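/- **Flowbox coordinates for supermanifolds.** Let $(M|\mathcal{R}M)$ be a smooth supermanifold of superdimension $(m|n)$ with $n\geq 1$: $M$ is a smooth Hausdorff $\sigma$-compact manifold of dimension $m$, and $\mathcal{R}M$ is a smooth bundle over $M$ of $\mathbb{Z}_2$-graded unital real algebras, locally trivial as such, with fibre the exterior algebra $\Lambda\mathbb{R}^n$. Let $\mathcal{R}^{\geq 1}M$ be the kernel of the fibrewise augmentation $\varepsilon$ and $\mathcal{R}^{\geq 2}M=(\mathcal{R}^{\geq 1}M)^2$; let $\mathbf{S}^*M=\mathcal{R}^{\geq 1}M/\mathcal{R}^{\geq 2}M$ be the bundle of odd codirections and $\mathbf{S}M$ its dual, the bundle of odd directions. Let $\operatorname{Der}(\mathcal{R}M)$ be the bundle whose sections are the superderivations of the superalgebra $\Gamma(\mathcal{R}M)$, with supercommutator $[\![D,E]\!]=DE-(-1)^{|D||E|}ED$. * Let $\operatorname{Conn}(\mathbf{S}M)$ be the set of connections on $\mathbf{S}M$. * Let $\operatorname{Inc}(M|\mathcal{R}M)$ be the set of $\mathbb{Z}_2$-graded inclusions $\psi$ of the bundle of generators $TM\oplus\mathbf{S}M$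 ($TM$ even, $\mathbf{S}M$ odd) into $\operatorname{Der}(\mathcal{R}M)$, that is, of parity-preserving bundle maps $\psi:TM\oplus \mathbf{S}M\to\operatorname{Der}(\mathcal{R}M)$ whose composition with the projection to $\operatorname{Der}(\mathcal{R}M)/\mathcal{R}^{\geq 1}M\cdot\operatorname{Der}(\mathcal{R}M)$ is injective in each fibre. (At $p$, the class of an even superderivation $D$ is given by the tangent vector $f\mapsto\varepsilon_p(Df)$, and that of an odd one by the odd direction $[\eta]\mapsto\varepsilon_p(D\eta)$, $\eta\in\Gamma(\mathcal{R}^{\geq 1}M)$.) * Let $\mathcal{S}(M|\mathcal{R}M)$ be the set of straightenings, i.e. of isomorphisms $\Psi:\Lambda\mathbf{S}^*M\to\mathcal{R}M$ of bundles of unital superalgebras. Let $\mathcal{P}$ be the set of pairs $(\psi,\nabla)\in\operatorname{Inc}(M|\mathcal{R}M)\times\operatorname{Conn}(\mathbf{S}M)$ such that 1. $[\![\psi(s),\psi(\tilde s)]\!]=0$ for all sections $s,\tilde s$ of $\mathbf{S}M$; 2. $[\![\psi(X),\psi(s)]\!]=\psi(\nabla_Xs)$ for every vector field $X$ on $M$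 and every section $s$ of $\mathbf{S}M$. Then there is exactly one bijection $\mathcal{P}\to\mathcal{S}(M|\mathcal{R}M)\times\operatorname{Conn}(\mathbf{S}M)$ of the form $(\psi,\nabla)\mapsto(\Psi,\nabla)$ such that 3. $\Psi(s\lrcorner\sigma)=\psi(s)(\Psi(\sigma))$ for all sections $s$ of $\mathbf{S}M$ and $\sigma$ of $\Lambda\mathbf{S}^*M$. (So, for each fixed connection $\nabla$, the inclusions $\psi$ satisfying 1 and 2 correspond bijectively to the straightenings $\Psi$.) Moreover, if $(\psi,\nabla)$ and $(\psi,\nabla')$ both belong to $\mathcal{P}$, then $\nabla=\nabla'$; hence the inclusions $\psi$ that satisfy 1, and 2 for some connection, correspond bijectively to the pairs $(\Psi,\nabla)$. -/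

import Mathlib

open scoped Manifold ContDiff Bundle Topology
open Bundle

noncomputable section

namespace Supermanifold

/-! ### Linear algebra of a single fibre -/

/-- The even (`i = 0`) and odd (`i = 1`) parts of the exterior algebra of `V`: the spans of the
products of an even, respectively odd, number of vectors. -/
abbrev extParity (V : Type*) [AddCommGroup V] [Module ℝ V] (i : ZMod 2) :
    Submodule ℝ (ExteriorAlgebra ℝ V) :=
  CliffordAlgebra.evenOdd (0 : QuadraticForm ℝ V) i

/-- The ideal `A^{≥1} = {η | ε(η) = 0}` of a free supercommutative algebra `A` with odd generators,
where `ε : A → ℝ` is the augmentation. The augmentation is the only unital algebra homomorphism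
`A → ℝ`, so we may intersect the kernels of all of these. -/
def nilIdeal (A : Type*) [Ring A] [Algebra ℝ A] : Submodule ℝ A :=
  ⨅ ε : A →ₐ[ℝ] ℝ, LinearMap.ker ε.toLinearMap

/-- The space `S^* = A^{≥1} / A^{≥2}` of odd codirections, where `A^{≥2} = (A^{≥1})^2`. -/
abbrev Codir (A : Type*) [Ring A] [Algebra ℝ A] : Type _ :=
  (nilIdeal A) ⧸ (nilIdeal A ^ 2).comap (nilIdeal A).subtype

/-- The space `S` of odd directions, the dual of `S^*`. -/
abbrev Dir (A : Type*) [Ring A] [Algebra ℝ A] : Type _ :=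
  Module.Dual ℝ (Codir A)

/-- The contraction `s ⌟ w` of `w ∈ Λ S^*` by `s ∈ S`. -/
abbrev contract {A : Type*} [Ring A] [Algebra ℝ A] (s : Dir A)
    (w : ExteriorAlgebra ℝ (Codir A)) : ExteriorAlgebra ℝ (Codir A) :=
  CliffordAlgebra.contractLeft (Q := (0 : QuadraticForm ℝ (Codir A))) s w

/-! ### Smooth functions acting on smooth sections -/

section Scalars

variable {m : ℕ} {M : Type*} [TopologicalSpace M] [ChartedSpace (EuclideanSpace ℝ (Fin m)) M]
  {F : Type*} [NormedAddCommGroup F] [NormedSpace ℝ F]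
  {V : M → Type*} [TopologicalSpace (TotalSpace F V)]
  [∀ p, AddCommGroup (V p)] [∀ p, Module ℝ (V p)] [∀ p, TopologicalSpace (V p)]
  [FiberBundle F V] [VectorBundle ℝ F V]

/-- `(f • s)(p) = f(p) s(p)` for a smooth function `f` and a smooth section `s`. -/
instance : SMul C^∞⟮𝓡 m, M; ℝ⟯ Cₛ^∞⟮𝓡 m; F, V⟯ where
  smul f s := ⟨fun p => f p • s p, f.contMDiff.smul_section s.contMDiff⟩

@[simp]
theorem smul_section_apply (f : C^∞⟮𝓡 m, M; ℝ⟯) (s : Cₛ^∞⟮𝓡 m; F, V⟯) (p : M) :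
    (f • s) p = f p • s p := rfl

instance : Module C^∞⟮𝓡 m, M; ℝ⟯ Cₛ^∞⟮𝓡 m; F, V⟯ where
  one_smul s := by ext p; exact one_smul ℝ (s p)
  mul_smul f g s := by ext p; exact mul_smul (f p) (g p) (s p)
  smul_zero f := by ext p; exact smul_zero (f p)
  smul_add f s t := by ext p; exact smul_add (f p) (s p) (t p)
  add_smul f g s := by ext p; exact add_smul (f p) (g p) (s p)
  zero_smul s := by ext p; exact zero_smul ℝ (s p)

instance : SMulCommClass ℝ C^∞⟮𝓡 m, M; ℝ⟯ Cₛ^∞⟮𝓡 m; F, V⟯ where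
  smul_comm c f s := by ext p; exact smul_comm c (f p) (s p)

end Scalars

/-- The smooth vector fields on `M`. -/
abbrev VectorField (m : ℕ) (M : Type*) [TopologicalSpace M]
    [ChartedSpace (EuclideanSpace ℝ (Fin m)) M] [IsManifold (𝓡 m) ∞ M] : Type _ :=
  Cₛ^∞⟮𝓡 m; EuclideanSpace ℝ (Fin m), (TangentSpace (𝓡 m) : M → Type _)⟯

section Bundle

variable (m : ℕ) {n : ℕ} {M : Type*} [TopologicalSpace M]
  [ChartedSpace (EuclideanSpace ℝ (Fin m)) M]
  (F : Type*) [NormedAddCommGroup F] [NormedSpace ℝ F]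
  (R : M → Type*) [TopologicalSpace (TotalSpace F R)]
  [∀ p, Ring (R p)] [∀ p, Algebra ℝ (R p)] [∀ p, TopologicalSpace (R p)] [FiberBundle F R]

/-- The (possibly discontinuous) section `η` of `R` is smooth on the set `U`. -/
abbrev SmoothOn (η : ∀ p, R p) (U : Set M) : Prop :=
  ContMDiffOn (𝓡 m) ((𝓡 m).prod 𝓘(ℝ, F)) ∞ (fun p => (⟨p, η p⟩ : TotalSpace F R)) U

/-- The structure of a smooth supermanifold `(M | R)` of superdimension `(m | n)` on a smooth vector
bundle `R` of algebras over the `m`-dimensional manifold `M`: every fibre is `ℤ₂`-graded, and `R` is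
locally isomorphic, by smooth families of isomorphisms of superalgebras, to the trivial bundle whose
fibre is the free supercommutative algebra `Λ ℝⁿ` on `n` odd generators. -/
class SuperalgebraBundle (n : outParam ℕ) where
  /-- the even part `parity p 0` and the odd part `parity p 1` of the fibre at `p` -/
  parity : ∀ p, ZMod 2 → Submodule ℝ (R p)
  locally_trivial : ∀ p₀ : M, ∃ U : Set M, IsOpen U ∧ p₀ ∈ U ∧
    ∃ φ : ∀ p, ExteriorAlgebra ℝ (Fin n → ℝ) ≃ₐ[ℝ] R p,
      (∀ p ∈ U, ∀ i, (extParity (Fin n → ℝ) i).map (φ p).toLinearMap = parity p i) ∧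
      ∀ a, SmoothOn m F R (fun p => φ p a) U

section One

variable {m F R}

theorem contMDiff_one [SuperalgebraBundle m F R n] :
    ContMDiff (𝓡 m) ((𝓡 m).prod 𝓘(ℝ, F)) ∞ (fun p => (⟨p, 1⟩ : TotalSpace F R)) := by
  intro p₀
  obtain ⟨U, hU, hp, φ, -, hφ⟩ := SuperalgebraBundle.locally_trivial (m := m) (F := F) (R := R) p₀
  simpa using (hφ 1).contMDiffAt (hU.mem_nhds hp)

instance [SuperalgebraBundle m F R n] : One Cₛ^∞⟮𝓡 m; F, R⟯ where
  one := ⟨fun _ => 1, contMDiff_one⟩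

@[simp]
theorem one_section_apply [SuperalgebraBundle m F R n] (p : M) :
    (1 : Cₛ^∞⟮𝓡 m; F, R⟯) p = 1 := rfl

end One

/-- The smooth sections of `R`, i.e. the superfunctions. -/
abbrev SuperFun : Type _ := Cₛ^∞⟮𝓡 m; F, R⟯

/-! ### Products of superfunctions are superfunctions -/

section Mul

variable {m F R} [VectorBundle ℝ F R]

/-- The coordinates of a smooth section in a smooth local frame are smooth. -/
theorem contMDiffAt_coord (p₀ : M) {U : Set M} (hU : IsOpen U)
    (hp : p₀ ∈ U) {W : Type*} [AddCommGroup W] [Module ℝ W] (φ : ∀ p, W ≃ₗ[ℝ] R p)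
    (hφ : ∀ a, SmoothOn m F R (fun p => φ p a) U) {ι : Type*} [Fintype ι]
    (b : Module.Basis ι ℝ W) (s : Cₛ^∞⟮𝓡 m; F, R⟯) (i : ι) :
    ContMDiffAt (𝓡 m) 𝓘(ℝ, ℝ) ∞ (fun p => b.repr ((φ p).symm (s p)) i) p₀ := by
  classical
  let e := trivializationAt F R p₀
  have he : p₀ ∈ e.baseSet := FiberBundle.mem_baseSet_trivializationAt' p₀
  let v : ι → M → F := fun i p => (e ⟨p, φ p (b i)⟩).2
  have hv : ∀ i, ContMDiffAt (𝓡 m) 𝓘(ℝ, F) ∞ (v i) p₀ := fun i =>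
    (contMDiffAt_section _).1 ((hφ (b i)).contMDiffAt (hU.mem_nhds hp))
  have hs : ContMDiffAt (𝓡 m) 𝓘(ℝ, F) ∞ (fun p => (e ⟨p, s p⟩).2) p₀ :=
    (contMDiffAt_section _).1 (s.contMDiff p₀)
  let T : M → (ι → ℝ) →L[ℝ] F := fun p =>
    ∑ i, (ContinuousLinearMap.proj (R := ℝ) (φ := fun _ : ι => ℝ) i).smulRight (v i p)
  have hT : ContMDiffAt (𝓡 m) 𝓘(ℝ, (ι → ℝ) →L[ℝ] F) ∞ T p₀ := by
    refine contMDiffAt_finsetSum fun i _ => ?_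
    exact ((ContinuousLinearMap.smulRightL ℝ (ι → ℝ) F
      (ContinuousLinearMap.proj (R := ℝ) (φ := fun _ : ι => ℝ) i)).contMDiff.contMDiffAt).comp p₀
        (hv i)
  let L : ∀ p, p ∈ e.baseSet → (ι → ℝ) ≃L[ℝ] F := fun p hpe =>
    ((b.equivFun.symm.trans (φ p)).trans
      (e.continuousLinearEquivAt ℝ p hpe).toLinearEquiv).toContinuousLinearEquiv
  have hL : ∀ p (hpe : p ∈ e.baseSet), (L p hpe : (ι → ℝ) →L[ℝ] F) = T p := by
    intro p hpe
    refine ContinuousLinearMap.ext fun c => ?_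
    have h2 : (L p hpe : (ι → ℝ) →L[ℝ] F) c =
        e.continuousLinearEquivAt ℝ p hpe (φ p (b.equivFun.symm c)) := rfl
    rw [h2, Module.Basis.equivFun_symm_apply, map_sum, map_sum]
    simp only [map_smul, T, FunLike.coe_sum, Finset.sum_apply,
      ContinuousLinearMap.smulRight_apply, ContinuousLinearMap.proj_apply]
    rfl
  have hinv : ContMDiffAt (𝓡 m) 𝓘(ℝ, F →L[ℝ] (ι → ℝ)) ∞
      (fun p => ContinuousLinearMap.inverse (T p)) p₀ := by
    have := contDiffAt_map_inverse (n := ∞) (𝕜 := ℝ) (L p₀ he)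
    rw [hL p₀ he] at this
    exact this.contMDiffAt.comp p₀ hT
  have hc : ContMDiffAt (𝓡 m) 𝓘(ℝ, ι → ℝ) ∞
      (fun p => ContinuousLinearMap.inverse (T p) (e ⟨p, s p⟩).2) p₀ := hinv.clm_apply hs
  have hc' : ContMDiffAt (𝓡 m) 𝓘(ℝ, ℝ) ∞
      (fun p => ContinuousLinearMap.inverse (T p) (e ⟨p, s p⟩).2 i) p₀ :=
    ((ContinuousLinearMap.proj (R := ℝ) (φ := fun _ : ι => ℝ) i).contMDiff.contMDiffAt).comp p₀ hc
  refine hc'.congr_of_eventuallyEq ?_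
  filter_upwards [e.open_baseSet.mem_nhds he] with p hpe
  rw [← hL p hpe, ContinuousLinearMap.inverse_equiv]
  have h1 : (e ⟨p, s p⟩).2 = L p hpe (b.equivFun ((φ p).symm (s p))) := by
    simp [L]
  rw [h1]
  simp

theorem contMDiff_mul [FiniteDimensional ℝ F] [SuperalgebraBundle m F R n] (s t : Cₛ^∞⟮𝓡 m; F, R⟯) :
    ContMDiff (𝓡 m) ((𝓡 m).prod 𝓘(ℝ, F)) ∞ (fun p => (⟨p, s p * t p⟩ : TotalSpace F R)) := by
  intro p₀
  obtain ⟨U, hU, hp, φ, -, hφ⟩ := SuperalgebraBundle.locally_trivial (m := m) (F := F) (R := R) p₀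
  have : Module.Finite ℝ (R p₀) := Module.Finite.equiv ((trivializationAt F R p₀).continuousLinearEquivAt ℝ p₀
    (FiberBundle.mem_baseSet_trivializationAt' p₀)).toLinearEquiv.symm
  have : Module.Finite ℝ (ExteriorAlgebra ℝ (Fin n → ℝ)) :=
    Module.Finite.equiv (φ p₀).toLinearEquiv.symm
  let b := Module.finBasis ℝ (ExteriorAlgebra ℝ (Fin n → ℝ))
  have hc := contMDiffAt_coord p₀ hU hp (fun p => (φ p).toLinearEquiv) hφ b
  have key : ∀ p, s p * t p = ∑ i, ∑ j, (b.repr ((φ p).symm (s p)) i *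
      b.repr ((φ p).symm (t p)) j) • φ p (b i * b j) := by
    intro p
    have h : ∀ x : R p, x = ∑ i, b.repr ((φ p).symm x) i • φ p (b i) := by
      intro x
      conv_lhs => rw [← (φ p).apply_symm_apply x, ← b.sum_repr ((φ p).symm x)]
      simp only [map_sum, map_smul]
    conv_lhs => rw [h (s p), h (t p)]
    simp only [Finset.sum_mul, Finset.mul_sum, map_mul, smul_mul_smul_comm]
    exact Finset.sum_comm
  simp only [key]
  refine ContMDiffAt.sum_section fun i _ => ContMDiffAt.sum_section fun j _ => ?_
  exact ContMDiffAt.smul_section ((hc s i).mul (hc t j))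
    ((hφ (b i * b j)).contMDiffAt (hU.mem_nhds hp))

instance [FiniteDimensional ℝ F] [SuperalgebraBundle m F R n] : Mul Cₛ^∞⟮𝓡 m; F, R⟯ where
  mul s t := ⟨fun p => s p * t p, contMDiff_mul s t⟩

@[simp]
theorem mul_section_apply [FiniteDimensional ℝ F] [SuperalgebraBundle m F R n] (s t : Cₛ^∞⟮𝓡 m; F, R⟯) (p : M) :
    (s * t) p = s p * t p := rfl

end Mul

/-! ### Smooth sections of the bundles `S^*M`, `SM` and `Λ S^*M` -/

/-- Smoothness of a section of the quotient bundle `S^*M = R^{≥1} / R^{≥2}`: local liftability to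
smooth sections of `R^{≥1}`. -/
def IsSmoothCodir (σ : ∀ p, Codir (R p)) : Prop :=
  ∀ p₀ : M, ∃ U : Set M, IsOpen U ∧ p₀ ∈ U ∧ ∃ η : ∀ p, nilIdeal (R p),
    SmoothOn m F R (fun p => (η p : R p)) U ∧ ∀ p ∈ U, σ p = Submodule.Quotient.mk (η p)

/-- Smoothness of a section of the dual bundle `SM` of `S^*M`. -/
def IsSmoothDir (s : ∀ p, Dir (R p)) : Prop :=
  ∀ σ, IsSmoothCodir m F R σ → ContMDiff (𝓡 m) 𝓘(ℝ, ℝ) ∞ (fun p => s p (σ p))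

/-- Smoothness of a section of the exterior bundle `Λ S^*M`: locally, it is a polynomial in smooth
sections of `S^*M` whose coefficients are smooth functions. -/
def IsSmoothExt (w : ∀ p, ExteriorAlgebra ℝ (Codir (R p))) : Prop :=
  ∀ p₀ : M, ∃ U : Set M, IsOpen U ∧ p₀ ∈ U ∧
    ∃ τ ∈ Algebra.adjoin ℝ
      ({τ : ∀ p, ExteriorAlgebra ℝ (Codir (R p)) |
          ∃ f : C^∞⟮𝓡 m, M; ℝ⟯, ∀ p, τ p = algebraMap ℝ _ (f p)} ∪
        {τ | ∃ σ, IsSmoothCodir m F R σ ∧ ∀ p, τ p = ExteriorAlgebra.ι ℝ (σ p)}),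
      ∀ p ∈ U, w p = τ p

/-- The space `Γ(SM)` of smooth sections of the bundle of odd directions. -/
def OddSection : Submodule ℝ (∀ p, Dir (R p)) where
  carrier := {s | IsSmoothDir m F R s}
  add_mem' hs ht σ hσ := (hs σ hσ).add (ht σ hσ)
  zero_mem' _ _ := contMDiff_const
  smul_mem' _ _ hs σ hσ := contMDiff_const.mul (hs σ hσ)

instance : SMul C^∞⟮𝓡 m, M; ℝ⟯ (OddSection m F R) where
  smul f s := ⟨fun p => f p • s.1 p, fun σ hσ => f.contMDiff.mul (s.2 σ hσ)⟩

@[simp]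
theorem smul_oddSection_apply (f : C^∞⟮𝓡 m, M; ℝ⟯) (s : OddSection m F R) (p : M) :
    (f • s).1 p = f p • s.1 p := rfl

instance : Module C^∞⟮𝓡 m, M; ℝ⟯ (OddSection m F R) where
  one_smul s := by ext1; funext p; exact one_smul ℝ (s.1 p)
  mul_smul f g s := by ext1; funext p; exact mul_smul (f p) (g p) (s.1 p)
  smul_zero f := by ext1; funext p; exact smul_zero (f p)
  smul_add f s t := by ext1; funext p; exact smul_add (f p) (s.1 p) (t.1 p)
  add_smul f g s := by ext1; funext p; exact add_smul (f p) (g p) (s.1 p)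
  zero_smul s := by ext1; funext p; exact zero_smul ℝ (s.1 p)

instance : SMulCommClass ℝ C^∞⟮𝓡 m, M; ℝ⟯ (OddSection m F R) where
  smul_comm c f s := by ext1; funext p; exact smul_comm c (f p) (s.1 p)

/-! ### Connections -/

/-- The derivative `X(f)` of the smooth function `f` along the vector field `X`, at the point `p`. -/
def lieDeriv [IsManifold (𝓡 m) ∞ M] (X : VectorField m M) (f : C^∞⟮𝓡 m, M; ℝ⟯) (p : M) : ℝ :=
  mfderiv (𝓡 m) 𝓘(ℝ, ℝ) f p (X p)

/-- A connection `∇` on `SM`: a rule `(X, s) ↦ ∇_X s`, linear over the smooth functions in `X`,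
additive in `s` and with `∇_X (f s) = X(f) s + f ∇_X s`. -/
@[ext]
structure Connection [IsManifold (𝓡 m) ∞ M] where
  toFun : VectorField m M →ₗ[C^∞⟮𝓡 m, M; ℝ⟯] (OddSection m F R →ₗ[ℝ] OddSection m F R)
  leibniz : ∀ (X : VectorField m M) (f : C^∞⟮𝓡 m, M; ℝ⟯) (s : OddSection m F R) (p : M),
    (toFun X (f • s)).1 p = lieDeriv m X f p • s.1 p + f p • (toFun X s).1 p

/-! ### Superderivations -/

section Derivations

variable [VectorBundle ℝ F R] [FiniteDimensional ℝ F] [SuperalgebraBundle m F R n]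

/-- The superfunction `η` is homogeneous of parity `i`. -/
def IsHomogeneous (i : ZMod 2) (η : SuperFun m F R) : Prop :=
  ∀ p, η p ∈ SuperalgebraBundle.parity m F (R := R) p i

/-- The sign `(-1)^{ij}`. -/
def sgn (i j : ZMod 2) : ℝ := (-1) ^ (i.val * j.val)

/-- The superderivations of parity `i` of the algebra of superfunctions, i.e. the sections of
`Der_i(R)`. They form a module over the smooth functions by `(f • D)(η) = f • D(η)`. -/
def SuperDer (i : ZMod 2) :
    Submodule C^∞⟮𝓡 m, M; ℝ⟯ (SuperFun m F R →ₗ[ℝ] SuperFun m F R) where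
  carrier := {D |
    (∀ j η, IsHomogeneous m F R j η → IsHomogeneous m F R (i + j) (D η)) ∧
    ∀ j η θ, IsHomogeneous m F R j η → D (η * θ) = D η * θ + sgn i j • (η * D θ)}
  add_mem' := by
    rintro D E ⟨hD, hD'⟩ ⟨hE, hE'⟩
    refine ⟨fun j η h p => add_mem (hD j η h p) (hE j η h p), fun j η θ h => ?_⟩
    ext p
    simp [hD' j η θ h, hE' j η θ h, add_mul, mul_add]
    abel
  zero_mem' := by
    refine ⟨fun j η h p => zero_mem _, fun j η θ h => ?_⟩
    ext p
    simp
  smul_mem' := by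
    rintro f D ⟨hD, hD'⟩
    refine ⟨fun j η h p => Submodule.smul_mem _ (f p) (hD j η h p), fun j η θ h => ?_⟩
    ext p
    simp [hD' j η θ h, smul_comm (f p) (sgn i j)]

/-- The supercommutator `⟦D, E⟧ = D ∘ E - (-1)^{ij} E ∘ D` of operators `D`, `E` on superfunctions,
of parities `i` and `j`. -/
def superBracket (i j : ZMod 2) (D E : SuperFun m F R →ₗ[ℝ] SuperFun m F R) :
    SuperFun m F R →ₗ[ℝ] SuperFun m F R :=
  D ∘ₗ E - sgn i j • (E ∘ₗ D)

/-! ### Inclusions and straightenings -/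

variable [IsManifold (𝓡 m) ∞ M]

/-- A `ℤ₂`-graded inclusion `ψ : TM ⊕ SM ↪ Der(R)` of the bundle of generators into the bundle of
superderivations. Bundle maps are given by their action on smooth sections, which is linear over
the smooth functions; `TM` is even and `SM` is odd. The two injectivity conditions express that the
induced map to the bundle `Der(R) / R^{≥1} Der(R)` of generators is injective in every fibre:
at `p`, the class of an even superderivation `D` is the tangent vector `f ↦ ε(D f)(p)`, and
that of an odd superderivation `D` is the odd direction `[η] ↦ ε(D η)(p)`, for sections `η` of
`R^{≥1}`. -/
@[ext]
structure Inclusion where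
  even : VectorField m M →ₗ[C^∞⟮𝓡 m, M; ℝ⟯] SuperDer m F R 0
  odd : OddSection m F R →ₗ[C^∞⟮𝓡 m, M; ℝ⟯] SuperDer m F R 1
  even_injective : ∀ (X : VectorField m M) (p : M),
    (∀ f : C^∞⟮𝓡 m, M; ℝ⟯, (even X).1 (f • 1) p ∈ nilIdeal (R p)) → X p = 0
  odd_injective : ∀ (s : OddSection m F R) (p : M),
    (∀ η : SuperFun m F R, (∀ q, η q ∈ nilIdeal (R q)) → (odd s).1 η p ∈ nilIdeal (R p)) →
      s.1 p = 0

/-- A straightening: an isomorphism `Ψ : Λ S^*M ≅ R` of bundles of unital superalgebras. -/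
@[ext]
structure Straightening where
  toFun : ∀ p, ExteriorAlgebra ℝ (Codir (R p)) ≃ₐ[ℝ] R p
  map_parity : ∀ p i, ∀ x ∈ extParity (Codir (R p)) i,
    toFun p x ∈ SuperalgebraBundle.parity m F (R := R) p i
  smooth_iff : ∀ w, IsSmoothExt m F R w ↔ SmoothOn m F R (fun p => toFun p (w p)) Set.univ

variable {m F R}

/-- `⟦ψ(s), ψ(s')⟧ = 0` for all sections `s`, `s'` of `SM`. -/
def Inclusion.OddCommute (ψ : Inclusion m F R) : Prop :=
  ∀ s s' : OddSection m F R, superBracket m F R 1 1 (ψ.odd s).1 (ψ.odd s').1 = 0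

/-- `⟦ψ(X), ψ(s)⟧ = ψ(∇_X s)` for all vector fields `X` and sections `s` of `SM`. -/
def Inclusion.Compatible (ψ : Inclusion m F R) (nabla : Connection m F R) : Prop :=
  ∀ (X : VectorField m M) (s : OddSection m F R),
    superBracket m F R 0 1 (ψ.even X).1 (ψ.odd s).1 = (ψ.odd (nabla.toFun X s)).1

/-- The smooth section `Ψ(w)` of `R`, for a smooth section `w` of `Λ S^*M`. -/
def Straightening.map (Ψ : Straightening m F R) (w : ∀ p, ExteriorAlgebra ℝ (Codir (R p)))
    (hw : IsSmoothExt m F R w) : SuperFun m F R :=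
  ⟨fun p => Ψ.toFun p (w p), contMDiffOn_univ.1 ((Ψ.smooth_iff w).1 hw)⟩

/-- `Ψ(s ⌟ w) = ψ(s)(Ψ(w))` for all sections `s` of `SM` and `w` of `Λ S^*M`. -/
def Straightening.Intertwines (Ψ : Straightening m F R) (ψ : Inclusion m F R) : Prop :=
  ∀ (s : OddSection m F R) (w : ∀ p, ExteriorAlgebra ℝ (Codir (R p)))
    (hw : IsSmoothExt m F R w) (p : M),
    Ψ.toFun p (contract (s.1 p) (w p)) = (ψ.odd s).1 (Ψ.map w hw) p

end Derivations
end Bundle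
end Supermanifold

end

/-! Write `D_s` for `ψ(s)`. Replacing `t` by `f t` in `D_s D_t + D_t D_s = 0` gives `D_s(f) · D_t η
= 0`. Since `n ≥ 1` and `ψ` is injective on odd directions, `D_t η` can be made invertible at any
given point, so `D_s` kills functions (`OddCommute.odd_smul_one`). Hence the `D_s` act fibre by
fibre, as a full space of anticommuting odd superderivations of an exterior algebra, and the
construction of `Ψ` becomes algebra in one fibre.

The algebra rests on one rigidity lemma, `eq_bot_of_stable`: a subspace of the augmentation ideal
`N` that is stable under a full set of odd superderivations `d_i` is zero. The Euler operator `Q = ∑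
e_i d_i` acts on `N^k / N^(k+1)` as multiplication by `k`, so a stable subspace of `N^k` lies in
`N^(k+1)`, and `N` is nilpotent. With a dimension count it makes the pairing `(w, a) ↦ ε(D_w a)`
between `Λ S` and the fibre perfect, so `D_s x = σ(s)` is solvable for every codirection `σ`
(`exists_forall_der_eq`). The odd parts of the solutions generate the fibre and define `Ψ`
(`exists_straightening_of_der`).

Conversely, `(Ψ, ∇)` yields an inclusion: transport by `Ψ` the contractions and the covariant
derivative which the dual of `∇` induces on `Λ S^*`. Condition 2 is then the Leibniz rule for `∇`
and contraction (`covDer_oddOp`).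

Uniqueness is rigidity again. Two straightenings with the same `ψ` differ by an operator that
commutes with all contractions and has nilpotent values. Two choices of `ψ(X)` for the same `Ψ` and
`∇` differ by an even superderivation commuting with all `D_s`; it kills functions by the argument
above, so it is fibrewise, and it has nilpotent values (`superDer_eq_zero_of_commute`). Finally `ψ`
determines `∇`, because `ψ` is injective on odd sections.

Smoothness of fibrewise constructions comes from `isSmoothSection_of_der`: if `ε(u)` and all `D_s u`
are smooth, then the coordinates of `u` solve an overdetermined smooth linear system with trivial
kernel. -/

noncomputable section

set_option linter.unusedSectionVars false

namespace Supermanifold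

/-! ### Exterior algebra: augmentation, nilpotence, odd superderivations -/

section Exterior

variable {V : Type*} [AddCommGroup V] [Module ℝ V]

/-- The augmentation of the exterior algebra. -/
abbrev aug : ExteriorAlgebra ℝ V →ₐ[ℝ] ℝ := ExteriorAlgebra.algebraMapInv

/-- The parity involution of the exterior algebra. -/
abbrev invol : ExteriorAlgebra ℝ V →ₐ[ℝ] ExteriorAlgebra ℝ V :=
  CliffordAlgebra.involute (Q := (0 : QuadraticForm ℝ V))

@[simp]
theorem aug_ι (v : V) : aug (ExteriorAlgebra.ι ℝ v) = 0 := by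
  simp [aug, ExteriorAlgebra.algebraMapInv]

theorem aug_algebraMap (r : ℝ) : aug (algebraMap ℝ (ExteriorAlgebra ℝ V) r) = r :=
  (aug (V := V)).commutes r

@[simp]
theorem invol_ι (v : V) : invol (ExteriorAlgebra.ι ℝ v) = -ExteriorAlgebra.ι ℝ v :=
  CliffordAlgebra.involute_ι v

theorem invol_invol (a : ExteriorAlgebra ℝ V) : invol (invol a) = a :=
  CliffordAlgebra.involute_involute a

@[simp]
theorem aug_invol (a : ExteriorAlgebra ℝ V) : aug (invol a) = aug a := by
  have : (aug (V := V)).comp invol = aug := by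
    ext v
    simp
  exact congrArg (fun f => f a) this

/-- A vector squares to zero, so every homomorphism to the reals kills it. This makes the
augmentation canonical and independent of all trivializations. -/
theorem algHom_eq_aug (f : ExteriorAlgebra ℝ V →ₐ[ℝ] ℝ) : f = aug := by
  refine ExteriorAlgebra.hom_ext (LinearMap.ext fun v => ?_)
  have h := mul_self_eq_zero.1 (ExteriorAlgebra.comp_ι_sq_zero f v)
  exact h.trans (aug_ι v).symm

theorem nilIdeal_exterior : nilIdeal (ExteriorAlgebra ℝ V) = LinearMap.ker (aug (V := V)).toLinearMap :=
  le_antisymm (iInf_le _ _) (le_iInf fun f => by rw [algHom_eq_aug f])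

@[simp]
theorem mem_nilIdeal_exterior {a : ExteriorAlgebra ℝ V} :
    a ∈ nilIdeal (ExteriorAlgebra ℝ V) ↔ aug a = 0 := by
  rw [nilIdeal_exterior]; rfl

theorem ι_mem_nilIdeal (v : V) : ExteriorAlgebra.ι ℝ v ∈ nilIdeal (ExteriorAlgebra ℝ V) := by
  simp

theorem mul_ι_eq (a : ExteriorAlgebra ℝ V) (v : V) :
    a * ExteriorAlgebra.ι ℝ v = ExteriorAlgebra.ι ℝ v * invol a := by
  induction a using ExteriorAlgebra.induction with
  | algebraMap r => rw [AlgHom.commutes]; exact Algebra.commutes r _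
  | ι x => rw [invol_ι, mul_neg, eq_neg_iff_add_eq_zero, ExteriorAlgebra.ι_add_mul_swap]
  | mul a b ha hb => rw [map_mul, mul_assoc, hb, ← mul_assoc, ha, mul_assoc]
  | add a b ha hb => rw [map_add, add_mul, mul_add, ha, hb]

theorem sub_aug_mem (a : ExteriorAlgebra ℝ V) :
    a - algebraMap ℝ _ (aug a) ∈
      LinearMap.range (ExteriorAlgebra.ι ℝ (M := V)) * (⊤ : Submodule ℝ (ExteriorAlgebra ℝ V)) := by
  induction a using ExteriorAlgebra.induction with
  | algebraMap r => simp
  | ι x =>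
    rw [aug_ι, map_zero, sub_zero, ← mul_one (ExteriorAlgebra.ι ℝ x)]
    exact Submodule.mul_mem_mul ⟨x, rfl⟩ trivial
  | mul a b ha hb =>
    have h : a * b - algebraMap ℝ _ (aug (a * b)) =
        (a - algebraMap ℝ _ (aug a)) * b + aug a • (b - algebraMap ℝ _ (aug b)) := by
      rw [map_mul, map_mul, Algebra.smul_def, sub_mul, mul_sub]; abel
    rw [h]
    refine add_mem ?_ (Submodule.smul_mem _ _ hb)
    have := Submodule.mul_mem_mul ha (Submodule.mem_top (x := b))
    rw [mul_assoc] at this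
    exact (mul_le_mul' le_rfl le_top :
      LinearMap.range (ExteriorAlgebra.ι ℝ (M := V)) * (⊤ * ⊤) ≤ _ * ⊤) this
  | add a b ha hb =>
    have h := add_mem ha hb
    rw [map_add, map_add]
    convert h using 1; abel

theorem top_mul_range_ι_le :
    (⊤ : Submodule ℝ (ExteriorAlgebra ℝ V)) * LinearMap.range (ExteriorAlgebra.ι ℝ (M := V)) ≤
      LinearMap.range (ExteriorAlgebra.ι ℝ (M := V)) * ⊤ := by
  rw [Submodule.mul_le]
  rintro a - _ ⟨v, rfl⟩
  rw [mul_ι_eq]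
  exact Submodule.mul_mem_mul ⟨v, rfl⟩ trivial

/-- The augmentation ideal is `ι(V) · Λ`, and vectors can be moved to the left past any element at
the cost of an involution; a product of `k` nilpotents thus collects `k` vectors in front. -/
theorem nilIdeal_pow_le (k : ℕ) : nilIdeal (ExteriorAlgebra ℝ V) ^ k ≤
    LinearMap.range (ExteriorAlgebra.ι ℝ (M := V)) ^ k * ⊤ := by
  have h1 : nilIdeal (ExteriorAlgebra ℝ V) ≤ LinearMap.range (ExteriorAlgebra.ι ℝ (M := V)) * ⊤ := by
    intro a ha
    have := sub_aug_mem a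
    rwa [mem_nilIdeal_exterior.1 ha, map_zero, sub_zero] at this
  have h2 : ∀ k : ℕ, (⊤ : Submodule ℝ (ExteriorAlgebra ℝ V)) *
      LinearMap.range (ExteriorAlgebra.ι ℝ (M := V)) ^ k ≤
      LinearMap.range (ExteriorAlgebra.ι ℝ (M := V)) ^ k * ⊤ := by
    intro k
    induction k with
    | zero => simp
    | succ k ih =>
      rw [pow_succ, ← mul_assoc]
      refine (mul_le_mul' ih le_rfl).trans ?_
      rw [mul_assoc, mul_assoc]
      exact mul_le_mul' le_rfl top_mul_range_ι_le
  induction k with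
  | zero => simp
  | succ k ih =>
    rw [pow_succ, pow_succ]
    refine (mul_le_mul' ih h1).trans ?_
    rw [mul_assoc, mul_assoc, ← mul_assoc ⊤]
    refine mul_le_mul' le_rfl ?_
    refine (mul_le_mul' top_mul_range_ι_le le_rfl).trans ?_
    rw [mul_assoc]
    exact mul_le_mul' le_rfl le_top

theorem nilIdeal_nilpotent [Module.Finite ℝ V] :
    ∃ k : ℕ, nilIdeal (ExteriorAlgebra ℝ V) ^ k = ⊥ := by
  refine ⟨Module.finrank ℝ V + 1, ?_⟩
  -- The exterior power of degree `dim V + 1` has rank `(dim V).choose (dim V + 1) = 0`.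
  have h : LinearMap.range (ExteriorAlgebra.ι ℝ (M := V)) ^ (Module.finrank ℝ V + 1) = ⊥ := by
    have := exteriorPower.finrank_eq (R := ℝ) (M := V) (n := Module.finrank ℝ V + 1)
    rw [Nat.choose_succ_self] at this
    exact Submodule.finrank_eq_zero.1 this
  rw [eq_bot_iff]
  refine (nilIdeal_pow_le _).trans ?_
  rw [h, Submodule.bot_mul]

instance [Module.Finite ℝ V] : Module.Finite ℝ (ExteriorAlgebra ℝ V) :=
  Module.Finite.of_basis (Module.finBasis ℝ V).ExteriorAlgebra

/-- An odd superderivation of the exterior algebra. -/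
def IsOddDer (d : ExteriorAlgebra ℝ V →ₗ[ℝ] ExteriorAlgebra ℝ V) : Prop :=
  ∀ a b, d (a * b) = d a * b + invol a * d b

theorem IsOddDer.map_one {d : ExteriorAlgebra ℝ V →ₗ[ℝ] ExteriorAlgebra ℝ V} (h : IsOddDer d) :
    d 1 = 0 := by
  simpa using h 1 1

theorem contract_mul (f : Module.Dual ℝ V) :
    IsOddDer (CliffordAlgebra.contractLeft (Q := (0 : QuadraticForm ℝ V)) f) := by
  intro a b
  induction a using ExteriorAlgebra.induction generalizing b with
  | algebraMap r =>
    rw [AlgHom.commutes]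
    erw [CliffordAlgebra.contractLeft_algebraMap_mul, CliffordAlgebra.contractLeft_algebraMap]
    simp
  | ι x =>
    rw [invol_ι]
    erw [CliffordAlgebra.contractLeft_ι_mul, CliffordAlgebra.contractLeft_ι]
    rw [Algebra.smul_def, neg_mul, sub_eq_add_neg]
  | mul a c ha hc =>
    rw [mul_assoc, ha, hc, ha c, map_mul, mul_add, add_mul]
    simp only [mul_assoc, add_assoc]
  | add a c ha hc => rw [add_mul, map_add, ha, hc, map_add, map_add, add_mul, add_mul]; abel

end Exterior

/-! ### The Euler operator, rigidity, and solvability of `D_s x = σ(s)` -/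

section Exterior

variable {V : Type*} [AddCommGroup V] [Module ℝ V]

theorem mul_mem_nilIdeal_right {a : ExteriorAlgebra ℝ V} (b : ExteriorAlgebra ℝ V)
    (ha : a ∈ nilIdeal (ExteriorAlgebra ℝ V)) : a * b ∈ nilIdeal (ExteriorAlgebra ℝ V) := by
  rw [mem_nilIdeal_exterior] at *
  rw [map_mul, ha, zero_mul]

/-- Modulo products, every nilpotent element of the exterior algebra is a generator. -/
theorem exists_ι_sub_mem (a : ExteriorAlgebra ℝ V) :
    ∃ v : V, a - algebraMap ℝ _ (aug a) - ExteriorAlgebra.ι ℝ v ∈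
      nilIdeal (ExteriorAlgebra ℝ V) ^ 2 := by
  induction a using ExteriorAlgebra.induction with
  | algebraMap r => exact ⟨0, by simp⟩
  | ι x => exact ⟨x, by simp⟩
  | mul a b ha hb =>
    obtain ⟨v, hv⟩ := ha
    obtain ⟨w, hw⟩ := hb
    refine ⟨aug b • v + aug a • w, ?_⟩
    have h1 : (a - algebraMap ℝ _ (aug a)) * (b - algebraMap ℝ _ (aug b)) ∈
        nilIdeal (ExteriorAlgebra ℝ V) ^ 2 := by
      rw [pow_two]
      exact Submodule.mul_mem_mul (by simp) (by simp)
    convert add_mem h1 (add_mem (Submodule.smul_mem _ (aug b) hv) (Submodule.smul_mem _ (aug a) hw))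
      using 1
    simp only [map_mul, map_add, map_smul, Algebra.smul_def, sub_mul, mul_sub]
    rw [Algebra.commutes (aug b) a, Algebra.commutes (aug b) (algebraMap ℝ _ (aug a))]
    abel
  | add a b ha hb =>
    obtain ⟨v, hv⟩ := ha
    obtain ⟨w, hw⟩ := hb
    refine ⟨v + w, ?_⟩
    convert add_mem hv hw using 1
    simp only [map_add]
    abel

/-- `ιInv` is the second component of a homomorphism to the trivial square-zero extension, whose
first component is the augmentation; there a product of two elements with zero first component
vanishes. -/
theorem ιInv_eq_zero_of_mem {a : ExteriorAlgebra ℝ V} (ha : a ∈ nilIdeal (ExteriorAlgebra ℝ V) ^ 2) :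
    ExteriorAlgebra.ιInv a = 0 := by
  let _ : Module ℝᵐᵒᵖ V := Module.compHom _ ((RingHom.id ℝ).fromOpposite mul_comm)
  have : IsCentralScalar ℝ V := ⟨fun r m => rfl⟩
  have h0 : ∀ x : ExteriorAlgebra ℝ V, (ExteriorAlgebra.toTrivSqZeroExt x).fst = aug x := by
    intro x
    exact congrArg (fun f => f x) (algHom_eq_aug
      ((TrivSqZeroExt.fstHom ℝ ℝ V).comp ExteriorAlgebra.toTrivSqZeroExt))
  rw [pow_two] at ha
  induction ha using Submodule.mul_induction_on' with
  | mem_mul_mem x hx y hy =>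
    change (ExteriorAlgebra.toTrivSqZeroExt (x * y)).snd = 0
    rw [map_mul, TrivSqZeroExt.snd_mul, h0, h0, mem_nilIdeal_exterior.1 hx,
      mem_nilIdeal_exterior.1 hy]
    simp
  | add x _ y _ hx hy => rw [map_add, hx, hy, add_zero]

theorem ιInv_mul_ι (a : ExteriorAlgebra ℝ V) (v : V) :
    ExteriorAlgebra.ιInv (a * ExteriorAlgebra.ι ℝ v) = aug a • v := by
  have h : (a - algebraMap ℝ _ (aug a)) * ExteriorAlgebra.ι ℝ v ∈
      nilIdeal (ExteriorAlgebra ℝ V) ^ 2 := by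
    rw [pow_two]
    exact Submodule.mul_mem_mul (by simp) (by simp)
  have h' := ιInv_eq_zero_of_mem h
  rw [sub_mul, map_sub, ← Algebra.smul_def, map_smul, sub_eq_zero] at h'
  rw [h']
  congr 1
  exact ExteriorAlgebra.ι_leftInverse v

section Euler

variable {Q : ExteriorAlgebra ℝ V →ₗ[ℝ] ExteriorAlgebra ℝ V}

/-- An even derivation that is the identity on `N / N²` acts on `N^k / N^(k+1)` as multiplication by
`k`, by the Leibniz rule. -/
theorem sub_smul_mem_pow_succ (hQ : ∀ a b, Q (a * b) = Q a * b + a * Q b)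
    (h1 : ∀ a ∈ nilIdeal (ExteriorAlgebra ℝ V), Q a - a ∈ nilIdeal (ExteriorAlgebra ℝ V) ^ 2)
    (k : ℕ) : ∀ a ∈ nilIdeal (ExteriorAlgebra ℝ V) ^ k,
      Q a - (k : ℝ) • a ∈ nilIdeal (ExteriorAlgebra ℝ V) ^ (k + 1) := by
  induction k with
  | zero =>
    intro a ha
    have hQ1 : Q 1 = 0 := by simpa using hQ 1 1
    rw [pow_zero, Submodule.mem_one] at ha
    obtain ⟨r, rfl⟩ := ha
    rw [Algebra.algebraMap_eq_smul_one, map_smul, hQ1]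
    simp
  | succ k ih =>
    intro a ha
    rw [pow_succ'] at ha
    induction ha using Submodule.mul_induction_on' with
    | mem_mul_mem x hx y hy =>
      have e : Q (x * y) - ((k + 1 : ℕ) : ℝ) • (x * y) =
          (Q x - x) * y + x * (Q y - (k : ℝ) • y) := by
        rw [hQ, sub_mul, mul_sub, mul_smul_comm, Nat.cast_succ, add_smul, one_smul]
        abel
      rw [e]
      refine add_mem ?_ ?_
      · have := Submodule.mul_mem_mul (h1 x hx) hy
        rwa [← pow_add, add_comm 2 k] at this
      · have := Submodule.mul_mem_mul hx (ih y hy)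
        rwa [← pow_succ'] at this
    | add x _ y _ hx hy =>
      convert add_mem hx hy using 1
      rw [map_add, smul_add]
      abel

end Euler

/-- Left multiplication by a vector turns an odd superderivation into an even derivation: moving `v`
past `a` cancels the involution in the signed Leibniz rule. -/
theorem IsOddDer.ι_mul (d : ExteriorAlgebra ℝ V →ₗ[ℝ] ExteriorAlgebra ℝ V) (hd : IsOddDer d)
    (v : V) (a b : ExteriorAlgebra ℝ V) :
    ExteriorAlgebra.ι ℝ v * d (a * b) =
      ExteriorAlgebra.ι ℝ v * d a * b + a * (ExteriorAlgebra.ι ℝ v * d b) := by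
  rw [hd, mul_add, ← mul_assoc, ← mul_assoc, ← mul_assoc, mul_ι_eq a v]

/-- A space of nilpotent elements which is stable under enough odd superderivations vanishes. -/
theorem eq_bot_of_stable [Module.Finite ℝ V] {K : Submodule ℝ (ExteriorAlgebra ℝ V)}
    (hK : K ≤ nilIdeal (ExteriorAlgebra ℝ V))
    (h : ∀ f : Module.Dual ℝ V, ∃ d : ExteriorAlgebra ℝ V →ₗ[ℝ] ExteriorAlgebra ℝ V, IsOddDer d ∧
      (∀ v, aug (d (ExteriorAlgebra.ι ℝ v)) = f v) ∧ ∀ a ∈ K, d a ∈ K) : K = ⊥ := by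
  classical
  let b := Module.finBasis ℝ V
  choose d hd hdv hdK using fun i => h (b.coord i)
  -- The Euler operator `∑ e_i d_i`, with `d_i` dual to `e_i` modulo nilpotents.
  let Q : ExteriorAlgebra ℝ V →ₗ[ℝ] ExteriorAlgebra ℝ V :=
    ∑ i, LinearMap.mulLeft ℝ (ExteriorAlgebra.ι ℝ (b i)) ∘ₗ d i
  have hQa : ∀ a, Q a = ∑ i, ExteriorAlgebra.ι ℝ (b i) * d i a := fun a => by simp [Q]
  have hQ : ∀ x y, Q (x * y) = Q x * y + x * Q y := by
    intro x y
    simp only [hQa, Finset.sum_mul, Finset.mul_sum, ← Finset.sum_add_distrib]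
    exact Finset.sum_congr rfl fun i _ => IsOddDer.ι_mul (d i) (hd i) (b i) x y
  have hQN : ∀ a, Q a ∈ nilIdeal (ExteriorAlgebra ℝ V) := fun a => by
    rw [hQa]
    exact sum_mem fun i _ => mul_mem_nilIdeal_right _ (ι_mem_nilIdeal _)
  have hQ1 : Q 1 = 0 := by simpa using hQ 1 1
  have h1 : ∀ a ∈ nilIdeal (ExteriorAlgebra ℝ V), Q a - a ∈ nilIdeal (ExteriorAlgebra ℝ V) ^ 2 := by
    have hsq : ∀ a ∈ nilIdeal (ExteriorAlgebra ℝ V) ^ 2,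
        Q a ∈ nilIdeal (ExteriorAlgebra ℝ V) ^ 2 := by
      intro a ha
      rw [pow_two] at ha ⊢
      induction ha using Submodule.mul_induction_on' with
      | mem_mul_mem x hx y hy =>
        rw [hQ]
        exact add_mem (Submodule.mul_mem_mul (hQN x) hy) (Submodule.mul_mem_mul hx (hQN y))
      | add x _ y _ hx hy => rw [map_add]; exact add_mem hx hy
    have hι : ∀ v, Q (ExteriorAlgebra.ι ℝ v) - ExteriorAlgebra.ι ℝ v ∈
        nilIdeal (ExteriorAlgebra ℝ V) ^ 2 := by
      intro v
      have e : Q (ExteriorAlgebra.ι ℝ v) - ExteriorAlgebra.ι ℝ v =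
          ∑ i, ExteriorAlgebra.ι ℝ (b i) *
            (d i (ExteriorAlgebra.ι ℝ v) - algebraMap ℝ _ (b.coord i v)) := by
        simp only [hQa, mul_sub, Finset.sum_sub_distrib]
        congr 1
        conv_lhs => rw [← b.sum_repr v, map_sum]
        refine Finset.sum_congr rfl fun i _ => ?_
        rw [← Algebra.commutes, ← Algebra.smul_def, map_smul, Module.Basis.coord_apply]
      rw [e, pow_two]
      refine sum_mem fun i _ => Submodule.mul_mem_mul (ι_mem_nilIdeal _) ?_
      rw [mem_nilIdeal_exterior, map_sub, hdv, aug_algebraMap, sub_self]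
    intro a ha
    obtain ⟨v, hv⟩ := exists_ι_sub_mem a
    rw [mem_nilIdeal_exterior.1 ha, map_zero, sub_zero] at hv
    have e : Q a - a = Q (a - ExteriorAlgebra.ι ℝ v) +
        (Q (ExteriorAlgebra.ι ℝ v) - ExteriorAlgebra.ι ℝ v) - (a - ExteriorAlgebra.ι ℝ v) := by
      rw [map_sub]; abel
    rw [e]
    exact sub_mem (add_mem (hsq _ hv) (hι v)) hv
  -- For `a ∈ K ⊆ N^(k+1)`, stability puts each `d_i a` in `K`, so `Q a ∈ N^(k+2)`. But `Q a ≡ (k+1)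
  -- a` modulo `N^(k+2)`, and `k + 1 ≠ 0`.
  have hpow : ∀ k : ℕ, K ≤ nilIdeal (ExteriorAlgebra ℝ V) ^ (k + 1) := by
    intro k
    induction k with
    | zero => simpa using hK
    | succ k ih =>
      intro a ha
      have h2 := sub_smul_mem_pow_succ hQ h1 (k + 1) a (ih ha)
      have h3 : Q a ∈ nilIdeal (ExteriorAlgebra ℝ V) ^ (k + 1 + 1) := by
        rw [hQa, pow_succ']
        exact sum_mem fun i _ => Submodule.mul_mem_mul (ι_mem_nilIdeal _) (ih (hdK i a ha))
      have h4 := sub_mem h3 h2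
      rw [sub_sub_cancel] at h4
      exact (Submodule.smul_mem_iff _ (by positivity)).1 h4
  obtain ⟨k, hk⟩ := nilIdeal_nilpotent (V := V)
  rw [eq_bot_iff, ← Submodule.bot_mul (nilIdeal (ExteriorAlgebra ℝ V)), ← hk, ← pow_succ]
  exact hpow k

/-- A space of nilpotent elements which is stable under all contractions vanishes. -/
theorem eq_bot_of_contract [Module.Finite ℝ V] {K : Submodule ℝ (ExteriorAlgebra ℝ V)}
    (hK : ∀ a ∈ K, aug a = 0)
    (h : ∀ (f : Module.Dual ℝ V), ∀ a ∈ K,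
      CliffordAlgebra.contractLeft (Q := (0 : QuadraticForm ℝ V)) f a ∈ K) : K = ⊥ := by
  refine eq_bot_of_stable (fun a ha => mem_nilIdeal_exterior.2 (hK a ha)) fun f =>
    ⟨CliffordAlgebra.contractLeft (Q := (0 : QuadraticForm ℝ V)) f, contract_mul f, fun v => ?_, h f⟩
  erw [CliffordAlgebra.contractLeft_ι]
  exact aug_algebraMap _

/-- Solvability of the system `D_s x = σ(s)`, for a full space of anticommuting odd
superderivations `D_s`. -/
theorem exists_forall_der_eq [Module.Finite ℝ V] {S : Type*} [AddCommGroup S] [Module ℝ S]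
    [Module.Finite ℝ S] (hS : Module.finrank ℝ S = Module.finrank ℝ V)
    (D : S →ₗ[ℝ] Module.End ℝ (ExteriorAlgebra ℝ V)) (hD : ∀ s, IsOddDer (D s))
    (hDD : ∀ s a, D s (D s a) = 0)
    (hB : ∀ f : Module.Dual ℝ V, ∃ s, ∀ v, aug (D s (ExteriorAlgebra.ι ℝ v)) = f v)
    (σ : Module.Dual ℝ S) : ∃ x, ∀ s, D s x = algebraMap ℝ _ (σ s) := by
  -- Since `D_s² = 0`, the exterior algebra of `S` acts through `D`. The map `T` below pairs it with
  -- `Λ V` by applying the operator and taking the augmentation.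
  let L : ExteriorAlgebra ℝ S →ₐ[ℝ] Module.End ℝ (ExteriorAlgebra ℝ V) :=
    ExteriorAlgebra.lift ℝ ⟨D, fun s => LinearMap.ext (hDD s)⟩
  have hL : ∀ s, L (ExteriorAlgebra.ι ℝ s) = D s := fun s => ExteriorAlgebra.lift_ι_apply _ _ _ _
  let T : ExteriorAlgebra ℝ V →ₗ[ℝ] Module.Dual ℝ (ExteriorAlgebra ℝ S) :=
    LinearMap.mk₂ ℝ (fun a w => aug (L w a)) (fun a b w => by simp) (fun c a w => by simp)
      (fun a w z => by simp) (fun c a w => by simp)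
  have hT : ∀ a w, T a w = aug (L w a) := fun a w => rfl
  have hTD : ∀ a w s, T (D s a) w = T a (w * ExteriorAlgebra.ι ℝ s) := by
    intro a w s
    rw [hT, hT, map_mul, hL]; rfl
  -- The kernel of `T` is nilpotent (pair with `w = 1`) and stable under every `D_s`, because `D_s`
  -- is adjoint to right multiplication by `s`. Rigidity applies.
  have hinj : LinearMap.ker T = ⊥ := by
    refine eq_bot_of_stable ?_ fun f => ?_
    · intro a ha
      rw [mem_nilIdeal_exterior]
      have := congrArg (fun φ => φ 1) (LinearMap.mem_ker.1 ha)
      simpa [hT] using this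
    · obtain ⟨s, hs⟩ := hB f
      refine ⟨D s, hD s, hs, fun a ha => ?_⟩
      rw [LinearMap.mem_ker] at ha ⊢
      refine LinearMap.ext fun w => ?_
      rw [hTD, ha]; rfl
  have hdim : Module.finrank ℝ (ExteriorAlgebra ℝ V) =
      Module.finrank ℝ (Module.Dual ℝ (ExteriorAlgebra ℝ S)) := by
    rw [Subspace.dual_finrank_eq, Module.finrank_eq_card_basis (Module.finBasis ℝ V).ExteriorAlgebra,
      Module.finrank_eq_card_basis (Module.finBasis ℝ S).ExteriorAlgebra]
    simp [hS]
  have hsurj := (LinearMap.injective_iff_surjective_of_finrank_eq_finrank hdim).1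
    (LinearMap.ker_eq_bot.1 hinj)
  -- The solution represents the functional "linear part, then `σ`". Paired with `w`, both `D_s x`
  -- and the scalar `σ(s)` give `ε(w) σ(s)`, since every `D_s` kills `1`.
  obtain ⟨x, hx⟩ := hsurj (σ ∘ₗ ExteriorAlgebra.ιInv)
  refine ⟨x, fun s => LinearMap.ker_eq_bot.1 hinj (LinearMap.ext fun w => ?_)⟩
  rw [hTD, hx, LinearMap.comp_apply, ιInv_mul_ι, map_smul, Algebra.algebraMap_eq_smul_one, map_smul,
    LinearMap.smul_apply, smul_eq_mul, smul_eq_mul, mul_comm]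
  congr 1
  have h1 : L w 1 = algebraMap ℝ _ (aug w) := by
    induction w using ExteriorAlgebra.induction with
    | algebraMap r =>
      rw [AlgHom.commutes, AlgHom.commutes, Algebra.algebraMap_eq_smul_one (A := Module.End ℝ _),
        Algebra.algebraMap_eq_smul_one]
      simp
    | ι s => rw [hL, (hD s).map_one, aug_ι, map_zero]
    | mul a c ha hc =>
      rw [map_mul, Module.End.mul_apply, hc, Algebra.algebraMap_eq_smul_one, map_smul, ha,
        map_mul, mul_comm, map_mul, Algebra.smul_def]
    | add a c ha hc => rw [map_add, LinearMap.add_apply, ha, hc, map_add, map_add]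
  rw [hT, h1, aug_algebraMap]

end Exterior

/-! ### Parity as an eigenspace condition for the involution -/

section Parity

variable {V : Type*} [AddCommGroup V] [Module ℝ V]

@[simp] theorem sgn_zero_left (j : ZMod 2) : sgn 0 j = 1 := by simp [sgn]

@[simp] theorem sgn_zero_right (j : ZMod 2) : sgn j 0 = 1 := by simp [sgn]

@[simp] theorem sgn_one_one : sgn 1 1 = -1 := by simp [sgn, ZMod.val_one]

theorem zmod_two_cases (i : ZMod 2) : i = 0 ∨ i = 1 := by revert i; decide

theorem exists_add_parity (a : ExteriorAlgebra ℝ V) :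
    ∃ x ∈ extParity V 0, ∃ y ∈ extParity V 1, x + y = a :=
  Submodule.mem_sup.1 ((CliffordAlgebra.evenOdd_isCompl (0 : QuadraticForm ℝ V)).sup_eq_top ▸
    Submodule.mem_top (x := a))

/-- The involution is `1` on the even and `-1` on the odd part, and these span everything. Parity
thus becomes an equation, which is easy to transport along maps. -/
theorem mem_extParity_iff {i : ZMod 2} {a : ExteriorAlgebra ℝ V} :
    a ∈ extParity V i ↔ invol a = sgn 1 i • a := by
  have h0 : ∀ x ∈ extParity V 0, invol x = x := fun x hx =>
    CliffordAlgebra.involute_eq_of_mem_even hx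
  have h1 : ∀ x ∈ extParity V 1, invol x = -x := fun x hx =>
    CliffordAlgebra.involute_eq_of_mem_odd hx
  obtain ⟨x, hx, y, hy, rfl⟩ := exists_add_parity a
  have hi := zmod_two_cases i
  constructor
  · intro h
    rcases hi with rfl | rfl
    · rw [h0 _ h, sgn_zero_right, one_smul]
    · rw [h1 _ h, sgn_one_one, neg_one_smul]
  · intro h
    rw [map_add, h0 x hx, h1 y hy] at h
    rcases hi with rfl | rfl
    · rw [sgn_zero_right, one_smul, add_right_inj, neg_eq_iff_add_eq_zero, ← two_smul ℝ,
        smul_eq_zero_iff_right two_ne_zero] at h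
      rw [h, add_zero]
      exact hx
    · rw [sgn_one_one, neg_one_smul, neg_add, add_left_inj, eq_neg_iff_add_eq_zero, ← two_smul ℝ,
        smul_eq_zero_iff_right two_ne_zero] at h
      rw [h, zero_add]
      exact hy

theorem sgn_one_add (i j : ZMod 2) : sgn 1 (i + j) = sgn 1 i * sgn 1 j := by
  rcases zmod_two_cases i with rfl | rfl <;> rcases zmod_two_cases j with rfl | rfl <;>
    simp [show (1 + 1 : ZMod 2) = 0 from rfl]

theorem extParity_inter {a : ExteriorAlgebra ℝ V} (h0 : a ∈ extParity V 0)
    (h1 : a ∈ extParity V 1) : a = 0 :=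
  Submodule.disjoint_def.1 (CliffordAlgebra.evenOdd_isCompl (0 : QuadraticForm ℝ V)).disjoint a h0 h1

theorem aug_eq_zero_of_odd {a : ExteriorAlgebra ℝ V} (h : a ∈ extParity V 1) : aug a = 0 := by
  rw [mem_extParity_iff, sgn_one_one, neg_one_smul] at h
  have := aug_invol a
  rw [h, map_neg] at this
  linarith

/-- Passing one vector applies the involution once, and an odd number of involutions amounts to one.
-/
theorem mul_odd_eq (a : ExteriorAlgebra ℝ V) {b : ExteriorAlgebra ℝ V} (hb : b ∈ extParity V 1) :
    a * b = b * invol a := by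
  induction b, hb using CliffordAlgebra.odd_induction generalizing a with
  | ι v => exact mul_ι_eq a v
  | add x y hx hy ihx ihy => rw [mul_add, ihx, ihy, add_mul]
  | ι_mul_ι_mul m₁ m₂ x hx ih =>
    have h1 := mul_ι_eq a m₁
    have h2 := mul_ι_eq (invol a) m₂
    rw [invol_invol] at h2
    calc a * (ExteriorAlgebra.ι ℝ m₁ * ExteriorAlgebra.ι ℝ m₂ * x)
        = (a * ExteriorAlgebra.ι ℝ m₁) * ExteriorAlgebra.ι ℝ m₂ * x := by simp only [mul_assoc]
      _ = ExteriorAlgebra.ι ℝ m₁ * (invol a * ExteriorAlgebra.ι ℝ m₂) * x := by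
        rw [h1]; simp only [mul_assoc]
      _ = ExteriorAlgebra.ι ℝ m₁ * ExteriorAlgebra.ι ℝ m₂ * (a * x) := by
        rw [h2]; simp only [mul_assoc]
      _ = _ := by rw [ih]; simp only [mul_assoc]

theorem mul_self_eq_zero_of_odd {a : ExteriorAlgebra ℝ V} (h : a ∈ extParity V 1) : a * a = 0 := by
  have h1 := mul_odd_eq a h
  rw [mem_extParity_iff.1 h, sgn_one_one, neg_one_smul, mul_neg, eq_neg_iff_add_eq_zero,
    ← two_smul ℝ, smul_eq_zero_iff_right two_ne_zero] at h1
  exact h1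

/-- An operator on the exterior algebra which commutes with all contractions and takes values in
the nilpotent elements vanishes. -/
theorem eq_zero_of_commute_contract [Module.Finite ℝ V]
    (H : ExteriorAlgebra ℝ V →ₗ[ℝ] ExteriorAlgebra ℝ V) (hH : ∀ w, aug (H w) = 0)
    (hc : ∀ (f : Module.Dual ℝ V) w,
      H (CliffordAlgebra.contractLeft (Q := (0 : QuadraticForm ℝ V)) f w) =
        CliffordAlgebra.contractLeft (Q := (0 : QuadraticForm ℝ V)) f (H w)) : H = 0 := by
  rw [← LinearMap.range_eq_bot]
  refine eq_bot_of_contract ?_ ?_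
  · rintro _ ⟨w, rfl⟩
    exact hH w
  · rintro f _ ⟨w, rfl⟩
    exact ⟨_, hc f w⟩

theorem eq_zero_of_contract_eq_zero [Module.Finite ℝ V] {a : ExteriorAlgebra ℝ V} (ha : aug a = 0)
    (h : ∀ f : Module.Dual ℝ V,
      CliffordAlgebra.contractLeft (Q := (0 : QuadraticForm ℝ V)) f a = 0) : a = 0 := by
  have : Submodule.span ℝ {a} = ⊥ := by
    refine eq_bot_of_contract ?_ ?_
    · intro x hx
      obtain ⟨c, rfl⟩ := Submodule.mem_span_singleton.1 hx
      rw [map_smul, ha, smul_zero]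
    · intro f x hx
      obtain ⟨c, rfl⟩ := Submodule.mem_span_singleton.1 hx
      rw [map_smul, h, smul_zero]
      exact zero_mem _
  exact Submodule.span_singleton_eq_bot.1 this

/-- Both sides are algebra homomorphisms in `x`, so it suffices to compare them on generators. -/
theorem map_ι_mem_of_odd {W : Type*} [AddCommGroup W] [Module ℝ W]
    {Φ : ExteriorAlgebra ℝ W →ₐ[ℝ] ExteriorAlgebra ℝ V}
    (h : ∀ w, Φ (ExteriorAlgebra.ι ℝ w) ∈ extParity V 1) (x : ExteriorAlgebra ℝ W) :
    Φ (invol x) = invol (Φ x) := by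
  have : Φ.comp invol = invol.comp Φ := by
    refine ExteriorAlgebra.hom_ext (LinearMap.ext fun w => ?_)
    have := mem_extParity_iff.1 (h w)
    rw [sgn_one_one, neg_one_smul] at this
    change Φ (invol (ExteriorAlgebra.ι ℝ w)) = invol (Φ (ExteriorAlgebra.ι ℝ w))
    rw [invol_ι, map_neg, this]
  exact congrArg (fun f => f x) this

end Parity

/-! ### One fibre: its codirections and its straightening -/

section Fibre

variable {V : Type*} [AddCommGroup V] [Module ℝ V] {A : Type*} [Ring A] [Algebra ℝ A]

theorem map_mem_map_iff {B C : Type*} [Ring B] [Algebra ℝ B] [Ring C] [Algebra ℝ C] (φ : B ≃ₐ[ℝ] C)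
    {S : Submodule ℝ B} {x : B} : φ x ∈ S.map φ.toAlgHom.toLinearMap ↔ x ∈ S :=
  ⟨fun ⟨_, hy, h⟩ => φ.injective h ▸ hy, fun h => ⟨x, h, rfl⟩⟩

@[simp]
theorem contract_algebraMap (s : Dir A) (r : ℝ) : contract s (algebraMap ℝ _ r) = 0 :=
  CliffordAlgebra.contractLeft_algebraMap _ s r

@[simp]
theorem contract_ι (s : Dir A) (σ : Codir A) :
    contract s (ExteriorAlgebra.ι ℝ σ) = algebraMap ℝ _ (s σ) :=
  CliffordAlgebra.contractLeft_ι _ s σ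

theorem contract_mul_apply (s : Dir A) (a b : ExteriorAlgebra ℝ (Codir A)) :
    contract s (a * b) = contract s a * b + invol a * contract s b :=
  contract_mul s a b

theorem contract_add (s : Dir A) (a b : ExteriorAlgebra ℝ (Codir A)) :
    contract s (a + b) = contract s a + contract s b :=
  map_add _ a b

theorem contract_smul (s : Dir A) (c : ℝ) (a : ExteriorAlgebra ℝ (Codir A)) :
    contract s (c • a) = c • contract s a :=
  map_smul _ c a

theorem contract_add_left (s t : Dir A) (a : ExteriorAlgebra ℝ (Codir A)) :
    contract (s + t) a = contract s a + contract t a := by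
  rw [contract, map_add]; rfl

theorem contract_smul_left (c : ℝ) (s : Dir A) (a : ExteriorAlgebra ℝ (Codir A)) :
    contract (c • s) a = c • contract s a := by
  rw [contract, map_smul]; rfl

theorem contract_comm (s t : Dir A) (a : ExteriorAlgebra ℝ (Codir A)) :
    contract s (contract t a) = -contract t (contract s a) :=
  CliffordAlgebra.contractLeft_comm _ _ a

theorem mem_nilIdeal_iff (φ : ExteriorAlgebra ℝ V ≃ₐ[ℝ] A) {a : A} :
    a ∈ nilIdeal A ↔ aug (φ.symm a) = 0 := by
  simp only [nilIdeal, Submodule.mem_iInf, LinearMap.mem_ker, AlgHom.toLinearMap_apply]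
  constructor
  · intro h
    exact h (aug.comp φ.symm.toAlgHom)
  · intro h f
    have := algHom_eq_aug (f.comp φ.toAlgHom)
    rw [← φ.apply_symm_apply a]
    exact (congrArg (fun g => g (φ.symm a)) this).trans h

/-- By uniqueness of the augmentation, it may be computed in any identification of the fibre with an
exterior algebra. -/
theorem aug_symm_eq {W : Type*} [AddCommGroup W] [Module ℝ W] (φ : ExteriorAlgebra ℝ V ≃ₐ[ℝ] A)
    (φ' : ExteriorAlgebra ℝ W ≃ₐ[ℝ] A) (a : A) : aug (φ.symm a) = aug (φ'.symm a) := by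
  have := algHom_eq_aug (aug.comp (φ'.symm.toAlgHom.comp φ.toAlgHom))
  have h := congrArg (fun g => g (φ.symm a)) this
  change aug (φ'.symm (φ (φ.symm a))) = aug (φ.symm a) at h
  rw [φ.apply_symm_apply] at h
  exact h.symm

theorem map_nilIdeal (φ : ExteriorAlgebra ℝ V ≃ₐ[ℝ] A) :
    (nilIdeal (ExteriorAlgebra ℝ V)).map φ.toAlgHom.toLinearMap = nilIdeal A := by
  ext a
  rw [Submodule.mem_map]
  constructor
  · rintro ⟨x, hx, rfl⟩
    rw [mem_nilIdeal_iff φ]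
    rw [mem_nilIdeal_exterior] at hx
    change aug (φ.symm (φ x)) = 0
    rw [φ.symm_apply_apply, hx]
  · intro h
    exact ⟨φ.symm a, mem_nilIdeal_exterior.2 ((mem_nilIdeal_iff φ).1 h), φ.apply_symm_apply a⟩

theorem mem_nilIdeal_sq_iff (φ : ExteriorAlgebra ℝ V ≃ₐ[ℝ] A) {x : ExteriorAlgebra ℝ V} :
    φ x ∈ nilIdeal A ^ 2 ↔ x ∈ nilIdeal (ExteriorAlgebra ℝ V) ^ 2 := by
  rw [← map_nilIdeal φ, ← Submodule.map_pow]
  exact map_mem_map_iff φ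

theorem map_ι_mem_nilIdeal (φ : ExteriorAlgebra ℝ V ≃ₐ[ℝ] A) (v : V) :
    φ (ExteriorAlgebra.ι ℝ v) ∈ nilIdeal A := by
  rw [mem_nilIdeal_iff φ, φ.symm_apply_apply, aug_ι]

/-- The codirections of a free supercommutative algebra are the classes of the generators. -/
def codirMap (φ : ExteriorAlgebra ℝ V ≃ₐ[ℝ] A) : V →ₗ[ℝ] Codir A :=
  Submodule.mkQ _ ∘ₗ LinearMap.codRestrict (nilIdeal A)
    (φ.toLinearMap ∘ₗ ExteriorAlgebra.ι ℝ) (map_ι_mem_nilIdeal φ)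

/-- A nilpotent element differs from its linear part by an element of `N²`, hence has the same
class. This yields surjectivity of `codirMap` and the formula for its inverse. -/
theorem codirMap_ιInv (φ : ExteriorAlgebra ℝ V ≃ₐ[ℝ] A) (η : nilIdeal A) :
    codirMap φ (ExteriorAlgebra.ιInv (φ.symm η)) = Submodule.Quotient.mk η := by
  obtain ⟨v, hv⟩ := exists_ι_sub_mem (φ.symm (η : A))
  rw [(mem_nilIdeal_iff φ).1 η.2, map_zero, sub_zero] at hv
  have h := ιInv_eq_zero_of_mem hv
  rw [map_sub, ExteriorAlgebra.ι_leftInverse v, sub_eq_zero] at h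
  rw [h]
  refine (Submodule.Quotient.eq _).2 ?_
  change φ (ExteriorAlgebra.ι ℝ v) - (η : A) ∈ nilIdeal A ^ 2
  rw [← φ.apply_symm_apply (η : A), ← map_sub, mem_nilIdeal_sq_iff, ← neg_mem_iff, neg_sub]
  exact hv

theorem codirMap_injective (φ : ExteriorAlgebra ℝ V ≃ₐ[ℝ] A) : Function.Injective (codirMap φ) := by
  rw [injective_iff_map_eq_zero]
  intro v hv
  have h : φ (ExteriorAlgebra.ι ℝ v) ∈ nilIdeal A ^ 2 := 
    (Submodule.Quotient.mk_eq_zero ((nilIdeal A ^ 2).comap (nilIdeal A).subtype)).1 hv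
  rw [mem_nilIdeal_sq_iff] at h
  exact (ExteriorAlgebra.ι_leftInverse v).symm.trans (ιInv_eq_zero_of_mem h)

theorem codirMap_surjective (φ : ExteriorAlgebra ℝ V ≃ₐ[ℝ] A) :
    Function.Surjective (codirMap φ) := fun σ => by
  obtain ⟨η, rfl⟩ := Submodule.Quotient.mk_surjective _ σ
  exact ⟨_, codirMap_ιInv φ η⟩

/-- The space of codirections of `A ≅ Λ V` is isomorphic to `V`. -/
def codirEquiv (φ : ExteriorAlgebra ℝ V ≃ₐ[ℝ] A) : V ≃ₗ[ℝ] Codir A :=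
  LinearEquiv.ofBijective (codirMap φ) ⟨codirMap_injective φ, codirMap_surjective φ⟩

theorem codirEquiv_apply (φ : ExteriorAlgebra ℝ V ≃ₐ[ℝ] A) (v : V) :
    codirEquiv φ v = Submodule.Quotient.mk ⟨φ (ExteriorAlgebra.ι ℝ v), map_ι_mem_nilIdeal φ v⟩ := rfl

theorem codirEquiv_symm_mk (φ : ExteriorAlgebra ℝ V ≃ₐ[ℝ] A) (η : nilIdeal A) :
    (codirEquiv φ).symm (Submodule.Quotient.mk η) = ExteriorAlgebra.ιInv (φ.symm η) := by
  rw [LinearEquiv.symm_apply_eq]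
  exact (codirMap_ιInv φ η).symm

/-- Contractions are natural. -/
theorem map_contract {W : Type*} [AddCommGroup W] [Module ℝ W] (κ : V →ₗ[ℝ] W)
    (s : Module.Dual ℝ W) (x : ExteriorAlgebra ℝ V) :
    CliffordAlgebra.contractLeft (Q := (0 : QuadraticForm ℝ W)) s (ExteriorAlgebra.map κ x) =
      ExteriorAlgebra.map κ
        (CliffordAlgebra.contractLeft (Q := (0 : QuadraticForm ℝ V)) (s ∘ₗ κ) x) := by
  have hinv : ∀ a, ExteriorAlgebra.map κ (invol a) = invol (ExteriorAlgebra.map κ a) :=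
    map_ι_mem_of_odd fun v => by
      rw [ExteriorAlgebra.map_apply_ι]
      exact CliffordAlgebra.ι_mem_evenOdd_one _ _
  induction x using ExteriorAlgebra.induction with
  | algebraMap r =>
    rw [AlgHom.commutes]
    erw [CliffordAlgebra.contractLeft_algebraMap, CliffordAlgebra.contractLeft_algebraMap]
    rw [map_zero]
  | ι v =>
    rw [ExteriorAlgebra.map_apply_ι]
    erw [CliffordAlgebra.contractLeft_ι, CliffordAlgebra.contractLeft_ι]
    exact (AlgHom.commutes _ _).symm
  | mul a b ha hb =>
    rw [map_mul, contract_mul s, contract_mul (s ∘ₗ κ), map_add, map_mul, map_mul, ha, hb, hinv]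
  | add a b ha hb => rw [map_add, map_add, ha, hb, map_add, map_add]

variable [Module.Finite ℝ V] {P : ZMod 2 → Submodule ℝ A}

/-- A full space of anticommuting odd superderivations of a free supercommutative algebra comes
from a unique straightening. -/
theorem exists_straightening_of_der (φ : ExteriorAlgebra ℝ V ≃ₐ[ℝ] A)
    (hφ : ∀ i, (extParity V i).map φ.toLinearMap = P i) (D : Dir A →ₗ[ℝ] Module.End ℝ A)
    (hpar : ∀ s j, ∀ a ∈ P j, D s a ∈ P (1 + j))
    (hleib : ∀ s j a b, a ∈ P j → D s (a * b) = D s a * b + sgn 1 j • (a * D s b))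
    (hDD : ∀ s a, D s (D s a) = 0)
    (hinj : ∀ s, (∀ a ∈ nilIdeal A, D s a ∈ nilIdeal A) → s = 0) :
    ∃ Ψ : ExteriorAlgebra ℝ (Codir A) ≃ₐ[ℝ] A,
      (∀ i, ∀ x ∈ extParity (Codir A) i, Ψ x ∈ P i) ∧
      ∀ s w, Ψ (contract s w) = D s (Ψ w) := by
  have : Module.Finite ℝ (Codir A) := Module.Finite.equiv (codirEquiv φ)
  have hmem : ∀ i x, φ x ∈ P i ↔ x ∈ extParity V i := by
    intro i x
    rw [← hφ i]
    exact map_mem_map_iff φ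
  let D' : Dir A →ₗ[ℝ] Module.End ℝ (ExteriorAlgebra ℝ V) :=
    φ.symm.toLinearEquiv.conj.toLinearMap ∘ₗ D
  have hD' : ∀ s x, D' s x = φ.symm (D s (φ x)) := fun s x => rfl
  have hpar' : ∀ s j, ∀ a ∈ extParity V j, D' s a ∈ extParity V (1 + j) := by
    intro s j a ha
    rw [← hmem, hD', φ.apply_symm_apply]
    exact hpar s j _ ((hmem j a).2 ha)
  have hodd : ∀ s, IsOddDer (D' s) := by
    intro s a b
    have key : ∀ j, ∀ x ∈ extParity V j, D' s (x * b) = D' s x * b + invol x * D' s b := by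
      intro j x hx
      rw [mem_extParity_iff.1 hx, hD', map_mul, hleib s j _ _ ((hmem j x).2 hx), map_add, map_mul,
        map_smul, map_mul, φ.symm_apply_apply, φ.symm_apply_apply, smul_mul_assoc]
      rfl
    obtain ⟨x, hx, y, hy, rfl⟩ := exists_add_parity a
    rw [add_mul, map_add, key 0 x hx, key 1 y hy, map_add, map_add, add_mul, add_mul]
    abel
  have hDD' : ∀ s a, D' s (D' s a) = 0 := fun s a => by
    rw [hD', hD', φ.apply_symm_apply, hDD, map_zero]
  have hfin : Module.finrank ℝ (Dir A) = Module.finrank ℝ V := by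
    rw [Subspace.dual_finrank_eq, (codirEquiv φ).finrank_eq]
  have hsq : ∀ s, ∀ x ∈ nilIdeal (ExteriorAlgebra ℝ V) ^ 2, aug (D' s x) = 0 := by
    intro s x hx
    rw [pow_two] at hx
    induction hx using Submodule.mul_induction_on' with
    | mem_mul_mem x hx y hy =>
      rw [mem_nilIdeal_exterior] at hx hy
      rw [hodd s, map_add, map_mul, map_mul, aug_invol, hx, hy, mul_zero, zero_mul, add_zero]
    | add x _ y _ hx hy => rw [map_add, map_add, hx, hy, add_zero]
  -- The map `s ↦ (v ↦ ε(D_s v))` is injective: an odd superderivation sends `N²` into `N`, so if it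
  -- also sends generators into `N` it sends all of `N` there, and `hinj` applies. Source and target
  -- have equal dimension.
  have hB : ∀ f : Module.Dual ℝ V, ∃ s, ∀ v, aug (D' s (ExteriorAlgebra.ι ℝ v)) = f v := by
    let β : Dir A →ₗ[ℝ] Module.Dual ℝ V :=
      LinearMap.mk₂ ℝ (fun s v => aug (D' s (ExteriorAlgebra.ι ℝ v)))
        (fun s t v => by simp) (fun c s v => by simp) (fun s v w => by simp) (fun c s v => by simp)
    have hβ : Function.Injective β := by
      rw [injective_iff_map_eq_zero]
      intro s hs
      refine hinj s fun a ha => ?_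
      rw [mem_nilIdeal_iff φ] at ha ⊢
      obtain ⟨v, hv⟩ := exists_ι_sub_mem (φ.symm a)
      rw [ha, map_zero, sub_zero] at hv
      have h1 := hsq s _ hv
      have h2 : aug (D' s (ExteriorAlgebra.ι ℝ v)) = 0 := congrArg (fun f => f v) hs
      rw [map_sub, map_sub, h2, sub_zero, hD', φ.apply_symm_apply] at h1
      exact h1
    have hsurj := (LinearMap.injective_iff_surjective_of_finrank_eq_finrank
      (hfin.trans Subspace.dual_finrank_eq.symm)).1 hβ
    intro f
    obtain ⟨s, rfl⟩ := hsurj f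
    exact ⟨s, fun v => rfl⟩
  -- Keep only the odd part `z` of a solution. For the even part `y`, `D_s y` is odd, but it is also
  -- a scalar minus the even element `D_s z`; so it vanishes.
  have hx : ∀ σ : Codir A, ∃ x ∈ extParity V 1, ∀ s, D' s x = algebraMap ℝ _ (s σ) := by
    intro σ
    obtain ⟨x, hx⟩ := exists_forall_der_eq hfin D' hodd hDD' hB (Module.Dual.eval ℝ _ σ)
    obtain ⟨y, hy, z, hz, rfl⟩ := exists_add_parity x
    refine ⟨z, hz, fun s => ?_⟩
    have h1 := hx s
    rw [map_add, ← eq_sub_iff_add_eq] at h1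
    have h2 : D' s z ∈ extParity V 0 := hpar' s 1 z hz
    have h3 : D' s y ∈ extParity V 1 := hpar' s 0 y hy
    have h4 : algebraMap ℝ _ (Module.Dual.eval ℝ _ σ s) ∈ extParity V 0 := by
      rw [mem_extParity_iff, AlgHom.commutes, sgn_zero_right, one_smul]
    have h5 : D' s y = 0 := extParity_inter (h1 ▸ sub_mem h4 h2) h3
    rw [h5, eq_comm, sub_eq_zero] at h1
    exact h1.symm
  let b := Module.finBasis ℝ (Codir A)
  choose x hxodd hxD using fun i => hx (b i)
  let ξ : Codir A →ₗ[ℝ] ExteriorAlgebra ℝ V := b.constr ℝ x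
  have hξ : ∀ σ, ξ σ = ∑ i, b.repr σ i • x i := fun σ => b.constr_apply_fintype ℝ x σ
  have hξodd : ∀ σ, ξ σ ∈ extParity V 1 := fun σ => by
    rw [hξ]
    exact sum_mem fun i _ => Submodule.smul_mem _ _ (hxodd i)
  have hξD : ∀ s σ, D' s (ξ σ) = algebraMap ℝ _ (s σ) := by
    intro s σ
    conv_rhs => rw [← b.sum_repr σ]
    rw [hξ, map_sum, map_sum, map_sum]
    refine Finset.sum_congr rfl fun i _ => ?_
    rw [map_smul, hxD, map_smul, smul_eq_mul, map_mul, Algebra.smul_def]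
  -- Odd elements square to zero, so the linear choice of odd solutions extends to the exterior
  -- algebra.
  let Φ : ExteriorAlgebra ℝ (Codir A) →ₐ[ℝ] ExteriorAlgebra ℝ V :=
    ExteriorAlgebra.lift ℝ ⟨ξ, fun σ => mul_self_eq_zero_of_odd (hξodd σ)⟩
  have hΦι : ∀ σ, Φ (ExteriorAlgebra.ι ℝ σ) = ξ σ := fun σ => ExteriorAlgebra.lift_ι_apply _ _ _ _
  have hΦinv : ∀ w, Φ (invol w) = invol (Φ w) :=
    map_ι_mem_of_odd fun σ => by rw [hΦι]; exact hξodd σ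
  have hΦD : ∀ s w, Φ (contract s w) = D' s (Φ w) := by
    intro s w
    induction w using ExteriorAlgebra.induction with
    | algebraMap r =>
      rw [contract_algebraMap, AlgHom.commutes, Algebra.algebraMap_eq_smul_one, map_smul,
        (hodd s).map_one, map_zero, smul_zero]
    | ι σ => rw [contract_ι, hΦι, hξD, AlgHom.commutes]
    | mul a c ha hc =>
      rw [map_mul, hodd s, ← ha, ← hc, ← hΦinv, ← map_mul, ← map_mul, ← map_add, contract_mul_apply]
    | add a c ha hc => rw [contract_add, map_add, ha, hc, map_add, map_add]
  have hΦaug : ∀ w, aug (Φ w) = aug w := fun w =>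
    congrArg (fun f => f w) (algHom_eq_aug (aug.comp Φ))
  -- The kernel is nilpotent, since `Φ` preserves the augmentation, and stable under contractions,
  -- since `Φ` intertwines them with `D'`.
  have hΦinj : Function.Injective Φ.toLinearMap := by
    rw [← LinearMap.ker_eq_bot]
    refine eq_bot_of_contract ?_ ?_
    · intro w hw
      rw [← hΦaug]
      exact (congrArg aug (LinearMap.mem_ker.1 hw)).trans (map_zero _)
    · intro s w hw
      rw [LinearMap.mem_ker] at hw ⊢
      exact (hΦD s w).trans ((congrArg (D' s) hw).trans (map_zero _))
  have hΦsurj : Function.Surjective Φ.toLinearMap :=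
    (LinearMap.injective_iff_surjective_of_finrank_eq_finrank (by
      rw [Module.finrank_eq_card_basis (Module.finBasis ℝ V).ExteriorAlgebra,
        Module.finrank_eq_card_basis b.ExteriorAlgebra]
      simp [(codirEquiv φ).finrank_eq])).1 hΦinj
  refine ⟨(AlgEquiv.ofBijective Φ ⟨hΦinj, hΦsurj⟩).trans φ, fun i w hw => ?_, fun s w => ?_⟩
  · refine (hmem i (Φ w)).2 ?_
    rw [mem_extParity_iff] at hw ⊢
    rw [← hΦinv, hw, map_smul]
  · change φ (Φ (contract s w)) = D s (φ (Φ w))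
    rw [hΦD, hD', φ.apply_symm_apply]

end Fibre

/-! ### Local frames with cutoff functions -/

section Frames

variable {m n : ℕ} {M : Type*} [TopologicalSpace M] [ChartedSpace (EuclideanSpace ℝ (Fin m)) M]
  {F : Type*} [NormedAddCommGroup F] [NormedSpace ℝ F]
  {R : M → Type*} [TopologicalSpace (TotalSpace F R)]
  [∀ p, Ring (R p)] [∀ p, Algebra ℝ (R p)] [∀ p, TopologicalSpace (R p)] [FiberBundle F R]
  [SuperalgebraBundle m F R n]

/-- The free supercommutative algebra on `n` odd generators. -/
abbrev Model (n : ℕ) : Type := ExteriorAlgebra ℝ (Fin n → ℝ)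

/-- A basis of the free supercommutative algebra on `n` odd generators. -/
def modelBasis (n : ℕ) : Module.Basis (Fin (Module.finrank ℝ (Model n))) ℝ (Model n) :=
  Module.finBasis ℝ (Model n)

variable (m F R) in
/-- A local trivialization of a bundle of superalgebras near `p₀`, with a cutoff function. -/
structure Frame (p₀ : M) where
  /-- the domain of the trivialization -/
  U : Set M
  isOpen : IsOpen U
  /-- the trivialization -/
  φ : ∀ p, Model n ≃ₐ[ℝ] R p
  parity_eq : ∀ p ∈ U, ∀ i, (extParity (Fin n → ℝ) i).map (φ p).toLinearMap =
    SuperalgebraBundle.parity m F (R := R) p i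
  smooth : ∀ a, SmoothOn m F R (fun p => φ p a) U
  /-- the cutoff function -/
  χ : C^∞⟮𝓡 m, M; ℝ⟯
  χ_eventually : ∀ᶠ p in 𝓝 p₀, χ p = 1
  tsupport_subset : tsupport χ ⊆ U

variable [VectorBundle ℝ F R] [FiniteDimensional ℝ F]

section Cutoff

variable [IsManifold (𝓡 m) ∞ M] [T2Space M] [SigmaCompactSpace M]

variable (m) in
theorem exists_cutoff {U : Set M} (hU : IsOpen U) {p₀ : M} (hp : p₀ ∈ U) :
    ∃ χ : C^∞⟮𝓡 m, M; ℝ⟯, (∀ᶠ p in 𝓝 p₀, χ p = 1) ∧ tsupport χ ⊆ U := by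
  have : LocallyCompactSpace M := ChartedSpace.locallyCompactSpace (EuclideanSpace ℝ (Fin m)) M
  obtain ⟨f, h0, h1, -⟩ := exists_contMDiffMap_zero_one_nhds_of_isClosed (𝓡 m) (n := ⊤)
    hU.isClosed_compl (isClosed_singleton (x := p₀)) (by simpa using hp)
  refine ⟨f, by simpa using h1, fun x hx => ?_⟩
  by_contra hxU
  have := Filter.Eventually.filter_mono (nhds_le_nhdsSet (show x ∈ Uᶜ from hxU)) h0
  exact (notMem_tsupport_iff_eventuallyEq.2 this) hx

variable (m F R) in
theorem nonempty_frame (p₀ : M) : Nonempty (Frame m F R p₀) := by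
  obtain ⟨U, hU, hp, φ, h1, h2⟩ :=
    SuperalgebraBundle.locally_trivial (m := m) (F := F) (R := R) p₀
  obtain ⟨χ, hχ, hs⟩ := exists_cutoff m hU hp
  exact ⟨⟨U, hU, φ, h1, h2, χ, hχ, hs⟩⟩

variable (m F R) in
/-- A chosen trivialization near `p`. -/
def frame (p : M) : Frame m F R p := (nonempty_frame m F R p).some

theorem exists_section_eventuallyEq {η : ∀ p, R p} {U : Set M} (hU : IsOpen U)
    (hη : SmoothOn m F R η U) {p₀ : M} (hp : p₀ ∈ U) :
    ∃ χ : C^∞⟮𝓡 m, M; ℝ⟯, (∀ᶠ p in 𝓝 p₀, χ p = 1) ∧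
      ∃ θ : SuperFun m F R, ∀ p, θ p = χ p • η p := by
  obtain ⟨χ, hχ, hs⟩ := exists_cutoff m hU hp
  exact ⟨χ, hχ, ⟨fun p => χ p • η p,
    ContMDiffOn.smul_section_of_tsupport χ.contMDiff.contMDiffOn hU hs hη⟩, fun p => rfl⟩

end Cutoff

namespace Frame

variable {p₀ : M} (fr : Frame m F R p₀)

@[simp]
theorem χ_self : fr.χ p₀ = 1 := fr.χ_eventually.self_of_nhds

theorem mem_of_ne {p : M} (h : fr.χ p ≠ 0) : p ∈ fr.U :=
  fr.tsupport_subset (subset_tsupport _ h)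

theorem mem : p₀ ∈ fr.U := fr.mem_of_ne (by simp)

/-- The section with constant coordinates `a` in the frame, cut off. -/
def ext : Model n →ₗ[ℝ] SuperFun m F R where
  toFun a := ⟨fun p => fr.χ p • fr.φ p a,
    ContMDiffOn.smul_section_of_tsupport fr.χ.contMDiff.contMDiffOn fr.isOpen fr.tsupport_subset
      (fr.smooth a)⟩
  map_add' a b := by
    ext p
    change fr.χ p • fr.φ p (a + b) = fr.χ p • fr.φ p a + fr.χ p • fr.φ p b
    rw [map_add, smul_add]
  map_smul' c a := by
    ext p
    change fr.χ p • fr.φ p (c • a) = c • fr.χ p • fr.φ p a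
    rw [map_smul, smul_comm]

theorem ext_apply (a : Model n) (p : M) : fr.ext a p = fr.χ p • fr.φ p a := rfl

@[simp]
theorem ext_apply_self (a : Model n) : fr.ext a p₀ = fr.φ p₀ a := by
  rw [ext_apply, χ_self, one_smul]

theorem contMDiffAt_functional {p : M} (hp : p ∈ fr.U) (l : Model n →ₗ[ℝ] ℝ)
    (η : SuperFun m F R) :
    ContMDiffAt (𝓡 m) 𝓘(ℝ, ℝ) ∞ (fun q => l ((fr.φ q).symm (η q))) p := by
  have h : ∀ q, l ((fr.φ q).symm (η q)) =
      ∑ k, (modelBasis n).repr ((fr.φ q).symm (η q)) k * l (modelBasis n k) := by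
    intro q
    conv_lhs => rw [← (modelBasis n).sum_repr ((fr.φ q).symm (η q))]
    simp only [map_sum, map_smul, smul_eq_mul]
  simp only [h]
  refine contMDiffAt_finsetSum fun k _ => ContMDiffAt.mul ?_ contMDiffAt_const
  exact contMDiffAt_coord p fr.isOpen hp (fun q => (fr.φ q).toLinearEquiv) fr.smooth _ η k

/-- A linear functional of the coordinates of a superfunction, cut off. -/
def functional (l : Model n →ₗ[ℝ] ℝ) (η : SuperFun m F R) : C^∞⟮𝓡 m, M; ℝ⟯ :=
  ⟨fun p => fr.χ p * l ((fr.φ p).symm (η p)), by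
    refine contMDiff_of_tsupport fun p hp => ?_
    refine fr.χ.contMDiff.contMDiffAt.mul (fr.contMDiffAt_functional (fr.tsupport_subset ?_) l η)
    exact closure_mono (Function.support_mul_subset_left _ _) hp⟩

theorem functional_apply (l : Model n →ₗ[ℝ] ℝ) (η : SuperFun m F R) (p : M) :
    fr.functional l η p = fr.χ p * l ((fr.φ p).symm (η p)) := rfl

/-- Coordinates and frame sections are each cut off once, hence the square of `χ`. The identity is
global and reads off `η` wherever `χ = 1`. -/
theorem sum_functional_smul_ext (η : SuperFun m F R) :
    (fr.χ * fr.χ) • η =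
      ∑ k, fr.functional ((modelBasis n).coord k) η • fr.ext (modelBasis n k) := by
  ext p
  have h : ∀ s : Finset (Fin (Module.finrank ℝ (Model n))),
      (∑ k ∈ s, fr.functional ((modelBasis n).coord k) η • fr.ext (modelBasis n k)) p =
      ∑ k ∈ s, (fr.functional ((modelBasis n).coord k) η p) • fr.ext (modelBasis n k) p := by
    intro s
    exact map_sum (⟨⟨fun σ : SuperFun m F R => σ p, rfl⟩, fun _ _ => rfl⟩ : _ →+ R p) _ _
  rw [h]
  change (fr.χ p * fr.χ p) • η p = _
  conv_lhs => rw [← (fr.φ p).apply_symm_apply (η p),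
    ← (modelBasis n).sum_repr ((fr.φ p).symm (η p)), map_sum, Finset.smul_sum]
  refine Finset.sum_congr rfl fun k _ => ?_
  rw [functional_apply, ext_apply, map_smul, smul_smul, smul_smul, Module.Basis.coord_apply]
  congr 1
  ring

end Frame

end Frames

/-- A nonzero scalar plus a nilpotent element commuting with it. -/
theorem isUnit_of_aug_ne_zero {V : Type*} [AddCommGroup V] [Module ℝ V] [Module.Finite ℝ V]
    {a : ExteriorAlgebra ℝ V} (h : aug a ≠ 0) : IsUnit a := by
  obtain ⟨k, hk⟩ := nilIdeal_nilpotent (V := V)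
  have h1 : a - algebraMap ℝ _ (aug a) ∈ nilIdeal (ExteriorAlgebra ℝ V) := by simp
  have h2 : IsNilpotent (a - algebraMap ℝ _ (aug a)) :=
    ⟨k, (Submodule.mem_bot ℝ).1 (hk ▸ Submodule.pow_mem_pow _ h1 k)⟩
  have h3 : IsUnit (algebraMap ℝ (ExteriorAlgebra ℝ V) (aug a)) :=
    (isUnit_iff_ne_zero.2 h).map (algebraMap ℝ _)
  have := h2.isUnit_add_left_of_commute h3 (Algebra.commutes _ _).symm
  rwa [add_sub_cancel] at this

/-! ### Extending fibre data to global sections; tensoriality -/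

section Sections

variable {m n : ℕ} {M : Type*} [TopologicalSpace M] [ChartedSpace (EuclideanSpace ℝ (Fin m)) M]
  {F : Type*} [NormedAddCommGroup F] [NormedSpace ℝ F]
  {R : M → Type*} [TopologicalSpace (TotalSpace F R)]
  [∀ p, Ring (R p)] [∀ p, Algebra ℝ (R p)] [∀ p, TopologicalSpace (R p)] [FiberBundle F R]
  [SuperalgebraBundle m F R n] [VectorBundle ℝ F R] [FiniteDimensional ℝ F]
  [IsManifold (𝓡 m) ∞ M] [T2Space M] [SigmaCompactSpace M]

variable (m F) in
/-- The augmentation of the fibre at `p`. -/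
def eps (p : M) : R p →ₐ[ℝ] ℝ := aug.comp ((frame m F R p).φ p).symm.toAlgHom

theorem eps_eq {W : Type*} [AddCommGroup W] [Module ℝ W] {p : M}
    (φ : ExteriorAlgebra ℝ W ≃ₐ[ℝ] R p) (a : R p) : eps m F p a = aug (φ.symm a) :=
  aug_symm_eq _ φ a

theorem mem_nilIdeal_iff_eps {p : M} {a : R p} : a ∈ nilIdeal (R p) ↔ eps m F p a = 0 :=
  mem_nilIdeal_iff ((frame m F R p).φ p)

theorem isUnit_of_eps_ne_zero {p : M} {a : R p} (h : eps m F p a ≠ 0) : IsUnit a := by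
  have : IsUnit ((frame m F R p).φ p (((frame m F R p).φ p).symm a)) :=
    (isUnit_of_aug_ne_zero h).map ((frame m F R p).φ p)
  rwa [AlgEquiv.apply_symm_apply] at this

theorem contMDiff_eps (η : SuperFun m F R) :
    ContMDiff (𝓡 m) 𝓘(ℝ, ℝ) ∞ (fun p => eps m F p (η p)) := by
  intro p
  refine ((frame m F R p).contMDiffAt_functional (frame m F R p).mem aug.toLinearMap
    η).congr_of_eventuallyEq (Filter.Eventually.of_forall fun q => ?_)
  exact eps_eq ((frame m F R p).φ q) (η q)

theorem IsSmoothCodir.exists_lift {σ : ∀ p, Codir (R p)} (hσ : IsSmoothCodir m F R σ) (p₀ : M) :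
    ∃ (η : SuperFun m F R) (h : ∀ p, η p ∈ nilIdeal (R p)),
      ∀ᶠ p in 𝓝 p₀, σ p = Submodule.Quotient.mk ⟨η p, h p⟩ := by
  obtain ⟨U, hU, hp, η, hη, hση⟩ := hσ p₀
  obtain ⟨χ, hχ, θ, hθ⟩ := exists_section_eventuallyEq hU hη hp
  refine ⟨θ, fun p => by rw [hθ]; exact Submodule.smul_mem _ _ (η p).2, ?_⟩
  filter_upwards [hχ, hU.mem_nhds hp] with p h1 h2
  rw [hση p h2]
  congr 1
  ext1
  change (η p : R p) = θ p
  rw [hθ, h1, one_smul]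

theorem isSmoothCodir_of_superFun (η : SuperFun m F R) (h : ∀ p, η p ∈ nilIdeal (R p)) :
    IsSmoothCodir m F R (fun p => Submodule.Quotient.mk ⟨η p, h p⟩) := fun _ =>
  ⟨Set.univ, isOpen_univ, trivial, fun p => ⟨η p, h p⟩, η.contMDiff.contMDiffOn, fun _ _ => rfl⟩

namespace Frame

variable {p₀ : M} (fr : Frame m F R p₀)

theorem ext_ι_mem (v : Fin n → ℝ) (p : M) : fr.ext (ExteriorAlgebra.ι ℝ v) p ∈ nilIdeal (R p) := by
  rw [ext_apply]
  exact Submodule.smul_mem _ _ (map_ι_mem_nilIdeal _ _)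

/-- The codirection with constant coordinates `v` in the frame, cut off. -/
def codir (v : Fin n → ℝ) (p : M) : Codir (R p) := fr.χ p • codirEquiv (fr.φ p) v

theorem isSmoothCodir_codir (v : Fin n → ℝ) : IsSmoothCodir m F R (fr.codir v) :=
  isSmoothCodir_of_superFun (fr.ext (ExteriorAlgebra.ι ℝ v)) (fr.ext_ι_mem v)

theorem contMDiffAt_codirFunctional {σ : ∀ p, Codir (R p)} (hσ : IsSmoothCodir m F R σ)
    (f : Module.Dual ℝ (Fin n → ℝ)) {p : M} (hp : p ∈ fr.U) :
    ContMDiffAt (𝓡 m) 𝓘(ℝ, ℝ) ∞ (fun q => f ((codirEquiv (fr.φ q)).symm (σ q))) p := by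
  obtain ⟨η, h, hση⟩ := hσ.exists_lift p
  refine (fr.contMDiffAt_functional hp (f ∘ₗ ExteriorAlgebra.ιInv) η).congr_of_eventuallyEq ?_
  filter_upwards [hση] with q hq
  rw [hq, codirEquiv_symm_mk]
  rfl

/-- The odd direction with constant coordinates `f` in the frame, cut off. -/
def dir : Module.Dual ℝ (Fin n → ℝ) →ₗ[ℝ] OddSection m F R where
  toFun f := ⟨fun p => fr.χ p • (f ∘ₗ (codirEquiv (fr.φ p)).symm.toLinearMap), fun σ hσ => by
    refine contMDiff_of_tsupport fun p hp => ?_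
    refine fr.χ.contMDiff.contMDiffAt.mul (fr.contMDiffAt_codirFunctional hσ f
      (fr.tsupport_subset ?_))
    exact closure_mono (Function.support_mul_subset_left _ _) hp⟩
  map_add' f g := by
    ext1
    funext p
    exact LinearMap.ext fun σ => mul_add _ _ _
  map_smul' c f := by
    ext1
    funext p
    exact LinearMap.ext fun σ => mul_left_comm _ _ _

theorem dir_apply (f : Module.Dual ℝ (Fin n → ℝ)) (p : M) :
    (fr.dir f).1 p = fr.χ p • (f ∘ₗ (codirEquiv (fr.φ p)).symm.toLinearMap) := rfl

/-- A coordinate of an odd direction in the frame, cut off. -/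
def oddCoord (v : Fin n → ℝ) (s : OddSection m F R) : C^∞⟮𝓡 m, M; ℝ⟯ :=
  ⟨fun p => s.1 p (fr.codir v p), s.2 _ (fr.isSmoothCodir_codir v)⟩

theorem oddCoord_apply (v : Fin n → ℝ) (s : OddSection m F R) (p : M) :
    fr.oddCoord v s p = fr.χ p * s.1 p (codirEquiv (fr.φ p) v) := by
  change s.1 p (fr.codir v p) = _
  rw [codir, map_smul, smul_eq_mul]

theorem sum_oddSection_apply {ι : Type*} (t : Finset ι) (s : ι → OddSection m F R) (p : M) :
    (∑ i ∈ t, s i).1 p = ∑ i ∈ t, (s i).1 p :=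
  map_sum (⟨⟨fun s : OddSection m F R => s.1 p, rfl⟩, fun _ _ => rfl⟩ : _ →+ Dir (R p)) _ _

theorem sum_oddCoord_smul_dir (s : OddSection m F R) :
    (fr.χ * fr.χ) • s = ∑ j, fr.oddCoord (Pi.basisFun ℝ (Fin n) j) s •
      fr.dir ((Pi.basisFun ℝ (Fin n)).coord j) := by
  ext1
  funext p
  rw [sum_oddSection_apply]
  change (fr.χ p * fr.χ p) • s.1 p = _
  refine LinearMap.ext fun σ => ?_
  obtain ⟨v, rfl⟩ := (codirEquiv (fr.φ p)).surjective σ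
  rw [LinearMap.sum_apply]
  conv_lhs => rw [← (Pi.basisFun ℝ (Fin n)).sum_repr v]
  rw [map_sum, map_sum]
  refine Finset.sum_congr rfl fun j _ => ?_
  rw [smul_oddSection_apply, oddCoord_apply, dir_apply, map_smul, map_smul]
  simp only [LinearMap.smul_apply, LinearMap.comp_apply, LinearEquiv.coe_coe,
    LinearEquiv.symm_apply_apply, Module.Basis.coord_apply, smul_eq_mul]
  ring

theorem mem_parity_iff {p : M} (hp : p ∈ fr.U) {i : ZMod 2} {a : R p} :
    a ∈ SuperalgebraBundle.parity m F (R := R) p i ↔ (fr.φ p).symm a ∈ extParity (Fin n → ℝ) i := by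
  rw [← fr.parity_eq p hp i]
  conv_lhs => rw [← (fr.φ p).apply_symm_apply a]
  exact map_mem_map_iff (fr.φ p)

theorem isHomogeneous_ext {i : ZMod 2} {a : Model n} (ha : a ∈ extParity (Fin n → ℝ) i) :
    IsHomogeneous m F R i (fr.ext a) := by
  intro p
  rw [ext_apply]
  by_cases h : fr.χ p = 0
  · rw [h, zero_smul]
    exact zero_mem _
  · refine Submodule.smul_mem _ _ ?_
    rw [fr.mem_parity_iff (fr.mem_of_ne h), AlgEquiv.symm_apply_apply]
    exact ha

end Frame

variable (m F) in
/-- Extension of an element of a fibre to a superfunction. -/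
def extend (p : M) : R p →ₗ[ℝ] SuperFun m F R :=
  (frame m F R p).ext ∘ₗ ((frame m F R p).φ p).symm.toLinearMap

@[simp]
theorem extend_self (p : M) (a : R p) : extend m F p a p = a := by
  change (frame m F R p).ext (((frame m F R p).φ p).symm a) p = a
  rw [Frame.ext_apply_self, AlgEquiv.apply_symm_apply]

theorem isHomogeneous_extend {p : M} {i : ZMod 2} {a : R p}
    (ha : a ∈ SuperalgebraBundle.parity m F (R := R) p i) :
    IsHomogeneous m F R i (extend m F p a) :=
  (frame m F R p).isHomogeneous_ext (((frame m F R p).mem_parity_iff (frame m F R p).mem).1 ha)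

theorem extend_mem_nilIdeal {p : M} {a : R p} (ha : a ∈ nilIdeal (R p)) (q : M) :
    extend m F p a q ∈ nilIdeal (R q) := by
  change (frame m F R p).ext (((frame m F R p).φ p).symm a) q ∈ _
  rw [Frame.ext_apply]
  refine Submodule.smul_mem _ _ ?_
  rw [mem_nilIdeal_iff ((frame m F R p).φ q), AlgEquiv.symm_apply_apply]
  exact (mem_nilIdeal_iff _).1 ha

variable (m F) in
/-- Extension of an odd direction at a point to an odd direction field. -/
def extendDir (p : M) : Dir (R p) →ₗ[ℝ] OddSection m F R :=
  (frame m F R p).dir ∘ₗ LinearMap.lcomp ℝ ℝ (codirEquiv ((frame m F R p).φ p)).toLinearMap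

@[simp]
theorem extendDir_self (p : M) (t : Dir (R p)) : (extendDir m F p t).1 p = t := by
  change ((frame m F R p).dir (t ∘ₗ (codirEquiv ((frame m F R p).φ p)).toLinearMap)).1 p = t
  rw [Frame.dir_apply, Frame.χ_self, one_smul]
  refine LinearMap.ext fun σ => ?_
  simp

theorem isHomogeneous_smul_one (f : C^∞⟮𝓡 m, M; ℝ⟯) :
    IsHomogeneous m F R 0 (f • (1 : SuperFun m F R)) := by
  intro p
  refine Submodule.smul_mem _ _ ?_
  rw [one_section_apply, (frame m F R p).mem_parity_iff (frame m F R p).mem, map_one,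
    mem_extParity_iff, map_one, sgn_zero_right, one_smul]

theorem smul_one_mul (f : C^∞⟮𝓡 m, M; ℝ⟯) (η : SuperFun m F R) : (f • (1 : SuperFun m F R)) * η = f • η := by
  ext p
  simp

/-- The Leibniz rule for the even superfunction `f • 1`. Linearity over functions is therefore
equivalent to killing all `f • 1`. -/
theorem superDer_smul {i : ZMod 2} {D : SuperFun m F R →ₗ[ℝ] SuperFun m F R}
    (hD : D ∈ SuperDer m F R i) (f : C^∞⟮𝓡 m, M; ℝ⟯) (η : SuperFun m F R) :
    D (f • η) = D (f • 1) * η + f • D η := by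
  conv_lhs => rw [← smul_one_mul f η]
  rw [hD.2 0 _ _ (isHomogeneous_smul_one f), sgn_zero_right, one_smul, smul_one_mul]

/-- The tensoriality argument: expand `χ² η` in the cut-off frame, pull the coefficients out of `D`,
and evaluate at `p`, where `χ = 1`. -/
theorem apply_eq_ext_of_linear {D : SuperFun m F R →ₗ[ℝ] SuperFun m F R}
    (hD : ∀ (f : C^∞⟮𝓡 m, M; ℝ⟯) (η : SuperFun m F R), D (f • η) = f • D η) {p : M}
    (fr : Frame m F R p) (η : SuperFun m F R) :
    D η p = D (fr.ext ((fr.φ p).symm (η p))) p := by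
  have hev : ∀ (s : Finset (Fin (Module.finrank ℝ (Model n)))) (g : _ → SuperFun m F R),
      (∑ k ∈ s, g k) p = ∑ k ∈ s, g k p := fun s g =>
    map_sum (⟨⟨fun σ : SuperFun m F R => σ p, rfl⟩, fun _ _ => rfl⟩ : _ →+ R p) _ _
  have h := congrArg (fun θ => D θ p) (fr.sum_functional_smul_ext η)
  simp only [hD, map_sum] at h
  rw [hev, smul_section_apply, ContMDiffMap.coe_mul, Pi.mul_apply, fr.χ_self, one_mul,
    one_smul] at h
  rw [h]
  conv_rhs => rw [← (modelBasis n).sum_repr ((fr.φ p).symm (η p))]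
  rw [map_sum, map_sum, hev]
  refine Finset.sum_congr rfl fun k _ => ?_
  rw [smul_section_apply, Frame.functional_apply, fr.χ_self, one_mul, map_smul, map_smul]
  rfl

theorem apply_eq_extend_of_linear {D : SuperFun m F R →ₗ[ℝ] SuperFun m F R}
    (hD : ∀ (f : C^∞⟮𝓡 m, M; ℝ⟯) (η : SuperFun m F R), D (f • η) = f • D η) (p : M)
    (η : SuperFun m F R) : D η p = D (extend m F p (η p)) p :=
  apply_eq_ext_of_linear hD (frame m F R p) η

/-- The same tensoriality argument for odd sections: only the value of `s` at `p` matters. -/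
theorem oddSection_apply_eq {N : Type*} [AddCommGroup N] [Module ℝ N]
    (B : OddSection m F R →ₗ[ℝ] N) {p : M}
    (hB : ∀ (f : C^∞⟮𝓡 m, M; ℝ⟯) (s : OddSection m F R), B (f • s) = f p • B s)
    (s : OddSection m F R) : B s = B (extendDir m F p (s.1 p)) := by
  let fr := frame m F R p
  have h := congrArg B (fr.sum_oddCoord_smul_dir s)
  simp only [hB, map_sum] at h
  rw [ContMDiffMap.coe_mul, Pi.mul_apply, fr.χ_self, one_mul, one_smul] at h
  rw [h]
  have e : extendDir m F p (s.1 p) = ∑ j, fr.oddCoord (Pi.basisFun ℝ (Fin n) j) s p •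
      fr.dir ((Pi.basisFun ℝ (Fin n)).coord j) := by
    change fr.dir (s.1 p ∘ₗ (codirEquiv (fr.φ p)).toLinearMap) = _
    simp only [← map_smul]
    rw [← map_sum]
    congr 1
    refine (Pi.basisFun ℝ (Fin n)).ext fun i => ?_
    rw [LinearMap.sum_apply, Finset.sum_eq_single i]
    · rw [LinearMap.smul_apply, Module.Basis.coord_apply, Module.Basis.repr_self,
        Finsupp.single_eq_same, Frame.oddCoord_apply, fr.χ_self, one_mul, smul_eq_mul, mul_one]
      rfl
    · intro j _ hj
      rw [LinearMap.smul_apply, Module.Basis.coord_apply, Module.Basis.repr_self,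
        Finsupp.single_eq_of_ne hj, smul_zero]
    · simp
  rw [e, map_sum]
  exact Finset.sum_congr rfl fun j _ => (map_smul _ _ _).symm

end Sections

/-! ### Smoothness from overdetermined linear systems -/

/-- The solution of a linear system with smooth coefficients and trivial kernel is smooth. -/
theorem contMDiffAt_of_linear_system {m : ℕ} {M : Type*} [TopologicalSpace M]
    [ChartedSpace (EuclideanSpace ℝ (Fin m)) M] {ι κ : Type*} [Fintype ι] [Fintype κ]
    {a : κ → ι → M → ℝ} {r : κ → M → ℝ} {c : ι → M → ℝ} {p₀ : M}
    (ha : ∀ k i, ContMDiffAt (𝓡 m) 𝓘(ℝ, ℝ) ∞ (a k i) p₀)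
    (hr : ∀ k, ContMDiffAt (𝓡 m) 𝓘(ℝ, ℝ) ∞ (r k) p₀)
    (h : ∀ᶠ p in 𝓝 p₀, ∀ k, ∑ i, a k i p * c i p = r k p)
    (hinj : ∀ x : ι → ℝ, (∀ k, ∑ i, a k i p₀ * x i = 0) → x = 0) (i : ι) :
    ContMDiffAt (𝓡 m) 𝓘(ℝ, ℝ) ∞ (c i) p₀ := by
  classical
  let A : M → (ι → ℝ) →ₗ[ℝ] (κ → ℝ) := fun p => Matrix.mulVecLin (Matrix.of fun k i => a k i p)
  have hA : ∀ p x k, A p x k = ∑ i, a k i p * x i := fun p x k => rfl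
  have hker : LinearMap.ker (A p₀) = ⊥ := by
    rw [LinearMap.ker_eq_bot']
    intro x hx
    exact hinj x fun k => by rw [← hA, hx]; rfl
  -- A fixed left inverse of the matrix at `p₀` makes the system square: `T p = C ∘ A p` is the
  -- identity at `p₀`, hence invertible nearby, with an inverse depending smoothly on `p`.
  obtain ⟨C, hC⟩ := (A p₀).exists_leftInverse_of_injective hker
  let v : ι → M → ι → ℝ := fun i p => C fun k => a k i p
  have hsmooth : ∀ g : M → κ → ℝ, (∀ k, ContMDiffAt (𝓡 m) 𝓘(ℝ, ℝ) ∞ (fun p => g p k) p₀) →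
      ContMDiffAt (𝓡 m) 𝓘(ℝ, ι → ℝ) ∞ (fun p => C (g p)) p₀ := by
    intro g hg
    exact (LinearMap.toContinuousLinearMap C).contMDiff.contMDiffAt.comp p₀
      (contMDiffAt_pi_space.2 hg)
  let T : M → (ι → ℝ) →L[ℝ] (ι → ℝ) := fun p =>
    ∑ i, (ContinuousLinearMap.proj (R := ℝ) (φ := fun _ : ι => ℝ) i).smulRight (v i p)
  have hTapp : ∀ p x, T p x = C (A p x) := by
    intro p x
    have e : A p x = ∑ i, x i • fun k => a k i p := by
      funext k
      rw [hA, Finset.sum_apply]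
      exact Finset.sum_congr rfl fun i _ => mul_comm _ _
    rw [e, map_sum]
    simp only [T, FunLike.coe_sum, Finset.sum_apply, ContinuousLinearMap.smulRight_apply,
      ContinuousLinearMap.proj_apply, map_smul, v]
  have hT0 : T p₀ = (ContinuousLinearEquiv.refl ℝ (ι → ℝ) : (ι → ℝ) →L[ℝ] (ι → ℝ)) := by
    ext1 x
    rw [hTapp]
    exact congrArg (fun f => f x) hC
  have hT : ContMDiffAt (𝓡 m) 𝓘(ℝ, (ι → ℝ) →L[ℝ] (ι → ℝ)) ∞ T p₀ := by
    refine contMDiffAt_finsetSum fun i _ => ?_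
    exact ((ContinuousLinearMap.smulRightL ℝ (ι → ℝ) (ι → ℝ)
      (ContinuousLinearMap.proj (R := ℝ) (φ := fun _ : ι => ℝ) i)).contMDiff.contMDiffAt).comp p₀
        (hsmooth (fun p k => a k i p) fun k => ha k i)
  have hinv : ContMDiffAt (𝓡 m) 𝓘(ℝ, (ι → ℝ) →L[ℝ] (ι → ℝ)) ∞
      (fun p => ContinuousLinearMap.inverse (T p)) p₀ := by
    have := contDiffAt_map_inverse (n := ∞) (𝕜 := ℝ) (ContinuousLinearEquiv.refl ℝ (ι → ℝ))
    rw [← hT0] at this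
    exact this.contMDiffAt.comp p₀ hT
  have hc : ContMDiffAt (𝓡 m) 𝓘(ℝ, ι → ℝ) ∞
      (fun p => ContinuousLinearMap.inverse (T p) (C fun k => r k p)) p₀ :=
    hinv.clm_apply (hsmooth (fun p k => r k p) hr)
  refine (contMDiffAt_pi_space.1 hc i).congr_of_eventuallyEq ?_
  have hev : ∀ᶠ p in 𝓝 p₀, T p ∈ Set.range
      ((↑) : ((ι → ℝ) ≃L[ℝ] (ι → ℝ)) → (ι → ℝ) →L[ℝ] (ι → ℝ)) := by
    refine hT.continuousAt.eventually_mem ?_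
    rw [hT0]
    exact ContinuousLinearEquiv.nhds _
  filter_upwards [hev, h] with p ⟨e, he⟩ hp
  have h1 : T p (fun i => c i p) = C fun k => r k p := by
    rw [hTapp]
    congr 1
    funext k
    rw [hA, hp]
  rw [← h1, ← he, ContinuousLinearMap.inverse_equiv, ContinuousLinearEquiv.coe_coe,
    ContinuousLinearEquiv.coe_coe, ContinuousLinearEquiv.symm_apply_apply]

section Sections

variable {m n : ℕ} {M : Type*} [TopologicalSpace M] [ChartedSpace (EuclideanSpace ℝ (Fin m)) M]
  {F : Type*} [NormedAddCommGroup F] [NormedSpace ℝ F]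
  {R : M → Type*} [TopologicalSpace (TotalSpace F R)]
  [∀ p, Ring (R p)] [∀ p, Algebra ℝ (R p)] [∀ p, TopologicalSpace (R p)] [FiberBundle F R]
  [SuperalgebraBundle m F R n] [VectorBundle ℝ F R] [FiniteDimensional ℝ F]
  [IsManifold (𝓡 m) ∞ M] [T2Space M] [SigmaCompactSpace M]

/-- Smoothness of a possibly discontinuous section. -/
abbrev IsSmoothSection (m : ℕ) {M : Type*} [TopologicalSpace M]
    [ChartedSpace (EuclideanSpace ℝ (Fin m)) M]
    (F : Type*) [NormedAddCommGroup F] [NormedSpace ℝ F]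
    {R : M → Type*} [TopologicalSpace (TotalSpace F R)] [∀ p, Ring (R p)] [∀ p, Algebra ℝ (R p)]
    [∀ p, TopologicalSpace (R p)] [FiberBundle F R] (u : ∀ p, R p) : Prop :=
  ContMDiff (𝓡 m) ((𝓡 m).prod 𝓘(ℝ, F)) ∞ (fun p => (⟨p, u p⟩ : TotalSpace F R))

/-- A section whose derivatives along all odd directions are smooth is smooth. -/
theorem isSmoothSection_of_der {D : ∀ p, Dir (R p) →ₗ[ℝ] Module.End ℝ (R p)}
    (hD : ∀ (s : OddSection m F R) (η : SuperFun m F R),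
      IsSmoothSection m F fun p => D p (s.1 p) (η p))
    (hinj : ∀ p a, (∀ t, D p t a = 0) → eps m F p a = 0 → a = 0) {u : ∀ p, R p}
    (hε : ContMDiff (𝓡 m) 𝓘(ℝ, ℝ) ∞ fun p => eps m F p (u p))
    (hu : ∀ s : OddSection m F R, IsSmoothSection m F fun p => D p (s.1 p) (u p)) :
    IsSmoothSection m F u := by
  intro p₀
  let fr := frame m F R p₀
  let b := modelBasis n
  let d : Fin n → OddSection m F R := fun j => fr.dir ((Pi.basisFun ℝ (Fin n)).coord j)
  -- One equation (`none`) for the augmentation, and one for each coordinate of each derivative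
  -- along a frame direction. The unknowns are the coordinates of `u`.
  let a : Option (Fin n × Fin (Module.finrank ℝ (Model n))) →
      Fin (Module.finrank ℝ (Model n)) → M → ℝ := fun k i q => k.elim (eps m F q (fr.ext (b i) q))
    fun x => b.coord x.2 ((fr.φ q).symm (D q ((d x.1).1 q) (fr.ext (b i) q)))
  let r : Option (Fin n × Fin (Module.finrank ℝ (Model n))) → M → ℝ := fun k q =>
    k.elim (eps m F q (u q)) fun x => b.coord x.2 ((fr.φ q).symm (D q ((d x.1).1 q) (u q)))
  let c : Fin (Module.finrank ℝ (Model n)) → M → ℝ := fun i q => b.repr ((fr.φ q).symm (u q)) i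
  have hc : ∀ q, fr.χ q = 1 → u q = ∑ i, c i q • fr.ext (b i) q := by
    intro q hq
    conv_lhs => rw [← (fr.φ q).apply_symm_apply (u q), ← b.sum_repr ((fr.φ q).symm (u q)), map_sum]
    refine Finset.sum_congr rfl fun i _ => ?_
    rw [map_smul, Frame.ext_apply, hq, one_smul]
  have ha : ∀ k i, ContMDiffAt (𝓡 m) 𝓘(ℝ, ℝ) ∞ (a k i) p₀ := by
    rintro (_ | x) i
    · exact contMDiff_eps (fr.ext (b i)) p₀
    · exact fr.contMDiffAt_functional fr.mem (b.coord x.2)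
        ⟨fun q => D q ((d x.1).1 q) (fr.ext (b i) q), hD _ _⟩
  have hr : ∀ k, ContMDiffAt (𝓡 m) 𝓘(ℝ, ℝ) ∞ (r k) p₀ := by
    rintro (_ | x)
    · exact hε p₀
    · exact fr.contMDiffAt_functional fr.mem (b.coord x.2)
        ⟨fun q => D q ((d x.1).1 q) (u q), hu _⟩
  have hsum : ∀ k q (y : Fin (Module.finrank ℝ (Model n)) → ℝ), ∑ i, a k i q * y i =
      k.elim (eps m F q (∑ i, y i • fr.ext (b i) q)) fun x =>
        b.coord x.2 ((fr.φ q).symm (D q ((d x.1).1 q) (∑ i, y i • fr.ext (b i) q))) := by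
    rintro (_ | x) q y
    · simp only [Option.elim, map_sum, map_smul, a, smul_eq_mul, mul_comm (y _)]
    · simp only [Option.elim, map_sum, map_smul, a, smul_eq_mul, mul_comm (y _)]
  have hsys : ∀ᶠ q in 𝓝 p₀, ∀ k, ∑ i, a k i q * c i q = r k q := by
    filter_upwards [fr.χ_eventually] with q hq k
    rw [hsum, ← hc q hq]
  -- The frame directions span all odd directions at `p₀`, so a kernel vector yields an element
  -- killed by every `D_t` and by the augmentation; `hinj` makes it zero.
  have hker : ∀ x : Fin (Module.finrank ℝ (Model n)) → ℝ,
      (∀ k, ∑ i, a k i p₀ * x i = 0) → x = 0 := by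
    intro x hx
    simp only [hsum] at hx
    have h0 : ∑ i, x i • fr.ext (b i) p₀ = 0 := by
      refine hinj p₀ _ (fun t => ?_) (hx none)
      have h1 : ∀ j, D p₀ ((d j).1 p₀) (∑ i, x i • fr.ext (b i) p₀) = 0 := by
        intro j
        refine (fr.φ p₀).symm.injective ((b.ext_elem fun k => ?_).trans (map_zero _).symm)
        rw [map_zero]
        exact hx (some (j, k))
      have ht : t = ∑ j, (t (codirEquiv (fr.φ p₀) (Pi.basisFun ℝ (Fin n) j))) • (d j).1 p₀ := by
        have := congrArg (fun s => s.1 p₀) (fr.sum_oddCoord_smul_dir (extendDir m F p₀ t))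
        rw [Frame.sum_oddSection_apply] at this
        simpa [Frame.oddCoord_apply] using this
      rw [ht, map_sum (D p₀), LinearMap.sum_apply]
      refine Finset.sum_eq_zero fun j _ => ?_
      rw [map_smul, LinearMap.smul_apply, h1, smul_zero]
    have h2 : ∑ i, x i • b i = 0 := by
      refine (fr.φ p₀).injective ?_
      rw [map_sum, map_zero, ← h0]
      exact Finset.sum_congr rfl fun i _ => by rw [map_smul, Frame.ext_apply_self]
    funext i
    exact (Fintype.linearIndependent_iff.1 b.linearIndependent) x h2 i
  have hcs := contMDiffAt_of_linear_system ha hr hsys hker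
  have hfin : ContMDiffAt (𝓡 m) ((𝓡 m).prod 𝓘(ℝ, F)) ∞
      (fun q => (⟨q, ∑ i, c i q • fr.ext (b i) q⟩ : TotalSpace F R)) p₀ :=
    ContMDiffAt.sum_section fun i _ => (hcs i).smul_section ((fr.ext (b i)).contMDiff p₀)
  refine hfin.congr_of_eventuallyEq ?_
  filter_upwards [fr.χ_eventually] with q hq
  rw [hc q hq]

end Sections

/-! ### Smooth families of fibre straightenings -/

/-- The isomorphism of exterior algebras induced by a linear isomorphism. -/
def exteriorEquiv {V W : Type*} [AddCommGroup V] [Module ℝ V] [AddCommGroup W] [Module ℝ W]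
    (κ : V ≃ₗ[ℝ] W) : ExteriorAlgebra ℝ V ≃ₐ[ℝ] ExteriorAlgebra ℝ W :=
  AlgEquiv.ofAlgHom (ExteriorAlgebra.map κ.toLinearMap) (ExteriorAlgebra.map κ.symm.toLinearMap)
    (by rw [ExteriorAlgebra.map_comp_map, LinearEquiv.comp_coe, LinearEquiv.symm_trans_self]
        exact ExteriorAlgebra.map_id)
    (by rw [ExteriorAlgebra.map_comp_map, LinearEquiv.comp_coe, LinearEquiv.self_trans_symm]
        exact ExteriorAlgebra.map_id)

theorem invol_exteriorEquiv {V W : Type*} [AddCommGroup V] [Module ℝ V] [AddCommGroup W]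
    [Module ℝ W] (κ : V ≃ₗ[ℝ] W) (x : ExteriorAlgebra ℝ V) :
    exteriorEquiv κ (invol x) = invol (exteriorEquiv κ x) :=
  map_ι_mem_of_odd (Φ := ExteriorAlgebra.map κ.toLinearMap) (fun v => by
    rw [ExteriorAlgebra.map_apply_ι]
    exact CliffordAlgebra.ι_mem_evenOdd_one _ _) x

theorem exteriorEquiv_mem_parity {V W : Type*} [AddCommGroup V] [Module ℝ V] [AddCommGroup W]
    [Module ℝ W] (κ : V ≃ₗ[ℝ] W) {i : ZMod 2} {x : ExteriorAlgebra ℝ V} :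
    exteriorEquiv κ x ∈ extParity W i ↔ x ∈ extParity V i := by
  rw [mem_extParity_iff, mem_extParity_iff, ← invol_exteriorEquiv, ← map_smul]
  exact (exteriorEquiv κ).injective.eq_iff

section Sections

variable {m n : ℕ} {M : Type*} [TopologicalSpace M] [ChartedSpace (EuclideanSpace ℝ (Fin m)) M]
  {F : Type*} [NormedAddCommGroup F] [NormedSpace ℝ F]
  {R : M → Type*} [TopologicalSpace (TotalSpace F R)]
  [∀ p, Ring (R p)] [∀ p, Algebra ℝ (R p)] [∀ p, TopologicalSpace (R p)] [FiberBundle F R]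
  [SuperalgebraBundle m F R n] [VectorBundle ℝ F R] [FiniteDimensional ℝ F]
  [IsManifold (𝓡 m) ∞ M] [T2Space M] [SigmaCompactSpace M]

include n in
theorem SmoothOn.mul {η θ : ∀ p, R p} {U : Set M} (hU : IsOpen U) (hη : SmoothOn m F R η U)
    (hθ : SmoothOn m F R θ U) : SmoothOn m F R (fun p => η p * θ p) U := by
  intro p hp
  refine ContMDiffAt.contMDiffWithinAt ?_
  obtain ⟨χ, hχ, η', hη'⟩ := exists_section_eventuallyEq hU hη hp
  obtain ⟨χ', hχ', θ', hθ'⟩ := exists_section_eventuallyEq hU hθ hp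
  refine ((η' * θ').contMDiff p).congr_of_eventuallyEq ?_
  filter_upwards [hχ, hχ'] with q h h'
  rw [mul_section_apply, hη', hθ', h, h', one_smul, one_smul]

include n in
theorem SmoothOn.const_smul_one (r : ℝ) (U : Set M) :
    SmoothOn m F R (fun p => algebraMap ℝ (R p) r) U := by
  refine (ContMDiff.contMDiffOn (s := U) (r • (1 : SuperFun m F R)).contMDiff).congr fun p _ => ?_
  exact congrArg (TotalSpace.mk p) (Algebra.algebraMap_eq_smul_one r)

section Straighten

variable {Ψ : ∀ p, ExteriorAlgebra ℝ (Codir (R p)) ≃ₐ[ℝ] R p}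

include n in
/-- A family of straightenings of the fibres is smooth on smooth codirections if it intertwines
the contractions with a smooth family of operators. -/
theorem isSmoothSection_ι_of_der {D : ∀ p, Dir (R p) →ₗ[ℝ] Module.End ℝ (R p)}
    (hD : ∀ (s : OddSection m F R) (η : SuperFun m F R),
      IsSmoothSection m F fun p => D p (s.1 p) (η p))
    (hΨ : ∀ p t w, Ψ p (contract t w) = D p t (Ψ p w))
    {σ : ∀ p, Codir (R p)} (hσ : IsSmoothCodir m F R σ) :
    IsSmoothSection m F fun p => Ψ p (ExteriorAlgebra.ι ℝ (σ p)) := by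
  -- Here the augmentation is zero and the derivative along `s` is the smooth scalar `s(σ)`.
  refine isSmoothSection_of_der hD (fun p a h0 h1 => ?_) ?_ fun s => ?_
  · have : Module.Finite ℝ (Codir (R p)) :=
      Module.Finite.equiv (codirEquiv ((frame m F R p).φ p))
    have h : (Ψ p).symm a = 0 := by
      refine eq_zero_of_contract_eq_zero ?_ fun t => ?_
      · rw [← eps_eq (m := m) (F := F), h1]
      · refine (Ψ p).injective ((hΨ p t _).trans ?_)
        rw [AlgEquiv.apply_symm_apply, h0, map_zero]
    rw [← (Ψ p).apply_symm_apply a, h, map_zero]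
  · have h : ∀ p, eps m F p (Ψ p (ExteriorAlgebra.ι ℝ (σ p))) = 0 := fun p => by
      rw [eps_eq (Ψ p), AlgEquiv.symm_apply_apply, aug_ι]
    simp only [h]
    exact contMDiff_const
  · let f : C^∞⟮𝓡 m, M; ℝ⟯ := ⟨fun p => s.1 p (σ p), s.2 σ hσ⟩
    have h : ∀ p, D p (s.1 p) (Ψ p (ExteriorAlgebra.ι ℝ (σ p))) =
        (f • (1 : SuperFun m F R)) p := by
      intro p
      rw [← hΨ, contract_ι, AlgEquiv.commutes, Algebra.algebraMap_eq_smul_one]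
      rfl
    simp only [h]
    exact ContMDiffSection.contMDiff _

include n in
-- A smooth section of `Λ S^*M` is locally a polynomial in functions and codirections, and products
-- of superfunctions are smooth; so codirections suffice.
theorem isSmoothSection_of_isSmoothExt
    (hΨ : ∀ σ, IsSmoothCodir m F R σ →
      IsSmoothSection m F fun p => Ψ p (ExteriorAlgebra.ι ℝ (σ p)))
    {w : ∀ p, ExteriorAlgebra ℝ (Codir (R p))} (hw : IsSmoothExt m F R w) :
    IsSmoothSection m F fun p => Ψ p (w p) := by
  intro p₀
  obtain ⟨U, hU, hp, τ, hτ, hwτ⟩ := hw p₀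
  have h : IsSmoothSection m F fun p => Ψ p (τ p) := by
    clear hwτ
    induction hτ using Algebra.adjoin_induction with
    | mem τ hτ =>
      rcases hτ with ⟨f, hf⟩ | ⟨σ, hσ, hτ⟩
      · have e : ∀ p, Ψ p (τ p) = (f • (1 : SuperFun m F R)) p := fun p => by
          rw [hf, AlgEquiv.commutes, Algebra.algebraMap_eq_smul_one]
          rfl
        simp only [e]
        exact ContMDiffSection.contMDiff _
      · simp only [hτ]
        exact hΨ σ hσ
    | algebraMap r =>
      have e : ∀ p, Ψ p (algebraMap ℝ (∀ p, ExteriorAlgebra ℝ (Codir (R p))) r p) =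
          (r • (1 : SuperFun m F R)) p := fun p => by
        rw [Pi.algebraMap_apply, AlgEquiv.commutes, Algebra.algebraMap_eq_smul_one]
        rfl
      simp only [e]
      exact ContMDiffSection.contMDiff _
    | add x y _ _ hx hy =>
      simp only [Pi.add_apply, map_add]
      exact hx.add_section hy
    | mul x y _ _ hx hy =>
      simp only [Pi.mul_apply, map_mul]
      exact contMDiff_mul ⟨fun p => Ψ p (x p), hx⟩ ⟨fun p => Ψ p (y p), hy⟩
  refine (h p₀).congr_of_eventuallyEq ?_
  filter_upwards [hU.mem_nhds hp] with p hp
  rw [hwτ p hp]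

/-- The trivialization by means of a smooth family of straightenings of the fibres. -/
def Frame.adapt {p₀ : M} (fr : Frame m F R p₀)
    (hpar : ∀ p i, ∀ x, Ψ p x ∈ SuperalgebraBundle.parity m F (R := R) p i ↔
      x ∈ extParity (Codir (R p)) i)
    (hΨ : ∀ σ, IsSmoothCodir m F R σ →
      IsSmoothSection m F fun p => Ψ p (ExteriorAlgebra.ι ℝ (σ p))) : Frame m F R p₀ where
  U := fr.U
  isOpen := fr.isOpen
  φ p := (exteriorEquiv (codirEquiv (fr.φ p))).trans (Ψ p)
  parity_eq p hp i := by
    ext a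
    constructor
    · rintro ⟨x, hx, rfl⟩
      exact (hpar p i _).2 ((exteriorEquiv_mem_parity _).2 hx)
    · intro ha
      refine ⟨((exteriorEquiv (codirEquiv (fr.φ p))).trans (Ψ p)).symm a, ?_,
        AlgEquiv.apply_symm_apply _ a⟩
      refine (exteriorEquiv_mem_parity (codirEquiv (fr.φ p))).1 ((hpar p i _).1 ?_)
      rwa [show Ψ p (exteriorEquiv (codirEquiv (fr.φ p))
        (((exteriorEquiv (codirEquiv (fr.φ p))).trans (Ψ p)).symm a)) = a from
          AlgEquiv.apply_symm_apply ((exteriorEquiv (codirEquiv (fr.φ p))).trans (Ψ p)) a]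
  smooth a := by
    change SmoothOn m F R (fun p => Ψ p (ExteriorAlgebra.map (codirEquiv (fr.φ p)).toLinearMap a))
      fr.U
    induction a using ExteriorAlgebra.induction with
    | algebraMap r =>
      simp only [AlgHom.commutes, AlgEquiv.commutes]
      exact SmoothOn.const_smul_one r fr.U
    | ι v =>
      intro p hp
      refine ContMDiffAt.contMDiffWithinAt ?_
      obtain ⟨χ, hχ, η, hη⟩ := exists_section_eventuallyEq fr.isOpen
        (fr.smooth (ExteriorAlgebra.ι ℝ v)) hp
      have hmem : ∀ q, η q ∈ nilIdeal (R q) := fun q => by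
        rw [hη]
        exact Submodule.smul_mem _ _ (map_ι_mem_nilIdeal _ _)
      refine (hΨ _ (isSmoothCodir_of_superFun η hmem) p).congr_of_eventuallyEq ?_
      filter_upwards [hχ] with q hq
      rw [ExteriorAlgebra.map_apply_ι, LinearEquiv.coe_coe, codirEquiv_apply]
      congr 5
      rw [hη, hq, one_smul]
    | mul a b ha hb =>
      simp only [map_mul]
      exact SmoothOn.mul fr.isOpen ha hb
    | add a b ha hb =>
      simp only [map_add]
      exact ContMDiffOn.add_section ha hb
  χ := fr.χ
  χ_eventually := fr.χ_eventually
  tsupport_subset := fr.tsupport_subset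

/-- The cutoff is put on the linear map, so that generators go to global smooth codirections; the
degree `k` part is thereby scaled by `χ^k`, which is harmless where `χ = 1`. -/
theorem Frame.map_codir_mem_adjoin {p₀ : M} (fr : Frame m F R p₀) (a : Model n) :
    (fun p => ExteriorAlgebra.map (fr.χ p • (codirEquiv (fr.φ p)).toLinearMap) a) ∈
      Algebra.adjoin ℝ ({τ : ∀ p, ExteriorAlgebra ℝ (Codir (R p)) |
          ∃ f : C^∞⟮𝓡 m, M; ℝ⟯, ∀ p, τ p = algebraMap ℝ _ (f p)} ∪
        {τ | ∃ σ, IsSmoothCodir m F R σ ∧ ∀ p, τ p = ExteriorAlgebra.ι ℝ (σ p)}) := by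
  induction a using ExteriorAlgebra.induction with
  | algebraMap r =>
    simp only [AlgHom.commutes]
    exact Subalgebra.algebraMap_mem _ r
  | ι v =>
    refine Algebra.subset_adjoin (Or.inr ⟨fr.codir v, fr.isSmoothCodir_codir v, fun p => ?_⟩)
    exact ExteriorAlgebra.map_apply_ι _ _
  | mul a b ha hb =>
    simp only [map_mul]
    exact mul_mem ha hb
  | add a b ha hb =>
    simp only [map_add]
    exact add_mem ha hb

/-- In the frame adapted to `Ψ`, the coordinates of `Ψ(w)` are smooth and are also the coordinates
of `w` in the exterior frame of codirections. -/
theorem isSmoothExt_of_isSmoothSection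
    (hpar : ∀ p i, ∀ x, Ψ p x ∈ SuperalgebraBundle.parity m F (R := R) p i ↔
      x ∈ extParity (Codir (R p)) i)
    (hΨ : ∀ σ, IsSmoothCodir m F R σ →
      IsSmoothSection m F fun p => Ψ p (ExteriorAlgebra.ι ℝ (σ p)))
    {w : ∀ p, ExteriorAlgebra ℝ (Codir (R p))} (hw : IsSmoothSection m F fun p => Ψ p (w p)) :
    IsSmoothExt m F R w := by
  intro p₀
  let fr := frame m F R p₀
  let fr' := fr.adapt hpar hΨ
  let η : SuperFun m F R := ⟨fun p => Ψ p (w p), hw⟩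
  obtain ⟨U, hχ, hU, hp⟩ := eventually_nhds_iff.1 fr.χ_eventually
  refine ⟨U, hU, hp, ∑ k, (fun p => algebraMap ℝ _ (fr'.functional ((modelBasis n).coord k) η p)) *
    (fun p => ExteriorAlgebra.map (fr.χ p • (codirEquiv (fr.φ p)).toLinearMap) (modelBasis n k)),
    sum_mem fun k _ => mul_mem (Algebra.subset_adjoin (Or.inl ⟨_, fun p => rfl⟩))
      (fr.map_codir_mem_adjoin _), fun p hpU => ?_⟩
  rw [Finset.sum_apply]
  have h1 : exteriorEquiv (codirEquiv (fr.φ p)) ((fr'.φ p).symm (η p)) = w p := by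
    refine (Ψ p).injective ?_
    exact (fr'.φ p).apply_symm_apply (η p)
  rw [← h1]
  conv_lhs => rw [← (modelBasis n).sum_repr ((fr'.φ p).symm (η p)), map_sum]
  refine Finset.sum_congr rfl fun k _ => ?_
  rw [map_smul, Pi.mul_apply, Frame.functional_apply, hχ p hpU, one_smul, ← Algebra.smul_def]
  change _ = (fr.χ p * _) • _
  rw [hχ p hpU, one_mul]
  rfl

end Straighten

/-- A homomorphism sending generators to odd elements commutes with the involutions; injectivity
then gives the converse inclusion. -/
theorem parity_iff_of_map_parity {p : M} {Ψ : ExteriorAlgebra ℝ (Codir (R p)) ≃ₐ[ℝ] R p}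
    (h : ∀ i, ∀ x ∈ extParity (Codir (R p)) i, Ψ x ∈ SuperalgebraBundle.parity m F (R := R) p i)
    (i : ZMod 2) (x : ExteriorAlgebra ℝ (Codir (R p))) :
    Ψ x ∈ SuperalgebraBundle.parity m F (R := R) p i ↔ x ∈ extParity (Codir (R p)) i := by
  refine ⟨fun hx => ?_, h i x⟩
  let fr := frame m F R p
  rw [fr.mem_parity_iff fr.mem, mem_extParity_iff] at hx
  have hinv := map_ι_mem_of_odd (Φ := (fr.φ p).symm.toAlgHom.comp Ψ.toAlgHom) (fun σ =>
    (fr.mem_parity_iff fr.mem).1 (h 1 _ (CliffordAlgebra.ι_mem_evenOdd_one _ σ))) x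
  change (fr.φ p).symm (Ψ (invol x)) = invol ((fr.φ p).symm (Ψ x)) at hinv
  rw [← hinv, ← map_smul, ← map_smul] at hx
  rw [mem_extParity_iff]
  exact Ψ.injective ((fr.φ p).symm.injective hx)

variable (m F) in
include m F in
theorem exists_dir_ne_zero (hn : 1 ≤ n) (p : M) : ∃ t : Dir (R p), t ≠ 0 := by
  have e := codirEquiv ((frame m F R p).φ p)
  have : Nonempty (Fin n) := ⟨⟨0, hn⟩⟩
  have : Nontrivial (Codir (R p)) := e.injective.nontrivial
  exact exists_ne 0

/-! ### From commuting odd superderivations to a straightening -/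

namespace Inclusion

variable (ψ : Inclusion m F R)

/-- If `ψ(s)(η)` were never invertible at `p`, its augmentation there would always vanish, and
injectivity would kill every odd direction at `p`; but one is nonzero because `n ≥ 1`. -/
theorem exists_isUnit (hn : 1 ≤ n) (p : M) :
    ∃ (s : OddSection m F R) (η : SuperFun m F R), IsUnit ((ψ.odd s).1 η p) := by
  obtain ⟨t, ht⟩ := exists_dir_ne_zero m F (R := R) hn p
  by_contra! h
  refine ht ?_
  rw [← extendDir_self (m := m) (F := F) p t]
  refine ψ.odd_injective _ p fun η _ => ?_
  rw [mem_nilIdeal_iff_eps (m := m) (F := F)]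
  by_contra h0
  exact h _ η (isUnit_of_eps_ne_zero h0)

theorem odd_smul (f : C^∞⟮𝓡 m, M; ℝ⟯) (s : OddSection m F R) (η : SuperFun m F R) :
    (ψ.odd (f • s)).1 η = f • (ψ.odd s).1 η := by
  rw [map_smul]; rfl

theorem odd_sub_apply (s t : OddSection m F R) (η : SuperFun m F R) :
    (ψ.odd (s - t)).1 η = (ψ.odd s).1 η - (ψ.odd t).1 η := by
  have e : s - t + t = s := Subtype.ext (sub_add_cancel s.1 t.1)
  have h : ψ.odd s = ψ.odd (s - t) + ψ.odd t := by rw [← map_add, e]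
  rw [h]
  exact (add_sub_cancel_right _ _).symm

variable {ψ}

theorem OddCommute.comm (h : ψ.OddCommute) (s t : OddSection m F R) (η : SuperFun m F R) :
    (ψ.odd s).1 ((ψ.odd t).1 η) + (ψ.odd t).1 ((ψ.odd s).1 η) = 0 := by
  have := congrArg (fun D => D η) (h s t)
  simpa [superBracket] using this

/-- Insert `f t` for `t` in the anticommutation relation: what remains is `ψ(s)(f) · ψ(t)(η) = 0`,
and the second factor can be chosen invertible at `p`. -/
theorem OddCommute.odd_smul_one (hn : 1 ≤ n) (h : ψ.OddCommute) (s : OddSection m F R)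
    (f : C^∞⟮𝓡 m, M; ℝ⟯) : (ψ.odd s).1 (f • 1) = 0 := by
  ext p
  obtain ⟨t, η, hu⟩ := ψ.exists_isUnit hn p
  have h1 := h.comm s (f • t) η
  rw [odd_smul, odd_smul, superDer_smul (ψ.odd s).2, add_assoc, ← smul_add, h.comm, smul_zero,
    add_zero] at h1
  have h2 : (ψ.odd s).1 (f • 1) p * (ψ.odd t).1 η p = 0 := congrArg (fun θ => θ p) h1
  rw [ContMDiffSection.coe_zero, Pi.zero_apply]
  exact hu.mul_left_eq_zero.1 h2

theorem OddCommute.smul_apply (hn : 1 ≤ n) (h : ψ.OddCommute) (s : OddSection m F R)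
    (f : C^∞⟮𝓡 m, M; ℝ⟯) (η : SuperFun m F R) : (ψ.odd s).1 (f • η) = f • (ψ.odd s).1 η := by
  rw [superDer_smul (ψ.odd s).2, h.odd_smul_one hn]
  ext p
  simp

variable (ψ) in
/-- The action of odd directions at `p` on the fibre at `p`. -/
def oddAt (p : M) : Dir (R p) →ₗ[ℝ] Module.End ℝ (R p) :=
  LinearMap.mk₂ ℝ (fun t a => (ψ.odd (extendDir m F p t)).1 (extend m F p a) p)
    (fun s t a => by rw [map_add, map_add]; rfl)
    (fun c t a => by
      have e : c • extendDir m F p t = (ContMDiffMap.const c : C^∞⟮𝓡 m, M; ℝ⟯) • extendDir m F p t :=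
        rfl
      rw [map_smul, e, odd_smul]; rfl)
    (fun t a b => by rw [map_add, map_add]; rfl)
    (fun c t a => by rw [map_smul, map_smul]; rfl)

/-- `ψ(s)(η)` is now linear over functions in both arguments, so it is determined pointwise. -/
theorem OddCommute.odd_apply (hn : 1 ≤ n) (h : ψ.OddCommute) (s : OddSection m F R)
    (η : SuperFun m F R) (p : M) : (ψ.odd s).1 η p = ψ.oddAt p (s.1 p) (η p) := by
  rw [apply_eq_extend_of_linear (h.smul_apply hn s) p]
  let B : OddSection m F R →ₗ[ℝ] R p :=
    { toFun := fun s => (ψ.odd s).1 (extend m F p (η p)) p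
      map_add' := fun s t => by rw [map_add]; rfl
      map_smul' := fun c s => by
        have e : c • s = (ContMDiffMap.const c : C^∞⟮𝓡 m, M; ℝ⟯) • s := rfl
        rw [e, odd_smul]; rfl }
  exact oddSection_apply_eq B (fun f s => by
    change (ψ.odd (f • s)).1 (extend m F p (η p)) p = _
    rw [odd_smul]; rfl) s

/-- A commuting odd inclusion comes from a straightening. -/
theorem OddCommute.exists_straightening (hn : 1 ≤ n) (h : ψ.OddCommute) :
    ∃ Ψ : Straightening m F R, Ψ.Intertwines ψ := by
  have hfib : ∀ p, ∃ Ψ : ExteriorAlgebra ℝ (Codir (R p)) ≃ₐ[ℝ] R p,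
      (∀ i, ∀ x ∈ extParity (Codir (R p)) i, Ψ x ∈ SuperalgebraBundle.parity m F (R := R) p i) ∧
      ∀ s w, Ψ (contract s w) = ψ.oddAt p s (Ψ w) := by
    intro p
    refine exists_straightening_of_der ((frame m F R p).φ p)
      ((frame m F R p).parity_eq p (frame m F R p).mem) (ψ.oddAt p) ?_ ?_ ?_ ?_
    · intro s j a ha
      exact (ψ.odd (extendDir m F p s)).2.1 j _ (isHomogeneous_extend ha) p
    · intro s j a b ha
      have h1 := congrArg (fun θ => θ p) ((ψ.odd (extendDir m F p s)).2.2 j _ (extend m F p b)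
        (isHomogeneous_extend ha))
      simp only [h.odd_apply hn, ContMDiffSection.coe_add, Pi.add_apply, mul_section_apply,
        ContMDiffSection.coe_smul, Pi.smul_apply, extend_self, extendDir_self] at h1
      exact h1
    · intro s a
      have h1 := congrArg (fun θ => θ p)
        (h.comm (extendDir m F p s) (extendDir m F p s) (extend m F p a))
      simp only [h.odd_apply hn, ContMDiffSection.coe_add, Pi.add_apply, extend_self,
        extendDir_self, ContMDiffSection.coe_zero, Pi.zero_apply] at h1
      rwa [← two_smul ℝ, smul_eq_zero_iff_right two_ne_zero] at h1
    · intro s hs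
      rw [← extendDir_self (m := m) (F := F) p s]
      refine ψ.odd_injective _ p fun η hη => ?_
      rw [h.odd_apply hn, extendDir_self]
      exact hs _ (hη p)
  choose Ψ hpar hΨ using hfib
  have hsmooth := fun σ (hσ : IsSmoothCodir m F R σ) =>
    isSmoothSection_ι_of_der (D := ψ.oddAt) (fun s η => by
      simp only [← h.odd_apply hn]
      exact ContMDiffSection.contMDiff _) hΨ hσ
  refine ⟨⟨Ψ, hpar, fun w => ⟨fun hw => ?_, fun hw => ?_⟩⟩, fun s w hw p => ?_⟩
  · exact contMDiffOn_univ.2 (isSmoothSection_of_isSmoothExt hsmooth hw)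
  · exact isSmoothExt_of_isSmoothSection (fun p => parity_iff_of_map_parity (hpar p)) hsmooth
      (contMDiffOn_univ.1 hw)
  · rw [h.odd_apply hn]
    exact hΨ p _ _

end Inclusion

/-! ### Uniqueness of the straightening, the connection and the inclusion -/

namespace Straightening

variable (Ψ : Straightening m F R)

/-- The smooth section `Ψ⁻¹(η)` of `Λ S^*M`. -/
theorem isSmoothExt_symm (η : SuperFun m F R) :
    IsSmoothExt m F R fun p => (Ψ.toFun p).symm (η p) := by
  rw [Ψ.smooth_iff]
  simp only [AlgEquiv.apply_symm_apply]
  exact η.contMDiff.contMDiffOn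

variable {Ψ} in
theorem Intertwines.odd_apply {ψ : Inclusion m F R} (h : Ψ.Intertwines ψ) (s : OddSection m F R)
    (η : SuperFun m F R) (p : M) :
    (ψ.odd s).1 η p = Ψ.toFun p (contract (s.1 p) ((Ψ.toFun p).symm (η p))) := by
  rw [h s _ (Ψ.isSmoothExt_symm η) p]
  congr 2
  ext q
  exact ((Ψ.toFun q).apply_symm_apply (η q)).symm

-- `Ψ'⁻¹ Ψ - id` commutes with all contractions, and its values are nilpotent since both
-- isomorphisms preserve the augmentation; rigidity makes it zero.
variable {Ψ} in
theorem Intertwines.unique {ψ : Inclusion m F R} (h : Ψ.Intertwines ψ) {Ψ' : Straightening m F R}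
    (h' : Ψ'.Intertwines ψ) : Ψ = Ψ' := by
  ext p w
  have : Module.Finite ℝ (Codir (R p)) := Module.Finite.equiv (codirEquiv ((frame m F R p).φ p))
  let H : ExteriorAlgebra ℝ (Codir (R p)) →ₗ[ℝ] ExteriorAlgebra ℝ (Codir (R p)) :=
    ((Ψ.toFun p).trans (Ψ'.toFun p).symm).toLinearMap - LinearMap.id
  have hH : ∀ w, H w = (Ψ'.toFun p).symm (Ψ.toFun p w) - w := fun w => rfl
  have key : ∀ (t : Dir (R p)) (a : R p), Ψ.toFun p (contract t ((Ψ.toFun p).symm a)) =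
      Ψ'.toFun p (contract t ((Ψ'.toFun p).symm a)) := by
    intro t a
    have h1 := h.odd_apply (extendDir m F p t) (extend m F p a) p
    rw [h'.odd_apply, extendDir_self, extend_self] at h1
    exact h1.symm
  have h0 : H = 0 := by
    refine eq_zero_of_commute_contract H (fun w => ?_) fun t w => ?_
    · rw [hH, map_sub, ← aug_symm_eq (Ψ.toFun p), AlgEquiv.symm_apply_apply, sub_self]
    · have h1 := key t (Ψ.toFun p w)
      rw [AlgEquiv.symm_apply_apply] at h1
      have h2 : H (contract t w) = contract t (H w) := by
        rw [hH, hH, h1, AlgEquiv.symm_apply_apply]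
        exact (map_sub _ _ _).symm
      exact h2
  have h1 := congrArg (fun f => f w) h0
  rw [hH, LinearMap.zero_apply, sub_eq_zero, AlgEquiv.symm_apply_eq] at h1
  exact h1

end Straightening

/-- The bracket determines `ψ(∇_X s)`, and `ψ` is injective on odd directions. -/
theorem Inclusion.Compatible.unique {ψ : Inclusion m F R} {nabla nabla' : Connection m F R}
    (h : ψ.Compatible nabla) (h' : ψ.Compatible nabla') : nabla = nabla' := by
  ext1
  refine LinearMap.ext fun X => LinearMap.ext fun s => ?_
  rw [← sub_eq_zero]
  ext1
  funext p
  refine ψ.odd_injective _ p fun η _ => ?_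
  rw [ψ.odd_sub_apply, ← h, ← h', sub_self]
  exact zero_mem _

theorem exists_add_parity_fibre {p : M} (a : R p) :
    ∃ x ∈ SuperalgebraBundle.parity m F (R := R) p 0,
      ∃ y ∈ SuperalgebraBundle.parity m F (R := R) p 1, x + y = a := by
  let fr := frame m F R p
  obtain ⟨x, hx, y, hy, h⟩ := exists_add_parity ((fr.φ p).symm a)
  refine ⟨fr.φ p x, ?_, fr.φ p y, ?_, ?_⟩
  · rw [fr.mem_parity_iff fr.mem, AlgEquiv.symm_apply_apply]; exact hx
  · rw [fr.mem_parity_iff fr.mem, AlgEquiv.symm_apply_apply]; exact hy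
  · rw [← map_add, h, AlgEquiv.apply_symm_apply]

theorem eps_eq_zero_of_odd {p : M} {a : R p}
    (ha : a ∈ SuperalgebraBundle.parity m F (R := R) p 1) : eps m F p a = 0 :=
  aug_eq_zero_of_odd (((frame m F R p).mem_parity_iff (frame m F R p).mem).1 ha)

/-- An even superderivation commuting with the odd superderivations which correspond to the
contractions vanishes. -/
theorem superDer_eq_zero_of_commute (hn : 1 ≤ n) {ψ : Inclusion m F R} {Ψ : Straightening m F R}
    (hΨ : Ψ.Intertwines ψ) {D : SuperFun m F R →ₗ[ℝ] SuperFun m F R} (hD : D ∈ SuperDer m F R 0)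
    (hc : ∀ (s : OddSection m F R) (η : SuperFun m F R),
      D ((ψ.odd s).1 η) = (ψ.odd s).1 (D η)) : D = 0 := by
  -- Insert `f s` for `s` in the commutation relation: `D(f) · ψ(s)(η) = 0`, with an invertible
  -- second factor for suitable `s` and `η`.
  have h1 : ∀ f : C^∞⟮𝓡 m, M; ℝ⟯, D (f • 1) = 0 := by
    intro f
    ext p
    obtain ⟨s, η, hu⟩ := ψ.exists_isUnit hn p
    have h := hc (f • s) η
    rw [ψ.odd_smul, ψ.odd_smul, superDer_smul hD, hc, add_eq_right] at h
    have h2 : D (f • 1) p * (ψ.odd s).1 η p = 0 := congrArg (fun θ => θ p) h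
    exact hu.mul_left_eq_zero.1 h2
  have hlin : ∀ (f : C^∞⟮𝓡 m, M; ℝ⟯) (η : SuperFun m F R), D (f • η) = f • D η := by
    intro f η
    rw [superDer_smul hD, h1]
    ext p
    simp
  ext η p
  let Dp : R p →ₗ[ℝ] R p :=
    { toFun := fun a => D (extend m F p a) p
      map_add' := fun a b => by rw [map_add, map_add]; rfl
      map_smul' := fun c a => by rw [map_smul, map_smul]; rfl }
  have hDp : ∀ θ : SuperFun m F R, D θ p = Dp (θ p) := apply_eq_extend_of_linear hlin p
  have hmul : ∀ a b, Dp (a * b) = Dp a * b + a * Dp b := by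
    intro a b
    have h : ∀ j, ∀ x ∈ SuperalgebraBundle.parity m F (R := R) p j,
        Dp (x * b) = Dp x * b + x * Dp b := by
      intro j x hx
      have h2 := congrArg (fun θ => θ p) (hD.2 j _ (extend m F p b) (isHomogeneous_extend hx))
      simp only [hDp, mul_section_apply, ContMDiffSection.coe_add, Pi.add_apply, extend_self,
        sgn_zero_left, one_smul] at h2
      exact h2
    obtain ⟨x, hx, y, hy, rfl⟩ := exists_add_parity_fibre (m := m) (F := F) a
    rw [add_mul, map_add, h 0 x hx, h 1 y hy, map_add, add_mul, add_mul]
    abel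
  have : Module.Finite ℝ (Codir (R p)) := Module.Finite.equiv (codirEquiv ((frame m F R p).φ p))
  let H : ExteriorAlgebra ℝ (Codir (R p)) →ₗ[ℝ] ExteriorAlgebra ℝ (Codir (R p)) :=
    (Ψ.toFun p).symm.toLinearMap ∘ₗ Dp ∘ₗ (Ψ.toFun p).toLinearMap
  have hH : ∀ w, H w = (Ψ.toFun p).symm (Dp (Ψ.toFun p w)) := fun w => rfl
  have haug : ∀ w, aug (H w) = eps m F p (Dp (Ψ.toFun p w)) := fun w => (eps_eq (Ψ.toFun p) _).symm
  have h0 : H = 0 := by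
    refine eq_zero_of_commute_contract H (fun w => ?_) fun t w => ?_
    -- Nilpotent values: `D` kills constants, sends generators to odd elements, and the Leibniz rule
    -- covers products.
    · rw [haug]
      induction w using ExteriorAlgebra.induction with
      | algebraMap r =>
        have h2 := hDp ((ContMDiffMap.const r : C^∞⟮𝓡 m, M; ℝ⟯) • 1)
        rw [h1] at h2
        rw [AlgEquiv.commutes, Algebra.algebraMap_eq_smul_one]
        exact (congrArg (eps m F p) h2.symm).trans (map_zero _)
      | ι σ =>
        refine eps_eq_zero_of_odd ?_
        have h2 := hD.1 1 _ (isHomogeneous_extend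
          (Ψ.map_parity p 1 _ (CliffordAlgebra.ι_mem_evenOdd_one _ σ))) p
        rw [hDp, extend_self, zero_add] at h2
        exact h2
      | mul a b ha hb => rw [map_mul, hmul, map_add, map_mul, map_mul, ha, hb, mul_zero, zero_mul,
          add_zero]
      | add a b ha hb => rw [map_add, map_add, map_add, ha, hb, add_zero]
    · have h2 := congrArg (fun θ => θ p) (hc (extendDir m F p t) (extend m F p (Ψ.toFun p w)))
      simp only [hDp, hΨ.odd_apply, extend_self, extendDir_self, AlgEquiv.symm_apply_apply] at h2
      have h3 : H (contract t w) = contract t (H w) := by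
        rw [hH, h2, AlgEquiv.symm_apply_apply, hH]
      exact h3
  have h2 := congrArg (fun f => Ψ.toFun p (f ((Ψ.toFun p).symm (η p)))) h0
  simp only [hH, AlgEquiv.apply_symm_apply, LinearMap.zero_apply, map_zero] at h2
  rw [hDp, h2]
  rfl

theorem Inclusion.Compatible.commute {ψ : Inclusion m F R} {nabla : Connection m F R}
    (h : ψ.Compatible nabla) (X : VectorField m M) (s : OddSection m F R) (η : SuperFun m F R) :
    (ψ.even X).1 ((ψ.odd s).1 η) =
      (ψ.odd s).1 ((ψ.even X).1 η) + (ψ.odd (nabla.toFun X s)).1 η := by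
  rw [← h X s]
  simp [superBracket]

/-- `Ψ` prescribes the odd part. The brackets with odd sections are prescribed by `∇`, so the even
parts differ by a superderivation commuting with the odd part. -/
theorem Inclusion.ext_of_intertwines (hn : 1 ≤ n) {ψ ψ' : Inclusion m F R}
    {Ψ : Straightening m F R} (hΨ : Ψ.Intertwines ψ) (hΨ' : Ψ.Intertwines ψ')
    {nabla : Connection m F R} (h : ψ.Compatible nabla) (h' : ψ'.Compatible nabla) : ψ = ψ' := by
  have hodd : ψ.odd = ψ'.odd := by
    refine LinearMap.ext fun s => Subtype.ext (LinearMap.ext fun η => ?_)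
    ext p
    rw [hΨ.odd_apply, hΨ'.odd_apply]
  refine Inclusion.ext (LinearMap.ext fun X => Subtype.ext ?_) hodd
  rw [← sub_eq_zero]
  refine superDer_eq_zero_of_commute hn hΨ (sub_mem (ψ.even X).2 (ψ'.even X).2) fun s η => ?_
  have h1 := h.commute X s η
  have h2 := h'.commute X s η
  rw [← hodd] at h2
  rw [LinearMap.sub_apply, h1, h2, LinearMap.sub_apply, map_sub]
  abel

end Sections

/-! ### Derivatives of functions along vector fields -/

section LieDeriv

variable {m : ℕ} {M : Type*} [TopologicalSpace M] [ChartedSpace (EuclideanSpace ℝ (Fin m)) M]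
  [IsManifold (𝓡 m) ∞ M] (X : VectorField m M) (f g : C^∞⟮𝓡 m, M; ℝ⟯) (p : M)

variable {f g p} in
theorem lieDeriv_congr (h : f =ᶠ[𝓝 p] g) : lieDeriv m X f p = lieDeriv m X g p := by
  rw [lieDeriv, lieDeriv, h.mfderiv_eq]
  rfl

theorem lieDeriv_add : lieDeriv m X (f + g) p = lieDeriv m X f p + lieDeriv m X g p := by
  have h := ((f.mdifferentiableAt (x := p)).hasMFDerivAt.add
    (g.mdifferentiableAt (x := p)).hasMFDerivAt).mfderiv
  rw [lieDeriv, ContMDiffMap.coe_add, h]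
  rfl

theorem lieDeriv_mul :
    lieDeriv m X (f * g) p = lieDeriv m X f p * g p + f p * lieDeriv m X g p := by
  have h := ((f.mdifferentiableAt (x := p)).hasMFDerivAt.mul
    (g.mdifferentiableAt (x := p)).hasMFDerivAt).mfderiv
  rw [lieDeriv, ContMDiffMap.coe_mul, h]
  change f p * lieDeriv m X g p + g p * lieDeriv m X f p = _
  ring

theorem lieDeriv_smul (c : ℝ) : lieDeriv m X (c • f) p = c * lieDeriv m X f p := by
  have h := ((f.mdifferentiableAt (x := p)).hasMFDerivAt.const_smul c).mfderiv
  rw [lieDeriv, ContMDiffMap.coe_smul, h]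
  rfl

theorem lieDeriv_const (c : ℝ) : lieDeriv m X (ContMDiffMap.const c) p = 0 := by
  have h := mfderiv_const (I := 𝓡 m) (I' := 𝓘(ℝ, ℝ)) (x := p) (c := c)
  change mfderiv (𝓡 m) 𝓘(ℝ, ℝ) (fun _ => c) p (X p) = 0
  rw [h]
  rfl

/-- The derivative along a vector field at a point, as a linear functional. -/
def lieDerivAt : C^∞⟮𝓡 m, M; ℝ⟯ →ₗ[ℝ] ℝ where
  toFun f := lieDeriv m X f p
  map_add' f g := lieDeriv_add X f g p
  map_smul' c f := lieDeriv_smul X f p c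

theorem lieDeriv_sum {ι : Type*} (s : Finset ι) (f : ι → C^∞⟮𝓡 m, M; ℝ⟯) :
    lieDeriv m X (∑ i ∈ s, f i) p = ∑ i ∈ s, lieDeriv m X (f i) p :=
  map_sum (lieDerivAt X p) f s

theorem lieDeriv_add_left (Y : VectorField m M) :
    lieDeriv m (X + Y) f p = lieDeriv m X f p + lieDeriv m Y f p :=
  map_add (mfderiv (𝓡 m) 𝓘(ℝ, ℝ) f p) (X p) (Y p)

theorem lieDeriv_smul_left (g : C^∞⟮𝓡 m, M; ℝ⟯) :
    lieDeriv m (g • X) f p = g p * lieDeriv m X f p :=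
  map_smul (mfderiv (𝓡 m) 𝓘(ℝ, ℝ) f p) (g p) (X p)

theorem contMDiff_lieDeriv : ContMDiff (𝓡 m) 𝓘(ℝ, ℝ) ∞ (lieDeriv m X f) := by
  have : IsManifold (𝓡 m) 1 M := IsManifold.of_le (n := ∞) (by norm_num)
  have h := f.contMDiff.contMDiff_tangentMap (m := ∞) (by norm_num)
  exact (contMDiff_snd_tangentBundle_modelSpace ℝ 𝓘(ℝ, ℝ)).comp (h.comp X.contMDiff)

/-- The smooth function `X(f)`. -/
def lieDerivFun : C^∞⟮𝓡 m, M; ℝ⟯ := ⟨lieDeriv m X f, contMDiff_lieDeriv X f⟩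

variable [T2Space M] [SigmaCompactSpace M]

-- Test against cut-off chart coordinates; the differential of the chart is injective.
variable {X p} in
theorem eq_zero_of_lieDeriv (h : ∀ f, lieDeriv m X f p = 0) : X p = 0 := by
  have : IsManifold (𝓡 m) 1 M := IsManifold.of_le (n := ∞) (by norm_num)
  let e := extChartAt (𝓡 m) p
  have hU : IsOpen (chartAt (EuclideanSpace ℝ (Fin m)) p).source :=
    (chartAt (EuclideanSpace ℝ (Fin m)) p).open_source
  have hp := mem_chart_source (EuclideanSpace ℝ (Fin m)) p
  obtain ⟨χ, hχ, hs⟩ := exists_cutoff m hU hp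
  have hinv := isInvertible_mfderiv_extChartAt (I := 𝓡 m) (mem_extChartAt_source (I := 𝓡 m) p)
  refine hinv.injective (Eq.trans ?_ (map_zero _).symm)
  have he : ContMDiffOn (𝓡 m) 𝓘(ℝ, EuclideanSpace ℝ (Fin m)) ∞ e
    (chartAt (EuclideanSpace ℝ (Fin m)) p).source := contMDiffOn_extChartAt
  have hd := ((he.contMDiffAt (hU.mem_nhds hp)).mdifferentiableAt (by simp)).hasMFDerivAt
  have hL : ∀ L : EuclideanSpace ℝ (Fin m) →L[ℝ] ℝ,
      L (mfderiv (𝓡 m) 𝓘(ℝ, EuclideanSpace ℝ (Fin m)) e p (X p)) = 0 := by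
    intro L
    let g : C^∞⟮𝓡 m, M; ℝ⟯ := ⟨fun q => χ q * L (e q), by
      refine contMDiff_of_tsupport fun q hq => ?_
      refine χ.contMDiff.contMDiffAt.mul (L.contMDiff.contMDiffAt.comp q
        (he.contMDiffAt (hU.mem_nhds (hs ?_))))
      exact closure_mono (Function.support_mul_subset_left _ _) hq⟩
    have h1 := (L.hasMFDerivAt (x := e p)).comp p hd
    have h2 : g =ᶠ[𝓝 p] L ∘ e := by
      filter_upwards [hχ] with q hq
      change χ q * L (e q) = L (e q)
      rw [hq, one_mul]
    have h3 := h g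
    rw [lieDeriv, h2.mfderiv_eq, h1.mfderiv] at h3
    exact h3
  refine PiLp.ext fun i => ?_
  exact hL (EuclideanSpace.proj i)

end LieDeriv

section Fibre

variable {A : Type*} [Ring A] [Algebra ℝ A]

theorem invol_contractLeft {V : Type*} [AddCommGroup V] [Module ℝ V] (f : Module.Dual ℝ V)
    (a : ExteriorAlgebra ℝ V) :
    invol (CliffordAlgebra.contractLeft (Q := (0 : QuadraticForm ℝ V)) f a) =
      -CliffordAlgebra.contractLeft (Q := (0 : QuadraticForm ℝ V)) f (invol a) := by
  induction a using ExteriorAlgebra.induction with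
  | algebraMap r =>
    rw [AlgHom.commutes, CliffordAlgebra.contractLeft_algebraMap, map_zero, neg_zero]
  | ι v =>
    rw [invol_ι, map_neg, neg_neg, CliffordAlgebra.contractLeft_ι]
    exact AlgHom.commutes _ _
  | mul a b ha hb =>
    rw [contract_mul f, map_add, map_mul, map_mul, ha, hb, map_mul, contract_mul f,
      neg_add, neg_mul, mul_neg]
  | add a b ha hb => rw [map_add, map_add, ha, hb, map_add, map_add, neg_add]

theorem invol_contract (s : Dir A) (a : ExteriorAlgebra ℝ (Codir A)) :
    invol (contract s a) = -contract s (invol a) :=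
  invol_contractLeft s a

theorem contract_mem_parity (s : Dir A) {i : ZMod 2} {a : ExteriorAlgebra ℝ (Codir A)}
    (ha : a ∈ extParity (Codir A) i) : contract s a ∈ extParity (Codir A) (1 + i) := by
  rw [mem_extParity_iff] at *
  rw [invol_contract, ha, contract_smul, sgn_one_add, sgn_one_one, neg_one_mul, neg_smul]

end Fibre

/-! ### The odd part of the inclusion defined by a straightening -/

section Sections

variable {m n : ℕ} {M : Type*} [TopologicalSpace M] [ChartedSpace (EuclideanSpace ℝ (Fin m)) M]
  {F : Type*} [NormedAddCommGroup F] [NormedSpace ℝ F]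
  {R : M → Type*} [TopologicalSpace (TotalSpace F R)]
  [∀ p, Ring (R p)] [∀ p, Algebra ℝ (R p)] [∀ p, TopologicalSpace (R p)] [FiberBundle F R]
  [SuperalgebraBundle m F R n] [VectorBundle ℝ F R] [FiniteDimensional ℝ F]
  [IsManifold (𝓡 m) ∞ M] [T2Space M] [SigmaCompactSpace M]

theorem IsSmoothExt.contractLeft {w : ∀ p, ExteriorAlgebra ℝ (Codir (R p))}
    (hw : IsSmoothExt m F R w) (s : OddSection m F R) :
    IsSmoothExt m F R fun p => contract (s.1 p) (w p) := by
  intro p₀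
  obtain ⟨U, hU, hp, τ, hτ, hwτ⟩ := hw p₀
  refine ⟨U, hU, hp, fun p => contract (s.1 p) (τ p), ?_,
    fun p hp => congrArg (contract (s.1 p)) (hwτ p hp)⟩
  clear hwτ
  -- The Leibniz rule for contraction involves the involution, so the induction must carry both.
  suffices h : (fun p => contract (s.1 p) (τ p)) ∈ Algebra.adjoin ℝ
      ({τ : ∀ p, ExteriorAlgebra ℝ (Codir (R p)) |
          ∃ f : C^∞⟮𝓡 m, M; ℝ⟯, ∀ p, τ p = algebraMap ℝ _ (f p)} ∪
        {τ | ∃ σ, IsSmoothCodir m F R σ ∧ ∀ p, τ p = ExteriorAlgebra.ι ℝ (σ p)}) ∧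
      (fun p => invol (τ p)) ∈ Algebra.adjoin ℝ
      ({τ : ∀ p, ExteriorAlgebra ℝ (Codir (R p)) |
          ∃ f : C^∞⟮𝓡 m, M; ℝ⟯, ∀ p, τ p = algebraMap ℝ _ (f p)} ∪
        {τ | ∃ σ, IsSmoothCodir m F R σ ∧ ∀ p, τ p = ExteriorAlgebra.ι ℝ (σ p)}) from h.1
  induction hτ using Algebra.adjoin_induction with
  | mem τ hτ =>
    rcases hτ with ⟨f, hf⟩ | ⟨σ, hσ, hτ⟩
    · constructor
      · simp only [hf, contract_algebraMap]
        exact zero_mem _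
      · simp only [hf, AlgHom.commutes]
        exact Algebra.subset_adjoin (Or.inl ⟨f, fun _ => rfl⟩)
    · constructor
      · simp only [hτ, contract_ι]
        let f : C^∞⟮𝓡 m, M; ℝ⟯ := ⟨fun p => s.1 p (σ p), s.2 σ hσ⟩
        refine Algebra.subset_adjoin (Or.inl ?_)
        exact ⟨f, fun _ => rfl⟩
      · simp only [hτ, invol_ι]
        exact Subalgebra.neg_mem _ (x := fun p => ExteriorAlgebra.ι ℝ (σ p))
          (Algebra.subset_adjoin (Or.inr ⟨σ, hσ, fun _ => rfl⟩))
  | algebraMap r =>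
    constructor
    · simp only [Pi.algebraMap_apply, contract_algebraMap]
      exact zero_mem _
    · simp only [Pi.algebraMap_apply, AlgHom.commutes]
      exact Subalgebra.algebraMap_mem _ r
  | add x y _ _ hx hy =>
    simp only [Pi.add_apply, map_add]
    exact ⟨add_mem hx.1 hy.1, add_mem hx.2 hy.2⟩
  | mul x y hx' hy' hx hy =>
    simp only [Pi.mul_apply, contract_mul_apply, map_mul]
    exact ⟨add_mem (mul_mem hx.1 hy') (mul_mem hx.2 hy.1), mul_mem hx.2 hy.2⟩

namespace Straightening

variable (Ψ : Straightening m F R)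

theorem parity_iff (p : M) (i : ZMod 2) (x : ExteriorAlgebra ℝ (Codir (R p))) :
    Ψ.toFun p x ∈ SuperalgebraBundle.parity m F (R := R) p i ↔ x ∈ extParity (Codir (R p)) i :=
  parity_iff_of_map_parity (Ψ.map_parity p) i x

theorem symm_mem_parity {p : M} {i : ZMod 2} {a : R p}
    (ha : a ∈ SuperalgebraBundle.parity m F (R := R) p i) :
    (Ψ.toFun p).symm a ∈ extParity (Codir (R p)) i := by
  rwa [← Ψ.parity_iff, AlgEquiv.apply_symm_apply]

theorem invol_symm {i : ZMod 2} {η : SuperFun m F R} (hη : IsHomogeneous m F R i η) (p : M) :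
    invol ((Ψ.toFun p).symm (η p)) = sgn 1 i • (Ψ.toFun p).symm (η p) :=
  mem_extParity_iff.1 (Ψ.symm_mem_parity (hη p))

theorem map_contMDiff {w : ∀ p, ExteriorAlgebra ℝ (Codir (R p))} (hw : IsSmoothExt m F R w) :
    IsSmoothSection m F fun p => Ψ.toFun p (w p) :=
  contMDiffOn_univ.1 ((Ψ.smooth_iff w).1 hw)

/-- The contraction with `t`, transported to the fibre at `p` by the straightening. -/
def contractAt (p : M) : Dir (R p) →ₗ[ℝ] Module.End ℝ (R p) :=
  LinearMap.mk₂ ℝ (fun t a => Ψ.toFun p (contract t ((Ψ.toFun p).symm a)))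
    (fun s t a => by rw [contract_add_left, map_add])
    (fun c t a => by rw [contract_smul_left, map_smul])
    (fun t a b => by rw [map_add, contract_add, map_add])
    (fun c t a => by rw [map_smul, contract_smul, map_smul])

theorem contractAt_apply (p : M) (t : Dir (R p)) (a : R p) :
    Ψ.contractAt p t a = Ψ.toFun p (contract t ((Ψ.toFun p).symm a)) := rfl

theorem isSmoothSection_contractAt (s : OddSection m F R) (η : SuperFun m F R) :
    IsSmoothSection m F fun p => Ψ.contractAt p (s.1 p) (η p) :=
  Ψ.map_contMDiff ((Ψ.isSmoothExt_symm η).contractLeft s)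

/-- The contraction with `s`, transported to superfunctions by the straightening. -/
def oddOp (s : OddSection m F R) : SuperFun m F R →ₗ[ℝ] SuperFun m F R where
  toFun η := ⟨fun p => Ψ.contractAt p (s.1 p) (η p), Ψ.isSmoothSection_contractAt s η⟩
  map_add' η θ := by
    ext p
    exact map_add (Ψ.contractAt p (s.1 p)) (η p) (θ p)
  map_smul' c η := by
    ext p
    exact map_smul (Ψ.contractAt p (s.1 p)) c (η p)

theorem oddOp_apply (s : OddSection m F R) (η : SuperFun m F R) (p : M) :
    Ψ.oddOp s η p = Ψ.toFun p (contract (s.1 p) ((Ψ.toFun p).symm (η p))) := rfl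

theorem symm_oddOp_apply (s : OddSection m F R) (η : SuperFun m F R) (p : M) :
    (Ψ.toFun p).symm (Ψ.oddOp s η p) = contract (s.1 p) ((Ψ.toFun p).symm (η p)) := by
  rw [oddOp_apply, AlgEquiv.symm_apply_apply]

theorem oddOp_mem (s : OddSection m F R) : Ψ.oddOp s ∈ SuperDer m F R 1 := by
  refine ⟨fun j η hη p => ?_, fun j η θ hη => ?_⟩
  · exact Ψ.map_parity p _ _ (contract_mem_parity _ (Ψ.symm_mem_parity (hη p)))
  · ext p
    refine (Ψ.toFun p).symm.injective ?_
    rw [symm_oddOp_apply, mul_section_apply, map_mul, contract_mul_apply, Ψ.invol_symm hη,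
      ContMDiffSection.coe_add, Pi.add_apply, ContMDiffSection.coe_smul, Pi.smul_apply,
      mul_section_apply, mul_section_apply, map_add, map_smul, map_mul, map_mul,
      symm_oddOp_apply, symm_oddOp_apply, smul_mul_assoc]

/-- The odd part of the inclusion which corresponds to a straightening. -/
def odd : OddSection m F R →ₗ[C^∞⟮𝓡 m, M; ℝ⟯] SuperDer m F R 1 where
  toFun s := ⟨Ψ.oddOp s, Ψ.oddOp_mem s⟩
  map_add' s t := by
    refine Subtype.ext (LinearMap.ext fun η => ?_)
    ext p
    exact congrArg (fun f => f (η p)) (map_add (Ψ.contractAt p) (s.1 p) (t.1 p))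
  map_smul' f s := by
    refine Subtype.ext (LinearMap.ext fun η => ?_)
    ext p
    exact congrArg (fun g => g (η p)) (map_smul (Ψ.contractAt p) (f p) (s.1 p))

theorem odd_injective (s : OddSection m F R) (p : M)
    (h : ∀ η : SuperFun m F R, (∀ q, η q ∈ nilIdeal (R q)) →
      (Ψ.odd s).1 η p ∈ nilIdeal (R p)) : s.1 p = 0 := by
  refine LinearMap.ext fun σ => ?_
  have h1 := h (extend m F p (Ψ.toFun p (ExteriorAlgebra.ι ℝ σ)))
    (extend_mem_nilIdeal (map_ι_mem_nilIdeal (Ψ.toFun p) σ))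
  rw [mem_nilIdeal_iff (Ψ.toFun p)] at h1
  change aug ((Ψ.toFun p).symm (Ψ.oddOp s _ p)) = 0 at h1
  rw [symm_oddOp_apply, extend_self, AlgEquiv.symm_apply_apply, contract_ι, aug_algebraMap] at h1
  exact h1

end Straightening

end Sections

/-! ### Even derivations of the exterior algebra: the connection term -/

section Gam

variable {V : Type*} [AddCommGroup V] [Module ℝ V] {ι : Type*} [Fintype ι]

/-- The contraction of the exterior algebra by a linear functional. -/
abbrev interior (f : Module.Dual ℝ V) : ExteriorAlgebra ℝ V →ₗ[ℝ] ExteriorAlgebra ℝ V :=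
  CliffordAlgebra.contractLeft (Q := (0 : QuadraticForm ℝ V)) f

theorem interior_comm (f g : Module.Dual ℝ V) (a : ExteriorAlgebra ℝ V) :
    interior f (interior g a) = -interior g (interior f a) :=
  CliffordAlgebra.contractLeft_comm _ _ a

theorem interior_ι_mul (f : Module.Dual ℝ V) (v : V) (a : ExteriorAlgebra ℝ V) :
    interior f (ExteriorAlgebra.ι ℝ v * a) = f v • a - ExteriorAlgebra.ι ℝ v * interior f a :=
  CliffordAlgebra.contractLeft_ι_mul f v a

theorem interior_add_left (f g : Module.Dual ℝ V) (a : ExteriorAlgebra ℝ V) :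
    interior (f + g) a = interior f a + interior g a := by
  rw [interior, map_add]; rfl

theorem interior_smul_left (c : ℝ) (f : Module.Dual ℝ V) (a : ExteriorAlgebra ℝ V) :
    interior (c • f) a = c • interior f a := by
  rw [interior, map_smul]; rfl

theorem interior_sum_left (f : ι → Module.Dual ℝ V) (a : ExteriorAlgebra ℝ V) :
    interior (∑ j, f j) a = ∑ j, interior (f j) a := by
  rw [interior, map_sum, LinearMap.sum_apply]

theorem invol_interior (f : Module.Dual ℝ V) (a : ExteriorAlgebra ℝ V) :
    invol (interior f a) = -interior f (invol a) :=
  invol_contractLeft f a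

/-- The even derivation of the exterior algebra which extends the linear map
`w ↦ ∑ j, g j w • v j`. -/
def evenDer (v : ι → V) (g : ι → Module.Dual ℝ V) : ExteriorAlgebra ℝ V →ₗ[ℝ] ExteriorAlgebra ℝ V :=
  ∑ j, LinearMap.mulLeft ℝ (ExteriorAlgebra.ι ℝ (v j)) ∘ₗ interior (g j)

variable (v : ι → V) (g : ι → Module.Dual ℝ V)

theorem evenDer_apply (a : ExteriorAlgebra ℝ V) :
    evenDer v g a = ∑ j, ExteriorAlgebra.ι ℝ (v j) * interior (g j) a := by
  rw [evenDer, LinearMap.sum_apply]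
  rfl

theorem evenDer_mul (a b : ExteriorAlgebra ℝ V) :
    evenDer v g (a * b) = evenDer v g a * b + a * evenDer v g b := by
  simp only [evenDer_apply, Finset.sum_mul, Finset.mul_sum, ← Finset.sum_add_distrib]
  exact Finset.sum_congr rfl fun j _ => IsOddDer.ι_mul _ (contract_mul (g j)) (v j) a b

theorem evenDer_add_right (g' : ι → Module.Dual ℝ V) (a : ExteriorAlgebra ℝ V) :
    evenDer v (g + g') a = evenDer v g a + evenDer v g' a := by
  simp only [evenDer_apply, ← Finset.sum_add_distrib, ← mul_add, Pi.add_apply, interior_add_left]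

theorem evenDer_smul_right (c : ℝ) (a : ExteriorAlgebra ℝ V) :
    evenDer v (c • g) a = c • evenDer v g a := by
  simp only [evenDer_apply, Finset.smul_sum, Pi.smul_apply, interior_smul_left, mul_smul_comm]

theorem aug_evenDer (a : ExteriorAlgebra ℝ V) : aug (evenDer v g a) = 0 := by
  simp only [evenDer_apply, map_sum, map_mul, aug_ι, zero_mul, Finset.sum_const_zero]

theorem invol_evenDer (a : ExteriorAlgebra ℝ V) :
    invol (evenDer v g a) = evenDer v g (invol a) := by
  simp only [evenDer_apply, map_sum, map_mul, invol_ι, invol_interior, neg_mul_neg]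

/-- The commutator with a contraction is minus the contraction by the transformed functional. This
produces the connection form in `covDer_oddOp`. -/
theorem evenDer_interior (f : Module.Dual ℝ V) (a : ExteriorAlgebra ℝ V) :
    evenDer v g (interior f a) =
      interior f (evenDer v g a) - ∑ j, f (v j) • interior (g j) a := by
  simp only [evenDer_apply, map_sum, ← Finset.sum_sub_distrib]
  refine Finset.sum_congr rfl fun j _ => ?_
  rw [interior_ι_mul, interior_comm f, mul_neg]
  abel

end Gam

/-! ### Derivatives of superfunctions in a frame -/

section Sections

variable {m n : ℕ} {M : Type*} [TopologicalSpace M] [ChartedSpace (EuclideanSpace ℝ (Fin m)) M]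
  {F : Type*} [NormedAddCommGroup F] [NormedSpace ℝ F]
  {R : M → Type*} [TopologicalSpace (TotalSpace F R)]
  [∀ p, Ring (R p)] [∀ p, Algebra ℝ (R p)] [∀ p, TopologicalSpace (R p)] [FiberBundle F R]
  [SuperalgebraBundle m F R n] [VectorBundle ℝ F R] [FiniteDimensional ℝ F]
  [IsManifold (𝓡 m) ∞ M] [T2Space M] [SigmaCompactSpace M]

namespace Frame

variable {p : M} (fr : Frame m F R p) (X : VectorField m M)

/-- The derivative at `p` along `X` of the coordinates of a superfunction. -/
def jet : SuperFun m F R →ₗ[ℝ] Model n where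
  toFun η := ∑ k, lieDeriv m X (fr.functional ((modelBasis n).coord k) η) p • modelBasis n k
  map_add' η θ := by
    rw [← Finset.sum_add_distrib]
    refine Finset.sum_congr rfl fun k _ => ?_
    rw [← add_smul, ← lieDeriv_add]
    congr 2
    ext q
    change fr.χ q * _ = fr.χ q * _ + fr.χ q * _
    rw [← mul_add, ← map_add, ← map_add]
    rfl
  map_smul' c η := by
    rw [Finset.smul_sum]
    refine Finset.sum_congr rfl fun k _ => ?_
    rw [RingHom.id_apply, smul_smul, ← lieDeriv_smul]
    congr 2
    ext q
    change fr.χ q * _ = c * (fr.χ q * _)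
    rw [ContMDiffSection.coe_smul, Pi.smul_apply, map_smul, map_smul, smul_eq_mul]
    ring

theorem apply_jet (l : Model n →ₗ[ℝ] ℝ) (η : SuperFun m F R) :
    l (fr.jet X η) = lieDeriv m X (fr.functional l η) p := by
  have h : fr.functional l η =
      ∑ k, l (modelBasis n k) • fr.functional ((modelBasis n).coord k) η := by
    ext q
    have hs := map_sum (⟨⟨fun f : C^∞⟮𝓡 m, M; ℝ⟯ => f q, rfl⟩, fun _ _ => rfl⟩ : _ →+ ℝ)
      (fun k => l (modelBasis n k) • fr.functional ((modelBasis n).coord k) η) Finset.univ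
    refine Eq.trans ?_ hs.symm
    change fr.χ q * l _ = ∑ k, l (modelBasis n k) * (fr.χ q * _)
    conv_lhs => rw [← (modelBasis n).sum_repr ((fr.φ q).symm (η q)), map_sum, Finset.mul_sum]
    refine Finset.sum_congr rfl fun k _ => ?_
    rw [map_smul, smul_eq_mul, Module.Basis.coord_apply]
    ring
  rw [h, lieDeriv_sum]
  change l (∑ k : Fin (Module.finrank ℝ (Model n)), _) = _
  rw [map_sum]
  refine Finset.sum_congr rfl fun k _ => ?_
  rw [map_smul, lieDeriv_smul, smul_eq_mul, mul_comm]

theorem model_ext {a b : Model n} (h : ∀ l : Model n →ₗ[ℝ] ℝ, l a = l b) : a = b :=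
  (modelBasis n).ext_elem fun k => h ((modelBasis n).coord k)

theorem jet_congr {η θ : SuperFun m F R} (h : ∀ᶠ q in 𝓝 p, η q = θ q) :
    fr.jet X η = fr.jet X θ := by
  refine model_ext fun l => ?_
  rw [apply_jet, apply_jet]
  refine lieDeriv_congr X ?_
  filter_upwards [h] with q hq
  rw [functional_apply, functional_apply, hq]

theorem lieDeriv_χ_mul (f : C^∞⟮𝓡 m, M; ℝ⟯) : lieDeriv m X (fr.χ * f) p = lieDeriv m X f p := by
  refine lieDeriv_congr X ?_
  filter_upwards [fr.χ_eventually] with q hq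
  rw [ContMDiffMap.coe_mul, Pi.mul_apply, hq, one_mul]

theorem functional_self (l : Model n →ₗ[ℝ] ℝ) (η : SuperFun m F R) :
    fr.functional l η p = l ((fr.φ p).symm (η p)) := by
  rw [functional_apply, χ_self, one_mul]

theorem jet_mul (η θ : SuperFun m F R) : fr.jet X (η * θ) =
    fr.jet X η * (fr.φ p).symm (θ p) + (fr.φ p).symm (η p) * fr.jet X θ := by
  let b := modelBasis n
  refine model_ext fun l => ?_
  have h : fr.χ * fr.functional l (η * θ) = ∑ i, ∑ j, l (b i * b j) •
      (fr.functional (b.coord i) η * fr.functional (b.coord j) θ) := by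
    ext q
    have hs := map_sum (⟨⟨fun f : C^∞⟮𝓡 m, M; ℝ⟯ => f q, rfl⟩, fun _ _ => rfl⟩ : _ →+ ℝ)
      (fun i => ∑ j, l (b i * b j) •
      (fr.functional (b.coord i) η * fr.functional (b.coord j) θ)) Finset.univ
    refine Eq.trans ?_ hs.symm
    have e : ∀ i, (⟨⟨fun f : C^∞⟮𝓡 m, M; ℝ⟯ => f q, rfl⟩, fun _ _ => rfl⟩ : _ →+ ℝ) (∑ j,
        l (b i * b j) • (fr.functional (b.coord i) η * fr.functional (b.coord j) θ)) =
        ∑ j, l (b i * b j) * ((fr.χ q * b.coord i ((fr.φ q).symm (η q))) *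
          (fr.χ q * b.coord j ((fr.φ q).symm (θ q)))) := fun i => map_sum _ _ _
    simp only [e]
    change fr.χ q * (fr.χ q * l ((fr.φ q).symm (η q * θ q))) = _
    rw [map_mul]
    conv_lhs => rw [← b.sum_repr ((fr.φ q).symm (η q)), ← b.sum_repr ((fr.φ q).symm (θ q)),
      Finset.sum_mul_sum, map_sum, Finset.mul_sum, Finset.mul_sum]
    refine Finset.sum_congr rfl fun i _ => ?_
    rw [map_sum, Finset.mul_sum, Finset.mul_sum]
    refine Finset.sum_congr rfl fun j _ => ?_
    rw [smul_mul_smul_comm, map_smul, smul_eq_mul, Module.Basis.coord_apply,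
      Module.Basis.coord_apply]
    ring
  rw [apply_jet, ← fr.lieDeriv_χ_mul, h, lieDeriv_sum]
  conv_rhs => rw [← b.sum_repr ((fr.φ p).symm (η p)), ← b.sum_repr ((fr.φ p).symm (θ p))]
  change _ = l ((∑ i, _ • b i) * _ + _ * ∑ j, _ • b j)
  rw [Finset.sum_mul_sum, Finset.sum_mul_sum, ← Finset.sum_add_distrib, map_sum]
  refine Finset.sum_congr rfl fun i _ => ?_
  rw [← Finset.sum_add_distrib, map_sum, lieDeriv_sum]
  refine Finset.sum_congr rfl fun j _ => ?_
  rw [lieDeriv_smul, lieDeriv_mul, smul_mul_smul_comm, smul_mul_smul_comm, ← add_smul, map_smul,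
    functional_self, functional_self, smul_eq_mul, mul_comm]
  rfl

theorem jet_smul_one (f : C^∞⟮𝓡 m, M; ℝ⟯) :
    fr.jet X (f • (1 : SuperFun m F R)) = lieDeriv m X f p • 1 := by
  refine model_ext fun l => ?_
  have h : fr.functional l (f • (1 : SuperFun m F R)) = fr.χ * (l 1 • f) := by
    ext q
    change fr.χ q * l ((fr.φ q).symm (f q • 1)) = fr.χ q * (l 1 * f q)
    rw [map_smul, map_one, map_smul, smul_eq_mul, mul_comm (f q)]
  rw [apply_jet, h, lieDeriv_χ_mul, lieDeriv_smul, map_smul, smul_eq_mul, mul_comm]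

theorem invol_jet {i : ZMod 2} {η : SuperFun m F R} (hη : IsHomogeneous m F R i η) :
    invol (fr.jet X η) = sgn 1 i • fr.jet X η := by
  refine model_ext fun l => ?_
  have h := fr.apply_jet X (l ∘ₗ (invol (V := Fin n → ℝ)).toLinearMap) η
  refine h.trans ?_
  rw [map_smul, apply_jet, smul_eq_mul, ← lieDeriv_smul]
  congr 1
  ext q
  change fr.χ q * l (invol ((fr.φ q).symm (η q))) = sgn 1 i * (fr.χ q * l ((fr.φ q).symm (η q)))
  by_cases hq : fr.χ q = 0
  · rw [hq, zero_mul, zero_mul, mul_zero]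
  · rw [mem_extParity_iff.1 ((fr.mem_parity_iff (fr.mem_of_ne hq)).1 (hη q)), map_smul,
      smul_eq_mul]
    ring

theorem aug_jet (η : SuperFun m F R) :
    aug (fr.jet X η) = lieDeriv m X ⟨fun q => eps m F q (η q), contMDiff_eps η⟩ p := by
  refine (fr.apply_jet X (aug (V := Fin n → ℝ)).toLinearMap η).trans ?_
  rw [← fr.lieDeriv_χ_mul X ⟨fun q => eps m F q (η q), contMDiff_eps η⟩]
  congr 1
  ext q
  exact congrArg (fr.χ q * ·) (eps_eq (fr.φ q) (η q)).symm

theorem jet_add_left (Y : VectorField m M) (η : SuperFun m F R) :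
    fr.jet (X + Y) η = fr.jet X η + fr.jet Y η := by
  refine model_ext fun l => ?_
  rw [map_add]
  simp only [apply_jet]
  exact lieDeriv_add_left X _ p Y

theorem jet_smul_left (f : C^∞⟮𝓡 m, M; ℝ⟯) (η : SuperFun m F R) :
    fr.jet (f • X) η = f p • fr.jet X η := by
  refine model_ext fun l => ?_
  rw [map_smul]
  simp only [apply_jet]
  exact lieDeriv_smul_left X _ p f

end Frame

theorem isSmoothExt_ι {σ : ∀ p, Codir (R p)} (hσ : IsSmoothCodir m F R σ) :
    IsSmoothExt m F R fun p => ExteriorAlgebra.ι ℝ (σ p) := fun _ =>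
  ⟨Set.univ, isOpen_univ, trivial, fun p => ExteriorAlgebra.ι ℝ (σ p),
    Algebra.subset_adjoin (Or.inr ⟨σ, hσ, fun _ => rfl⟩), fun _ _ => rfl⟩

namespace Straightening

variable (Ψ : Straightening m F R) {p : M} (fr : Frame m F R p) (nabla : Connection m F R)
  (X : VectorField m M)

/-- The trivialization by means of a straightening. -/
def adapt : Frame m F R p :=
  fr.adapt Ψ.parity_iff fun _ hσ => Ψ.map_contMDiff (isSmoothExt_ι hσ)

theorem adapt_apply (q : M) (x : Model n) : (Ψ.adapt fr).φ q x =
    Ψ.toFun q (ExteriorAlgebra.map (codirEquiv (fr.φ q)).toLinearMap x) := rfl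

theorem adapt_symm_contractAt (q : M) (t : Dir (R q)) (a : R q) :
    ((Ψ.adapt fr).φ q).symm (Ψ.contractAt q t a) =
      interior (t ∘ₗ (codirEquiv (fr.φ q)).toLinearMap) (((Ψ.adapt fr).φ q).symm a) := by
  rw [AlgEquiv.symm_apply_eq, adapt_apply, ← map_contract, contractAt_apply]
  refine congrArg (fun w => Ψ.toFun q (contract t w)) ?_
  rw [AlgEquiv.symm_apply_eq, ← adapt_apply, AlgEquiv.apply_symm_apply]

theorem adapt_symm_oddOp (s : OddSection m F R) (η : SuperFun m F R) (q : M) :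
    ((Ψ.adapt fr).φ q).symm (Ψ.oddOp s η q) =
      interior (s.1 q ∘ₗ (codirEquiv (fr.φ q)).toLinearMap) (((Ψ.adapt fr).φ q).symm (η q)) :=
  Ψ.adapt_symm_contractAt fr q (s.1 q) (η q)

/-- The covariant derivatives along `X` of the odd directions of a frame. -/
def connForm (j : Fin n) : Module.Dual ℝ (Fin n → ℝ) :=
  (nabla.toFun X (fr.dir ((Pi.basisFun ℝ (Fin n)).coord j))).1 p ∘ₗ
    (codirEquiv (fr.φ p)).toLinearMap

/-- The covariant derivative along `X` of a superfunction at `p`, in the coordinates of a frame. -/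
def covDer : SuperFun m F R →ₗ[ℝ] Model n where
  toFun η := (Ψ.adapt fr).jet X η -
    evenDer (Pi.basisFun ℝ (Fin n)) (connForm fr nabla X) (((Ψ.adapt fr).φ p).symm (η p))
  map_add' η θ := by
    rw [map_add, ContMDiffSection.coe_add, Pi.add_apply, map_add, map_add]
    abel
  map_smul' c η := by
    rw [map_smul, ContMDiffSection.coe_smul, Pi.smul_apply, map_smul, map_smul, RingHom.id_apply,
      smul_sub]

theorem covDer_apply (η : SuperFun m F R) : Ψ.covDer fr nabla X η = (Ψ.adapt fr).jet X η -
    evenDer (Pi.basisFun ℝ (Fin n)) (connForm fr nabla X) (((Ψ.adapt fr).φ p).symm (η p)) := rfl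

theorem covDer_mul (η θ : SuperFun m F R) : Ψ.covDer fr nabla X (η * θ) =
    Ψ.covDer fr nabla X η * ((Ψ.adapt fr).φ p).symm (θ p) +
      ((Ψ.adapt fr).φ p).symm (η p) * Ψ.covDer fr nabla X θ := by
  simp only [covDer_apply, Frame.jet_mul, mul_section_apply, map_mul, evenDer_mul, sub_mul, mul_sub]
  abel

theorem covDer_smul_one (f : C^∞⟮𝓡 m, M; ℝ⟯) :
    Ψ.covDer fr nabla X (f • (1 : SuperFun m F R)) = lieDeriv m X f p • 1 := by
  have h : evenDer (Pi.basisFun ℝ (Fin n)) (connForm fr nabla X) 1 = 0 := by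
    have := evenDer_mul (Pi.basisFun ℝ (Fin n)) (connForm fr nabla X) 1 1
    simpa using this
  rw [covDer_apply, Frame.jet_smul_one, smul_section_apply, one_section_apply, map_smul, map_one,
    map_smul, h, smul_zero, sub_zero]

theorem aug_covDer (η : SuperFun m F R) : aug (Ψ.covDer fr nabla X η) =
    lieDeriv m X ⟨fun q => eps m F q (η q), contMDiff_eps η⟩ p := by
  rw [covDer_apply, map_sub, aug_evenDer, sub_zero, Frame.aug_jet]

theorem covDer_mem_parity {i : ZMod 2} {η : SuperFun m F R} (hη : IsHomogeneous m F R i η) :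
    Ψ.covDer fr nabla X η ∈ extParity (Fin n → ℝ) i := by
  rw [mem_extParity_iff, covDer_apply, map_sub, Frame.invol_jet _ _ hη, invol_evenDer,
    mem_extParity_iff.1 (((Ψ.adapt fr).mem_parity_iff (Ψ.adapt fr).mem).1 (hη p)), map_smul,
    smul_sub]

theorem jet_oddOp (s : OddSection m F R) (η : SuperFun m F R) :
    (Ψ.adapt fr).jet X (Ψ.oddOp s η) =
      ∑ j, (lieDeriv m X (fr.oddCoord (Pi.basisFun ℝ (Fin n) j) s) p •
        interior ((Pi.basisFun ℝ (Fin n)).coord j) (((Ψ.adapt fr).φ p).symm (η p)) +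
        fr.oddCoord (Pi.basisFun ℝ (Fin n) j) s p •
          interior ((Pi.basisFun ℝ (Fin n)).coord j) ((Ψ.adapt fr).jet X η)) := by
  let e := Pi.basisFun ℝ (Fin n)
  refine Frame.model_ext fun l => ?_
  have h : (Ψ.adapt fr).χ * (Ψ.adapt fr).functional l (Ψ.oddOp s η) = ∑ j,
      fr.oddCoord (e j) s * (Ψ.adapt fr).functional (l ∘ₗ interior (e.coord j)) η := by
    ext q
    have hs := map_sum (⟨⟨fun f : C^∞⟮𝓡 m, M; ℝ⟯ => f q, rfl⟩, fun _ _ => rfl⟩ : _ →+ ℝ)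
      (fun j => fr.oddCoord (e j) s * (Ψ.adapt fr).functional (l ∘ₗ interior (e.coord j)) η)
      Finset.univ
    refine Eq.trans ?_ hs.symm
    change fr.χ q * (fr.χ q * l (((Ψ.adapt fr).φ q).symm (Ψ.oddOp s η q))) = ∑ j,
      fr.oddCoord (e j) s q * (fr.χ q * l (interior (e.coord j) (((Ψ.adapt fr).φ q).symm (η q))))
    have hexp : s.1 q ∘ₗ (codirEquiv (fr.φ q)).toLinearMap =
        ∑ j, s.1 q (codirEquiv (fr.φ q) (e j)) • e.coord j := by
      refine e.ext fun i => ?_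
      rw [LinearMap.sum_apply, Finset.sum_eq_single i]
      · simp
      · intro j _ hj
        simp [e, hj]
      · simp
    rw [adapt_symm_oddOp, hexp, interior_sum_left, map_sum, Finset.mul_sum, Finset.mul_sum]
    refine Finset.sum_congr rfl fun j _ => ?_
    rw [interior_smul_left, map_smul, Frame.oddCoord_apply, smul_eq_mul]
    ring
  rw [Frame.apply_jet, ← (Ψ.adapt fr).lieDeriv_χ_mul, h, lieDeriv_sum, map_sum]
  refine Finset.sum_congr rfl fun j _ => ?_
  rw [lieDeriv_mul, map_add, map_smul, map_smul, smul_eq_mul, smul_eq_mul, ← Frame.apply_jet,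
    Frame.functional_self]
  rfl

theorem connection_apply (s : OddSection m F R) : (nabla.toFun X s).1 p =
    ∑ j, (lieDeriv m X (fr.oddCoord (Pi.basisFun ℝ (Fin n) j) s) p •
      (fr.dir ((Pi.basisFun ℝ (Fin n)).coord j)).1 p +
      fr.oddCoord (Pi.basisFun ℝ (Fin n) j) s p •
        (nabla.toFun X (fr.dir ((Pi.basisFun ℝ (Fin n)).coord j))).1 p) := by
  have h := congrArg (fun s => (nabla.toFun X s).1 p) (fr.sum_oddCoord_smul_dir s)
  simp only [map_sum, Frame.sum_oddSection_apply, nabla.leibniz] at h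
  rw [← h, fr.lieDeriv_χ_mul, ContMDiffMap.coe_mul, Pi.mul_apply, fr.χ_self, one_mul, one_smul]
  have h1 : lieDeriv m X fr.χ p = 0 := by
    rw [← lieDeriv_const X p 1]
    refine lieDeriv_congr X ?_
    filter_upwards [fr.χ_eventually] with q hq
    exact hq
  rw [h1, zero_smul, zero_add]

theorem covDer_oddOp (s : OddSection m F R) (η : SuperFun m F R) :
    Ψ.covDer fr nabla X (Ψ.oddOp s η) =
      interior (s.1 p ∘ₗ (codirEquiv (fr.φ p)).toLinearMap) (Ψ.covDer fr nabla X η) +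
      interior ((nabla.toFun X s).1 p ∘ₗ (codirEquiv (fr.φ p)).toLinearMap)
        (((Ψ.adapt fr).φ p).symm (η p)) := by
  have h1 : (nabla.toFun X s).1 p ∘ₗ (codirEquiv (fr.φ p)).toLinearMap =
      ∑ j, (lieDeriv m X (fr.oddCoord (Pi.basisFun ℝ (Fin n) j) s) p •
        (Pi.basisFun ℝ (Fin n)).coord j +
        fr.oddCoord (Pi.basisFun ℝ (Fin n) j) s p • connForm fr nabla X j) := by
    rw [connection_apply fr]
    refine LinearMap.ext fun v => ?_
    rw [LinearMap.comp_apply, LinearMap.sum_apply, LinearMap.sum_apply]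
    refine Finset.sum_congr rfl fun j _ => ?_
    rw [Frame.dir_apply, fr.χ_self, one_smul]
    simp [connForm]
  have h2 : s.1 p ∘ₗ (codirEquiv (fr.φ p)).toLinearMap =
      ∑ j, fr.oddCoord (Pi.basisFun ℝ (Fin n) j) s p • (Pi.basisFun ℝ (Fin n)).coord j := by
    refine (Pi.basisFun ℝ (Fin n)).ext fun i => ?_
    rw [LinearMap.sum_apply, Finset.sum_eq_single i]
    · simp [Frame.oddCoord_apply]
    · intro j _ hj
      simp [hj]
    · simp
  have h3 : ∀ j, (s.1 p ∘ₗ (codirEquiv (fr.φ p)).toLinearMap) (Pi.basisFun ℝ (Fin n) j) =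
      fr.oddCoord (Pi.basisFun ℝ (Fin n) j) s p := by
    intro j
    rw [Frame.oddCoord_apply, fr.χ_self, one_mul]
    rfl
  rw [covDer_apply, jet_oddOp, adapt_symm_oddOp, evenDer_interior, covDer_apply, map_sub]
  simp only [h3, h1, interior_sum_left, interior_add_left, interior_smul_left,
    Finset.sum_add_distrib]
  rw [h2]
  simp only [interior_sum_left, interior_smul_left]
  abel

theorem covDer_congr {η θ : SuperFun m F R} (h : ∀ᶠ q in 𝓝 p, η q = θ q) :
    Ψ.covDer fr nabla X η = Ψ.covDer fr nabla X θ := by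
  rw [covDer_apply, covDer_apply, Frame.jet_congr _ _ h, h.self_of_nhds]

theorem covDer_add_left (Y : VectorField m M) (η : SuperFun m F R) :
    Ψ.covDer fr nabla (X + Y) η = Ψ.covDer fr nabla X η + Ψ.covDer fr nabla Y η := by
  have h : connForm fr nabla (X + Y) = connForm fr nabla X + connForm fr nabla Y := by
    funext j
    rw [connForm, map_add]
    rfl
  simp only [covDer_apply, Frame.jet_add_left, h, evenDer_add_right]
  abel

theorem covDer_smul_left (f : C^∞⟮𝓡 m, M; ℝ⟯) (η : SuperFun m F R) :
    Ψ.covDer fr nabla (f • X) η = f p • Ψ.covDer fr nabla X η := by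
  have h : connForm fr nabla (f • X) = f p • connForm fr nabla X := by
    funext j
    rw [connForm, map_smul]
    rfl
  simp only [covDer_apply, Frame.jet_smul_left, h, evenDer_smul_right, smul_sub]

end Straightening

namespace Straightening

variable (Ψ : Straightening m F R) (nabla : Connection m F R) (X : VectorField m M) (p : M)

/-- The covariant derivative along `X` of a superfunction at `p`. -/
def evenAt : SuperFun m F R →ₗ[ℝ] R p :=
  ((Ψ.adapt (frame m F R p)).φ p).toLinearMap ∘ₗ Ψ.covDer (frame m F R p) nabla X

theorem evenAt_apply (η : SuperFun m F R) : Ψ.evenAt nabla X p η =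
    (Ψ.adapt (frame m F R p)).φ p (Ψ.covDer (frame m F R p) nabla X η) := rfl

theorem evenAt_mul (η θ : SuperFun m F R) : Ψ.evenAt nabla X p (η * θ) =
    Ψ.evenAt nabla X p η * θ p + η p * Ψ.evenAt nabla X p θ := by
  simp only [evenAt_apply, covDer_mul, map_add, map_mul, AlgEquiv.apply_symm_apply]

theorem evenAt_smul_one (f : C^∞⟮𝓡 m, M; ℝ⟯) :
    Ψ.evenAt nabla X p (f • (1 : SuperFun m F R)) = lieDeriv m X f p • 1 := by
  rw [evenAt_apply, covDer_smul_one, map_smul, map_one]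

theorem eps_evenAt (η : SuperFun m F R) : eps m F p (Ψ.evenAt nabla X p η) =
    lieDeriv m X ⟨fun q => eps m F q (η q), contMDiff_eps η⟩ p := by
  rw [eps_eq ((Ψ.adapt (frame m F R p)).φ p), evenAt_apply, AlgEquiv.symm_apply_apply, aug_covDer]

theorem evenAt_mem_parity {i : ZMod 2} {η : SuperFun m F R} (hη : IsHomogeneous m F R i η) :
    Ψ.evenAt nabla X p η ∈ SuperalgebraBundle.parity m F (R := R) p i := by
  rw [(Ψ.adapt (frame m F R p)).mem_parity_iff (Ψ.adapt (frame m F R p)).mem, evenAt_apply,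
    AlgEquiv.symm_apply_apply]
  exact Ψ.covDer_mem_parity _ nabla X hη

theorem evenAt_oddOp (s : OddSection m F R) (η : SuperFun m F R) :
    Ψ.evenAt nabla X p (Ψ.oddOp s η) =
      Ψ.contractAt p (s.1 p) (Ψ.evenAt nabla X p η) + Ψ.oddOp (nabla.toFun X s) η p := by
  refine ((Ψ.adapt (frame m F R p)).φ p).symm.injective ?_
  rw [map_add, adapt_symm_oddOp, adapt_symm_contractAt]
  simp only [evenAt_apply, AlgEquiv.symm_apply_apply]
  exact Ψ.covDer_oddOp _ nabla X s η

theorem isSmoothExt_of_mem {τ : ∀ p, ExteriorAlgebra ℝ (Codir (R p))}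
    (hτ : τ ∈ Algebra.adjoin ℝ ({τ : ∀ p, ExteriorAlgebra ℝ (Codir (R p)) |
          ∃ f : C^∞⟮𝓡 m, M; ℝ⟯, ∀ p, τ p = algebraMap ℝ _ (f p)} ∪
        {τ | ∃ σ, IsSmoothCodir m F R σ ∧ ∀ p, τ p = ExteriorAlgebra.ι ℝ (σ p)})) :
    IsSmoothExt m F R τ := fun _ =>
  ⟨Set.univ, isOpen_univ, trivial, τ, hτ, fun _ _ => rfl⟩

theorem isSmoothSection_evenAt_ι {σ : ∀ p, Codir (R p)} (hσ : IsSmoothCodir m F R σ) :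
    IsSmoothSection m F fun p => Ψ.evenAt nabla X p
      (Ψ.map (fun p => ExteriorAlgebra.ι ℝ (σ p)) (isSmoothExt_ι hσ)) := by
  refine isSmoothSection_of_der Ψ.isSmoothSection_contractAt (fun p a h0 h1 => ?_) ?_ fun s => ?_
  · have : Module.Finite ℝ (Codir (R p)) :=
      Module.Finite.equiv (codirEquiv ((frame m F R p).φ p))
    have h : (Ψ.toFun p).symm a = 0 := by
      refine eq_zero_of_contract_eq_zero ?_ fun t => ?_
      · rw [← eps_eq (m := m) (F := F), h1]
      · exact (Ψ.toFun p).injective ((h0 t).trans (map_zero _).symm)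
    rw [← (Ψ.toFun p).apply_symm_apply a, h, map_zero]
  · simp only [eps_evenAt]
    exact contMDiff_lieDeriv X _
  · let f : C^∞⟮𝓡 m, M; ℝ⟯ := ⟨fun p => s.1 p (σ p), s.2 σ hσ⟩
    let θ : SuperFun m F R := Ψ.map (fun p => ExteriorAlgebra.ι ℝ (σ p)) (isSmoothExt_ι hσ)
    have h : Ψ.oddOp s θ = f • (1 : SuperFun m F R) := by
      ext p
      rw [oddOp_apply]
      change Ψ.toFun p (contract (s.1 p) ((Ψ.toFun p).symm (Ψ.toFun p (ExteriorAlgebra.ι ℝ (σ p)))))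
        = _
      rw [AlgEquiv.symm_apply_apply, contract_ι, AlgEquiv.commutes, Algebra.algebraMap_eq_smul_one]
      rfl
    have h1 : ∀ p, Ψ.contractAt p (s.1 p) (Ψ.evenAt nabla X p θ) =
        (lieDerivFun X f • (1 : SuperFun m F R) - Ψ.oddOp (nabla.toFun X s) θ) p := by
      intro p
      have h2 := Ψ.evenAt_oddOp nabla X p s θ
      rw [h, evenAt_smul_one] at h2
      rw [ContMDiffSection.coe_sub, Pi.sub_apply, eq_sub_iff_add_eq]
      exact h2.symm
    change IsSmoothSection m F fun p => Ψ.contractAt p (s.1 p) (Ψ.evenAt nabla X p θ)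
    simp only [h1]
    exact ContMDiffSection.contMDiff _

theorem isSmoothSection_evenAt_smul_one (f : C^∞⟮𝓡 m, M; ℝ⟯) :
    IsSmoothSection m F fun p => Ψ.evenAt nabla X p (f • (1 : SuperFun m F R)) := by
  simp only [evenAt_smul_one]
  exact (lieDerivFun X f • (1 : SuperFun m F R)).contMDiff

theorem isSmoothSection_evenAt (η : SuperFun m F R) :
    IsSmoothSection m F fun p => Ψ.evenAt nabla X p η := by
  intro p₀
  obtain ⟨U, hU, hp, τ, hτ, hητ⟩ := Ψ.isSmoothExt_symm η p₀
  have h : ∀ h, IsSmoothSection m F fun p => Ψ.evenAt nabla X p (Ψ.map τ h) := by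
    clear hητ
    induction hτ using Algebra.adjoin_induction with
    | mem τ hτ =>
      intro h
      rcases hτ with ⟨f, hf⟩ | ⟨σ, hσ, hτ⟩
      · have e : Ψ.map τ h = f • (1 : SuperFun m F R) := by
          ext p
          change Ψ.toFun p (τ p) = _
          rw [hf, AlgEquiv.commutes, Algebra.algebraMap_eq_smul_one]
          rfl
        rw [e]
        exact Ψ.isSmoothSection_evenAt_smul_one nabla X f
      · obtain rfl : τ = fun p => ExteriorAlgebra.ι ℝ (σ p) := funext hτ
        exact Ψ.isSmoothSection_evenAt_ι nabla X hσ
    | algebraMap r =>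
      intro h
      have e : Ψ.map _ h = (ContMDiffMap.const r : C^∞⟮𝓡 m, M; ℝ⟯) • (1 : SuperFun m F R) := by
        ext p
        change Ψ.toFun p (algebraMap ℝ _ r) = _
        rw [AlgEquiv.commutes, Algebra.algebraMap_eq_smul_one]
        rfl
      rw [e]
      exact Ψ.isSmoothSection_evenAt_smul_one nabla X _
    | add x y hx' hy' hx hy =>
      intro h
      have e : Ψ.map _ h =
          Ψ.map x (isSmoothExt_of_mem hx') + Ψ.map y (isSmoothExt_of_mem hy') := by
        ext p
        exact map_add (Ψ.toFun p) (x p) (y p)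
      simp only [e, map_add]
      exact (hx _).add_section (hy _)
    | mul x y hx' hy' hx hy =>
      intro h
      have e : Ψ.map _ h =
          Ψ.map x (isSmoothExt_of_mem hx') * Ψ.map y (isSmoothExt_of_mem hy') := by
        ext p
        exact map_mul (Ψ.toFun p) (x p) (y p)
      simp only [e, evenAt_mul]
      exact (contMDiff_mul ⟨_, hx _⟩ (Ψ.map y (isSmoothExt_of_mem hy'))).add_section
        (contMDiff_mul (Ψ.map x (isSmoothExt_of_mem hx')) ⟨_, hy _⟩)
  refine (h (isSmoothExt_of_mem hτ) p₀).congr_of_eventuallyEq ?_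
  filter_upwards [hU.mem_nhds hp] with p hp
  refine congrArg (fun a => TotalSpace.mk p ((Ψ.adapt (frame m F R p)).φ p a)) ?_
  refine Ψ.covDer_congr _ nabla X ?_
  filter_upwards [hU.mem_nhds hp] with q hq
  change η q = Ψ.toFun q (τ q)
  rw [← hητ q hq, AlgEquiv.apply_symm_apply]

/-- The covariant derivative along `X` of superfunctions. -/
def evenOp : SuperFun m F R →ₗ[ℝ] SuperFun m F R where
  toFun η := ⟨fun p => Ψ.evenAt nabla X p η, Ψ.isSmoothSection_evenAt nabla X η⟩
  map_add' η θ := by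
    ext p
    exact map_add (Ψ.evenAt nabla X p) η θ
  map_smul' c η := by
    ext p
    exact map_smul (Ψ.evenAt nabla X p) c η

theorem evenOp_mem : Ψ.evenOp nabla X ∈ SuperDer m F R 0 := by
  refine ⟨fun j η hη p => ?_, fun j η θ _ => ?_⟩
  · rw [zero_add]
    exact Ψ.evenAt_mem_parity nabla X p hη
  · ext p
    rw [sgn_zero_left, one_smul]
    exact Ψ.evenAt_mul nabla X p η θ

/-- The even part of the inclusion which corresponds to a straightening and a connection. -/
def even : VectorField m M →ₗ[C^∞⟮𝓡 m, M; ℝ⟯] SuperDer m F R 0 where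
  toFun X := ⟨Ψ.evenOp nabla X, Ψ.evenOp_mem nabla X⟩
  map_add' X Y := by
    refine Subtype.ext (LinearMap.ext fun η => ?_)
    ext p
    change Ψ.evenAt nabla (X + Y) p η = Ψ.evenAt nabla X p η + Ψ.evenAt nabla Y p η
    rw [evenAt_apply, covDer_add_left, map_add]
    rfl
  map_smul' f X := by
    refine Subtype.ext (LinearMap.ext fun η => ?_)
    ext p
    change Ψ.evenAt nabla (f • X) p η = f p • Ψ.evenAt nabla X p η
    rw [evenAt_apply, covDer_smul_left, map_smul]
    rfl

/-- The inclusion which corresponds to a straightening and a connection. -/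
def inclusion : Inclusion m F R where
  even := Ψ.even nabla
  odd := Ψ.odd
  even_injective X p h := by
    refine eq_zero_of_lieDeriv fun f => ?_
    have h1 := h f
    change Ψ.evenAt nabla X p (f • 1) ∈ nilIdeal (R p) at h1
    rwa [evenAt_smul_one, mem_nilIdeal_iff_eps (m := m) (F := F), map_smul, map_one, smul_eq_mul,
      mul_one] at h1
  odd_injective := Ψ.odd_injective

theorem inclusion_oddCommute : (Ψ.inclusion nabla).OddCommute := by
  intro s t
  refine LinearMap.ext fun η => ?_
  ext p
  refine (Ψ.toFun p).symm.injective ?_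
  change (Ψ.toFun p).symm (Ψ.oddOp s (Ψ.oddOp t η) p - sgn 1 1 • Ψ.oddOp t (Ψ.oddOp s η) p) =
    (Ψ.toFun p).symm 0
  rw [sgn_one_one, neg_one_smul, sub_neg_eq_add, map_add, map_zero]
  simp only [symm_oddOp_apply]
  rw [contract_comm, neg_add_cancel]

theorem inclusion_compatible : (Ψ.inclusion nabla).Compatible nabla := by
  intro X s
  refine LinearMap.ext fun η => ?_
  ext p
  change Ψ.evenAt nabla X p (Ψ.oddOp s η) -
    sgn 0 1 • Ψ.contractAt p (s.1 p) (Ψ.evenAt nabla X p η) = Ψ.oddOp (nabla.toFun X s) η p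
  rw [evenAt_oddOp, sgn_zero_left, one_smul, add_sub_cancel_left]

theorem inclusion_intertwines : Ψ.Intertwines (Ψ.inclusion nabla) := by
  intro s w hw p
  change _ = Ψ.toFun p (contract (s.1 p) ((Ψ.toFun p).symm (Ψ.toFun p (w p))))
  rw [AlgEquiv.symm_apply_apply]

end Straightening

end Sections

end Supermanifold

end

theorem mainTheorem5 {m n : ℕ} (hn : 1 ≤ n)
    {M : Type*} [TopologicalSpace M] [T2Space M] [SigmaCompactSpace M]
    [ChartedSpace (EuclideanSpace ℝ (Fin m)) M] [IsManifold (𝓡 m) ∞ M]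
    {F : Type*} [NormedAddCommGroup F] [NormedSpace ℝ F] [FiniteDimensional ℝ F]
    {R : M → Type*} [TopologicalSpace (TotalSpace F R)]
    [∀ p, Ring (R p)] [∀ p, Algebra ℝ (R p)] [∀ p, TopologicalSpace (R p)]
    [FiberBundle F R] [VectorBundle ℝ F R] [ContMDiffVectorBundle ∞ F R (𝓡 m)]
    [Supermanifold.SuperalgebraBundle m F R n] :
    (∃! B : {x : Supermanifold.Inclusion m F R × Supermanifold.Connection m F R //
          x.1.OddCommute ∧ x.1.Compatible x.2} ≃
        Supermanifold.Straightening m F R × Supermanifold.Connection m F R,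
      ∀ x, (B x).2 = x.1.2 ∧ (B x).1.Intertwines x.1.1) ∧
    ∀ x y : {x : Supermanifold.Inclusion m F R × Supermanifold.Connection m F R //
          x.1.OddCommute ∧ x.1.Compatible x.2},
      x.1.1 = y.1.1 → x = y := by
  classical
  let P := {x : Supermanifold.Inclusion m F R × Supermanifold.Connection m F R //
    x.1.OddCommute ∧ x.1.Compatible x.2}
  choose str hstr using fun x : P => x.2.1.exists_straightening hn
  have hbij : Function.Bijective fun x : P => (str x, x.1.2) := by
    refine ⟨fun x y h => ?_, fun y => ?_⟩
    · obtain ⟨h1, h2⟩ := Prod.ext_iff.1 h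
      have hx := hstr x
      have hc := x.2.2
      rw [show str x = str y from h1] at hx
      rw [show x.1.2 = y.1.2 from h2] at hc
      exact Subtype.ext
        (Prod.ext (Supermanifold.Inclusion.ext_of_intertwines hn hx (hstr y) hc y.2.2) h2)
    · let x : P := ⟨(y.1.inclusion y.2, y.2), y.1.inclusion_oddCommute y.2,
        y.1.inclusion_compatible y.2⟩
      exact ⟨x, Prod.ext ((hstr x).unique (y.1.inclusion_intertwines y.2)) rfl⟩
  refine ⟨⟨Equiv.ofBijective _ hbij, fun x => ⟨rfl, hstr x⟩, fun B hB => ?_⟩, fun x y h => ?_⟩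
  · refine Equiv.ext fun x => Prod.ext ?_ (hB x).1
    exact (hB x).2.unique (hstr x)
  · have hc := x.2.2
    rw [h] at hc
    exact Subtype.ext (Prod.ext h (hc.unique y.2.2))
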